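/- Let $M$ be a smooth manifold of dimension $n$, let $r\ge 0$ be an integer and let $\sigma\in\Omega^{r+1}(M)$ be a closed form. **The small DGLA.** $\mathfrak g_{r,\sigma}=\mathfrak X(M)[1]\oplus\mathfrak X(M)\oplus\Omega(M)[r]$. Write $\iota_X$ (degree $-1$) and $L_X$ (degree $0$) for the elements of $\mathfrak X[1]$ and $\mathfrak X$ given by a vector field $X$, and $|\alpha|=\deg\alpha-r$ for $\alpha\in\Omega[r]$. The bracket is the graded skew-symmetric one with $$\{\iota_X,\alpha\}=\iota_X\alpha,\quad \{L_X,\alpha\}=\mathcal L_X\alpha,\quad \{L_X,L_Y\}=L_{[X,Y]},\quad \{L_X,\iota_Y\}=\iota_{[X,Y]},\quad \{\iota_X,\iota_Y\}=0,\quad \{\alpha,\beta\}=0,$$ and the differential is $d_\sigma=d+\{\sigma,-\}$ with $d\,\iota_X=L_X$, $d\,L_X=0$ and $d\alpha$ the de Rham differential of $\alpha$. **The large DGLA.** $\mathfrak G_{r,\sigma}=\mathcal C(T^*[r]T[1]M)[r]$. In local coordinates $x^i$ on $M$, a function on the graded manifold $T^*[r]T[1]M$ is a polynomial, with coefficients smooth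 in $x$, in graded commuting fibre coordinates $v^i$ (degree $1$), $p_i$ (degree $r-1$), $P_i$ (degree $r$). Under a change of coordinates $x\mapsto x'$ these transform by $$v'^i=\tfrac{\partial x'^i}{\partial x^j}v^j,\qquad p_j=\tfrac{\partial x'^i}{\partial x^j}p'_i,\qquad P_j=\tfrac{\partial x'^i}{\partial x^j}P'_i+\tfrac{\partial^2x'^i}{\partial x^j\partial x^k}v^kp'_i .$$ The bracket is the canonical $r$-Poisson bracket, i.e. the graded biderivation of degree $-r$ with $\{P_i,x^j\}=\delta_i^j=-\{x^j,P_i\}$, $\{p_i,v^j\}=\delta_i^j=(-1)^r\{v^j,p_i\}$ and all other brackets of coordinates zero. The differential is $d_\sigma=\{\mathcal S+\sigma,-\}$, where $\mathcal S=v^iP_i$ and a form $\alpha=\sum_I\alpha_I\,dx^I$ ($I$ running over increasing multi-indices) is regarded as the function $\sum_I\alpha_Iv^I$. **Claim.** $\mathfrak g_{r,\sigma}$ and $\mathfrak G_{r,\sigma}$ are differential graded Lie algebras, and there is a unique linear map $\mathfrak g_{r,\sigma}\to\mathfrak G_{r,\sigma}$ which in all local coordinates is given by $$\iota_X+L_Y+\alpha\;\longmapsto\;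 X^ip_i+\Big(Y^iP_i+\frac{\partial Y^i}{\partial x^j}v^jp_i\Big)+\sum_I\alpha_Iv^I ;$$ this map is an injective morphism of differential graded Lie algebras. -/

import Mathlib

open scoped Manifold ContDiff Topology

noncomputable section

namespace HigherCourant

/-! ## Differential graded Lie algebras

A graded vector space is given by its homogeneous components, a family `𝒢 : ℤ → Submodule ℝ V` of
independent subspaces of an ambient vector space `V`; the graded vector space is their (internal)
direct sum `⨆ i, 𝒢 i`. Operations are functions on `V`; only their values on `⨆ i, 𝒢 i` matter. -/

section DGLA

variable {V W : Type*} [AddCommGroup V] [Module ℝ V] [AddCommGroup W] [Module ℝ W]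

/-- The components `𝒢 i`, the differential `d` and the bracket `br` form a (cohomologically graded)
real differential graded Lie algebra. -/
structure IsDGLA (𝒢 : ℤ → Submodule ℝ V) (d : V → V) (br : V → V → V) : Prop where
  indep : iSupIndep 𝒢
  d_mem : ∀ i, ∀ a ∈ 𝒢 i, d a ∈ 𝒢 (i + 1)
  d_add : ∀ a ∈ ⨆ i, 𝒢 i, ∀ b ∈ ⨆ i, 𝒢 i, d (a + b) = d a + d b
  d_smul : ∀ (c : ℝ), ∀ a ∈ ⨆ i, 𝒢 i, d (c • a) = c • d a
  br_mem : ∀ i j, ∀ a ∈ 𝒢 i, ∀ b ∈ 𝒢 j, br a b ∈ 𝒢 (i + j)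
  br_add_left : ∀ a ∈ ⨆ i, 𝒢 i, ∀ b ∈ ⨆ i, 𝒢 i, ∀ c ∈ ⨆ i, 𝒢 i,
    br (a + b) c = br a c + br b c
  br_add_right : ∀ a ∈ ⨆ i, 𝒢 i, ∀ b ∈ ⨆ i, 𝒢 i, ∀ c ∈ ⨆ i, 𝒢 i,
    br a (b + c) = br a b + br a c
  br_smul_left : ∀ (c : ℝ), ∀ a ∈ ⨆ i, 𝒢 i, ∀ b ∈ ⨆ i, 𝒢 i, br (c • a) b = c • br a b
  br_smul_right : ∀ (c : ℝ), ∀ a ∈ ⨆ i, 𝒢 i, ∀ b ∈ ⨆ i, 𝒢 i, br a (c • b) = c • br a b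
  d_d : ∀ a ∈ ⨆ i, 𝒢 i, d (d a) = 0
  leibniz : ∀ i j, ∀ a ∈ 𝒢 i, ∀ b ∈ 𝒢 j,
    d (br a b) = br (d a) b + ((-1 : ℝ) ^ i) • br a (d b)
  skew : ∀ i j, ∀ a ∈ 𝒢 i, ∀ b ∈ 𝒢 j, br a b = -(((-1 : ℝ) ^ (i * j)) • br b a)
  jacobi : ∀ i j k, ∀ a ∈ 𝒢 i, ∀ b ∈ 𝒢 j, ∀ c ∈ 𝒢 k,
    br a (br b c) = br (br a b) c + ((-1 : ℝ) ^ (i * j)) • br b (br a c)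

/-- A linear map between the total spaces is a morphism of differential graded Lie algebras:
it preserves degrees and commutes with differentials and brackets. -/
structure IsDGLAHom (𝒢 : ℤ → Submodule ℝ V) (d : V → V) (br : V → V → V)
    (ℋ : ℤ → Submodule ℝ W) (d' : W → W) (br' : W → W → W)
    (φ : ↥(⨆ i, 𝒢 i) →ₗ[ℝ] ↥(⨆ i, ℋ i)) : Prop where
  map_degree : ∀ i, ∀ a : ↥(⨆ i, 𝒢 i), (a : V) ∈ 𝒢 i → (φ a : W) ∈ ℋ i
  map_d : ∀ a b : ↥(⨆ i, 𝒢 i), (b : V) = d a → (φ b : W) = d' (φ a)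
  map_br : ∀ a b c : ↥(⨆ i, 𝒢 i), (c : V) = br a b → (φ c : W) = br' (φ a) (φ b)

end DGLA

/-! ## Vector fields and differential forms on a smooth manifold -/

/-- The model space `ℝⁿ`. -/
abbrev Euc (n : ℕ) := EuclideanSpace ℝ (Fin n)

/-- The `j`-th standard basis vector of `ℝⁿ`. -/
abbrev basisVec {n : ℕ} (j : Fin n) : Euc n := EuclideanSpace.single j 1

section Manifold

variable {n : ℕ} {M : Type*} [TopologicalSpace M] [ChartedSpace (Euc n) M]

variable (n M) in
/-- All smooth local coordinate systems (charts of the maximal smooth atlas). -/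
abbrev Chart := {e : OpenPartialHomeomorph M (Euc n) //
  e ∈ IsManifold.maximalAtlas 𝓘(ℝ, Euc n) ∞ M}

variable (n M) in
/-- Not necessarily smooth vector fields. -/
abbrev VField := (x : M) → TangentSpace 𝓘(ℝ, Euc n) x

variable (n M) in
/-- Not necessarily smooth differential `k`-forms. -/
abbrev Form (k : ℕ) := (x : M) → (TangentSpace 𝓘(ℝ, Euc n) x) [⋀^Fin k]→L[ℝ] ℝ

variable (n M) in
/-- Not necessarily smooth inhomogeneous differential forms: one `k`-form for every `k`. -/
abbrev TotalForm := (k : ℕ) → Form n M k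

/-- The expression of a `k`-form in a chart: its pullback along the inverse of the chart. -/
def formInChart (e : OpenPartialHomeomorph M (Euc n)) {k : ℕ} (η : Form n M k) :
    Euc n → (Euc n) [⋀^Fin k]→L[ℝ] ℝ :=
  fun y ↦ (η (e.symm y)).compContinuousLinearMap
    (mfderiv 𝓘(ℝ, Euc n) 𝓘(ℝ, Euc n) e.symm y)

variable (n M) in
/-- The smooth vector fields `𝔛(M)`. -/
def smoothVField [IsManifold 𝓘(ℝ, Euc n) ∞ M] : Submodule ℝ (VField n M) where
  carrier := {X | ContMDiff 𝓘(ℝ, Euc n) 𝓘(ℝ, Euc n).tangent ∞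
    (fun x ↦ (⟨x, X x⟩ : TangentBundle 𝓘(ℝ, Euc n) M))}
  add_mem' := fun hX hY ↦ ContMDiff.add_section hX hY
  zero_mem' := Bundle.contMDiff_zeroSection ℝ (TangentSpace 𝓘(ℝ, Euc n) : M → Type _)
  smul_mem' := fun c _ hX ↦ ContMDiff.const_smul_section (a := c) hX

variable (n M) in
/-- The smooth `k`-forms `Ωᵏ(M)`. -/
def smoothForm (k : ℕ) : Submodule ℝ (Form n M k) where
  carrier := {η | ∀ e : Chart n M, ContDiffOn ℝ ∞ (formInChart e.1 η) e.1.target}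
  add_mem' := by
    intro a b ha hb e
    exact (ha e).add (hb e)
  zero_mem' := by
    intro e
    exact contDiffOn_const (c := (0 : (Euc n) [⋀^Fin k]→L[ℝ] ℝ))
  smul_mem' := by
    intro c a ha e
    exact (contDiffOn_const (c := c)).smul (ha e)

/-- The exterior derivative of a `k`-form, computed at `x` in the preferred chart at `x`. -/
def extD {k : ℕ} (η : Form n M k) : Form n M (k + 1) := fun x ↦
  (extDeriv (formInChart (chartAt (Euc n) x) η) (chartAt (Euc n) x x)).compContinuousLinearMap
    (mfderiv 𝓘(ℝ, Euc n) 𝓘(ℝ, Euc n) (chartAt (Euc n) x) x)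

/-- The de Rham differential on inhomogeneous forms. -/
def deRham (η : TotalForm n M) : TotalForm n M
  | 0 => 0
  | k + 1 => extD (η k)

/-- The contraction `ι_X η`. -/
def contr (X : VField n M) (η : TotalForm n M) : TotalForm n M := fun k x ↦
  ContinuousAlternatingMap.curryLeft (𝕜 := ℝ) (E := Euc n) (F := ℝ) (η (k + 1) x) (X x)

/-- The Lie derivative `L_X = [d, ι_X] = d ∘ ι_X + ι_X ∘ d` on differential forms. -/
def lieD (X : VField n M) (η : TotalForm n M) : TotalForm n M :=
  deRham (contr X η) + contr X (deRham η)

/-! ## The DGLA of Cartan type -/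

variable (n M) in
/-- Ambient space of `𝔛[1] ⊕ 𝔛 ⊕ Ω[r]`; a triple `(X, Y, α)` stands for `ι_X + L_Y + α`. -/
abbrev Small := VField n M × VField n M × TotalForm n M

/-- Degree `k` component of `𝔛[1] ⊕ 𝔛 ⊕ Ω[r]`: `X` has degree `-1`, `Y` has degree `0`, and a
`j`-form has degree `j - r`. -/
def gSmall (n : ℕ) (M : Type*) [TopologicalSpace M] [ChartedSpace (Euc n) M]
    [IsManifold 𝓘(ℝ, Euc n) ∞ M] (r : ℕ) (k : ℤ) : Submodule ℝ (Small n M) where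
  carrier := {a | (a.1 ∈ smoothVField n M ∧ (k ≠ -1 → a.1 = 0)) ∧
    (a.2.1 ∈ smoothVField n M ∧ (k ≠ 0 → a.2.1 = 0)) ∧
    ∀ j : ℕ, a.2.2 j ∈ smoothForm n M j ∧ (k ≠ (j : ℤ) - r → a.2.2 j = 0)}
  add_mem' := by
    rintro a b ⟨⟨h1, h2⟩, ⟨h3, h4⟩, h5⟩ ⟨⟨k1, k2⟩, ⟨k3, k4⟩, k5⟩
    refine ⟨⟨add_mem h1 k1, fun h ↦ ?_⟩, ⟨add_mem h3 k3, fun h ↦ ?_⟩,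
      fun j ↦ ⟨add_mem (h5 j).1 (k5 j).1, fun h ↦ ?_⟩⟩
    · simp [h2 h, k2 h]
    · simp [h4 h, k4 h]
    · simp [(h5 j).2 h, (k5 j).2 h]
  zero_mem' := ⟨⟨zero_mem _, fun _ ↦ rfl⟩, ⟨zero_mem _, fun _ ↦ rfl⟩,
    fun _ ↦ ⟨zero_mem _, fun _ ↦ rfl⟩⟩
  smul_mem' := by
    rintro c a ⟨⟨h1, h2⟩, ⟨h3, h4⟩, h5⟩
    refine ⟨⟨Submodule.smul_mem _ _ h1, fun h ↦ ?_⟩, ⟨Submodule.smul_mem _ _ h3, fun h ↦ ?_⟩,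
      fun j ↦ ⟨Submodule.smul_mem _ _ (h5 j).1, fun h ↦ ?_⟩⟩
    · simp [h2 h]
    · simp [h4 h]
    · simp [(h5 j).2 h]

/-- Multiplication of a homogeneous form `α` by `(-1)^|α|`, where `|α| = deg α - r`. -/
def parity (r : ℕ) (α : TotalForm n M) : TotalForm n M := fun j ↦ ((-1 : ℝ) ^ ((j : ℤ) - r)) • α j

/-- The bracket: `{X₁, α} = ι_X α`, `{X, α} = L_X α`, `{X, Y} = [X, Y]`, `{X, Y₁} = [X, Y]₁`,
`{X₁, Y₁} = 0`, `{α, β} = 0`, extended bilinearly and graded skew-symmetrically (an index `1` marks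
elements of `𝔛[1]`), so `{α, X₁} = -(-1)^|α| ι_X α` and `{X₁, Y} = [X, Y]₁`. -/
def smallBracket (r : ℕ) (a b : Small n M) : Small n M :=
  (VectorField.mlieBracket 𝓘(ℝ, Euc n) a.2.1 b.1 + VectorField.mlieBracket 𝓘(ℝ, Euc n) a.1 b.2.1,
   VectorField.mlieBracket 𝓘(ℝ, Euc n) a.2.1 b.2.1,
   contr a.1 b.2.2 + lieD a.2.1 b.2.2 - contr b.1 (parity r a.2.2) - lieD b.2.1 a.2.2)

/-- The differential of the untwisted DGLA: `d X₁ = X`, `d X = 0`, `d α = dα`. -/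
def smallD₀ (a : Small n M) : Small n M := (0, a.1, deRham a.2.2)

/-- The twisted differential `d + {σ, -}`. -/
def smallD {r : ℕ} (σ : Form n M (r + 1)) (a : Small n M) : Small n M :=
  smallD₀ a + smallBracket r (0, 0, Pi.single (r + 1) σ) a

end Manifold

/-! ## Polynomials in the graded fibre coordinates of `T*[r]T[1]ℝⁿ` -/

/-- The fibre coordinates `vⁱ`, `pᵢ`, `Pᵢ`. -/
inductive Gen (n : ℕ) : Type
  | v (i : Fin n) : Gen n
  | p (i : Fin n) : Gen n
  | P (i : Fin n) : Gen n
  deriving DecidableEq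

/-- `vⁱ` has degree `1`, `pᵢ` has degree `r - 1` and `Pᵢ` has degree `r`. -/
def Gen.deg {n : ℕ} (r : ℕ) : Gen n → ℤ
  | .v _ => 1
  | .p _ => (r : ℤ) - 1
  | .P _ => r

/-- Graded commutativity of the generators: `a b = (-1)^(|a||b|) b a`. -/
inductive GradedComm (n r : ℕ) : FreeAlgebra ℝ (Gen n) → FreeAlgebra ℝ (Gen n) → Prop
  | swap (a b : Gen n) : GradedComm n r (FreeAlgebra.ι ℝ a * FreeAlgebra.ι ℝ b)
      (((-1 : ℝ) ^ (a.deg r * b.deg r)) • (FreeAlgebra.ι ℝ b * FreeAlgebra.ι ℝ a))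

/-- The free graded commutative real algebra on the `vⁱ`, `pᵢ`, `Pᵢ`. -/
abbrev FibreAlg (n r : ℕ) := RingQuot (GradedComm n r)

namespace FibreAlg

variable {n r : ℕ}

/-- A generator as an element of the algebra. -/
def var (r : ℕ) (a : Gen n) : FibreAlg n r :=
  RingQuot.mkAlgHom ℝ (GradedComm n r) (FreeAlgebra.ι ℝ a)

lemma var_mul_var (a b : Gen n) :
    var r a * var r b = ((-1 : ℝ) ^ (a.deg r * b.deg r)) • (var r b * var r a) := by
  have h := RingQuot.mkAlgHom_rel ℝ (GradedComm.swap (r := r) a b)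
  simpa [var] using h

/-- The algebra homomorphism with prescribed (graded commuting) values on the generators. -/
def lift {A : Type*} [Ring A] [Algebra ℝ A] (f : Gen n → A)
    (h : ∀ a b, f a * f b = ((-1 : ℝ) ^ (a.deg r * b.deg r)) • (f b * f a)) :
    FibreAlg n r →ₐ[ℝ] A :=
  RingQuot.liftAlgHom ℝ ⟨FreeAlgebra.lift ℝ f, by
    rintro _ _ ⟨a, b⟩
    simpa using h a b⟩

lemma leftAux (z a b : Gen n) :
    (!![((-1 : ℝ) ^ (z.deg r * a.deg r)) • var r a, if a = z then 1 else 0; 0, var r a] *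
      !![((-1 : ℝ) ^ (z.deg r * b.deg r)) • var r b, if b = z then 1 else 0; 0, var r b] :
        Matrix (Fin 2) (Fin 2) (FibreAlg n r)) = ((-1 : ℝ) ^ (a.deg r * b.deg r)) •
    (!![((-1 : ℝ) ^ (z.deg r * b.deg r)) • var r b, if b = z then 1 else 0; 0, var r b] *
      !![((-1 : ℝ) ^ (z.deg r * a.deg r)) • var r a, if a = z then 1 else 0; 0, var r a]) := by
  have hs : ∀ k : ℤ, (-1 : ℝ) ^ k * (-1 : ℝ) ^ k = 1 := fun k ↦ by
    rw [← mul_zpow]; simp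
  have h := var_mul_var (r := r) a b
  ext i j
  fin_cases i <;> fin_cases j <;> simp [Matrix.mul_apply, Fin.sum_univ_two]
  · have h0 : (Matrix.vecHead (if b = z then ![0, var r a] else 0) : FibreAlg n r) = 0 := by
      split_ifs <;> rfl
    rw [h0, smul_smul, smul_smul, smul_smul, h, smul_smul, smul_zero, add_zero]
    congr 1; ring
  · split_ifs with h1 h2 h2 <;> subst_vars <;> simp [smul_smul, mul_comm, hs]
    exact add_comm _ _
  · exact h

/-- The left partial derivative `∂/∂z`: the linear map with `∂/∂z (z) = 1`, with `∂/∂z (w) = 0` for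
the other generators `w`, and with `∂/∂z (a b) = (∂/∂z a) b + (-1)^(|z||a|) a (∂/∂z b)`. It is the
upper right entry of the algebra homomorphism to `2 × 2` matrices
`a ↦ !![(-1)^(|z||a|) a, ∂/∂z a; 0, a]`. -/
def leftPartial (z : Gen n) : FibreAlg n r →ₗ[ℝ] FibreAlg n r :=
  Matrix.entryLinearMap ℝ (FibreAlg n r) 0 1 ∘ₗ
    (lift (fun a ↦ !![((-1 : ℝ) ^ (z.deg r * a.deg r)) • var r a, if a = z then 1 else 0;
      0, var r a]) (leftAux z)).toLinearMap

lemma rightAux (z a b : Gen n) :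
    (!![var r a, if a = z then 1 else 0; 0, ((-1 : ℝ) ^ (z.deg r * a.deg r)) • var r a] *
      !![var r b, if b = z then 1 else 0; 0, ((-1 : ℝ) ^ (z.deg r * b.deg r)) • var r b] :
        Matrix (Fin 2) (Fin 2) (FibreAlg n r)) = ((-1 : ℝ) ^ (a.deg r * b.deg r)) •
    (!![var r b, if b = z then 1 else 0; 0, ((-1 : ℝ) ^ (z.deg r * b.deg r)) • var r b] *
      !![var r a, if a = z then 1 else 0; 0, ((-1 : ℝ) ^ (z.deg r * a.deg r)) • var r a]) := by
  have hs : ∀ k : ℤ, (-1 : ℝ) ^ k * (-1 : ℝ) ^ k = 1 := fun k ↦ by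
    rw [← mul_zpow]; simp
  have h := var_mul_var (r := r) a b
  ext i j
  fin_cases i <;> fin_cases j <;> simp [Matrix.mul_apply, Fin.sum_univ_two]
  · have h0 : (Matrix.vecHead (if b = z then ![0, ((-1 : ℝ) ^ (z.deg r * a.deg r)) • var r a]
        else 0) : FibreAlg n r) = 0 := by
      split_ifs <;> rfl
    rw [h0, smul_zero, add_zero]
    exact h
  · split_ifs with h1 h2 h2 <;> subst_vars <;> simp [smul_smul, mul_comm, hs]
    exact add_comm _ _
  · rw [smul_smul, smul_smul, smul_smul, h, smul_smul]
    congr 1; ring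

/-- The right partial derivative: the linear map with the same values on generators as the left
one and with `(a b)∂ = a (b∂) + (-1)^(|z||b|) (a∂) b`. -/
def rightPartial (z : Gen n) : FibreAlg n r →ₗ[ℝ] FibreAlg n r :=
  Matrix.entryLinearMap ℝ (FibreAlg n r) 0 1 ∘ₗ
    (lift (fun a ↦ !![var r a, if a = z then 1 else 0;
      0, ((-1 : ℝ) ^ (z.deg r * a.deg r)) • var r a]) (rightAux z)).toLinearMap

/-- The span of the monomials of degree `m`. -/
def degree (n r : ℕ) (m : ℤ) : Submodule ℝ (FibreAlg n r) :=
  Submodule.span ℝ {x | ∃ l : List (Gen n), (l.map (Gen.deg r)).sum = m ∧ x = (l.map (var r)).prod}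

/-- The substitution of fibre coordinates induced by a change of base coordinates `x ↦ x'` with
`J i j = ∂x'ⁱ/∂xʲ`, `K i j = ∂xⁱ/∂x'ʲ` and `H i j k = ∂²x'ⁱ/∂xʲ∂xᵏ`:
`vʲ = Kʲᵢ v'ⁱ`, `pⱼ = Jⁱⱼ p'ᵢ`, `Pⱼ = Jⁱⱼ P'ᵢ + Hⁱⱼₖ vᵏ p'ᵢ`. -/
def substGen (r : ℕ) (J K : Fin n → Fin n → ℝ) (H : Fin n → Fin n → Fin n → ℝ) :
    Gen n → FibreAlg n r
  | .v j => ∑ i, K j i • var r (.v i)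
  | .p j => ∑ i, J i j • var r (.p i)
  | .P j => (∑ i, J i j • var r (.P i)) +
      ∑ i, ∑ k, H i j k • ((∑ l, K k l • var r (.v l)) * var r (.p i))

lemma swap_symm {d e : ℤ} {x y : FibreAlg n r} (h : x * y = ((-1 : ℝ) ^ (d * e)) • (y * x)) :
    y * x = ((-1 : ℝ) ^ (e * d)) • (x * y) := by
  rw [h, smul_smul, mul_comm e d, ← mul_zpow]
  simp

lemma swap_substGen (J K : Fin n → Fin n → ℝ) (H : Fin n → Fin n → Fin n → ℝ) (a : Gen n)
    {e : ℤ} {y : FibreAlg n r}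
    (h : ∀ z : Gen n, var r z * y = ((-1 : ℝ) ^ (z.deg r * e)) • (y * var r z)) :
    substGen r J K H a * y = ((-1 : ℝ) ^ (a.deg r * e)) • (y * substGen r J K H a) := by
  have hv : ∀ z : Fin n, var r (.v z) * y = ((-1 : ℝ) ^ e) • (y * var r (.v z)) := fun z ↦ by
    simpa [Gen.deg] using h (.v z)
  have hp : ∀ z : Fin n, var r (.p z) * y = ((-1 : ℝ) ^ (((r : ℤ) - 1) * e)) • (y * var r (.p z)) :=
    fun z ↦ by simpa only [Gen.deg] using h (.p z)
  have hP : ∀ z : Fin n, var r (.P z) * y = ((-1 : ℝ) ^ ((r : ℤ) * e)) • (y * var r (.P z)) :=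
    fun z ↦ by simpa only [Gen.deg] using h (.P z)
  have hvp : ∀ w z : Fin n, var r (.v w) * var r (.p z) * y =
      ((-1 : ℝ) ^ ((r : ℤ) * e)) • (y * (var r (.v w) * var r (.p z))) := fun w z ↦ by
    rw [mul_assoc, hp, mul_smul_comm, ← mul_assoc, hv, smul_mul_assoc, smul_smul, mul_assoc,
      ← zpow_add₀ (by norm_num)]
    congr 2; ring
  cases a with
  | v j =>
    simp only [substGen, Gen.deg, one_mul, Finset.sum_mul, Finset.mul_sum, Finset.smul_sum,
      smul_mul_assoc, mul_smul_comm, hv]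
    exact Finset.sum_congr rfl fun i _ ↦ smul_comm _ _ _
  | p j =>
    simp only [substGen, Gen.deg, Finset.sum_mul, Finset.mul_sum, Finset.smul_sum,
      smul_mul_assoc, mul_smul_comm, hp]
    exact Finset.sum_congr rfl fun i _ ↦ smul_comm _ _ _
  | P j =>
    simp only [substGen, Gen.deg, Finset.sum_mul, Finset.mul_sum, Finset.smul_sum, add_mul, mul_add,
      smul_add, smul_mul_assoc, mul_smul_comm, hP, hvp]
    congr 1
    · exact Finset.sum_congr rfl fun i _ ↦ smul_comm _ _ _
    · refine Finset.sum_congr rfl fun i _ ↦ Finset.sum_congr rfl fun k _ ↦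
        Finset.sum_congr rfl fun l _ ↦ ?_
      rw [smul_comm (K k l), smul_comm (H i j k)]

lemma substAux (J K : Fin n → Fin n → ℝ) (H : Fin n → Fin n → Fin n → ℝ) (a b : Gen n) :
    substGen r J K H a * substGen r J K H b =
      ((-1 : ℝ) ^ (a.deg r * b.deg r)) • (substGen r J K H b * substGen r J K H a) :=
  swap_substGen J K H a fun z ↦ swap_symm (swap_substGen J K H b fun w ↦ var_mul_var w z)

/-- The algebra homomorphism given by `substGen`. -/
def subst (J K : Fin n → Fin n → ℝ) (H : Fin n → Fin n → Fin n → ℝ) :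
    FibreAlg n r →ₐ[ℝ] FibreAlg n r :=
  lift (substGen r J K H) (substAux J K H)

end FibreAlg

/-! ## Local functions and the `r`-Poisson bracket in Darboux coordinates -/

section LocalFunctions

open FibreAlg

variable {n r : ℕ}

/-- `D` is the partial derivative in the direction `xⁱ` of the function `F` of `x` with values
in the polynomials, taken coefficientwise (that is, after applying any linear functional). -/
def HasPartialX (F : Euc n → FibreAlg n r) (i : Fin n) (y : Euc n) (D : FibreAlg n r) : Prop :=
  ∀ ℓ : FibreAlg n r →ₗ[ℝ] ℝ, HasLineDerivAt ℝ (fun y' ↦ ℓ (F y')) (ℓ D) y (basisVec i)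

open Classical in
/-- The partial derivative `∂F/∂xⁱ`. -/
def partialX (F : Euc n → FibreAlg n r) (i : Fin n) (y : Euc n) : FibreAlg n r :=
  if h : ∃ D, HasPartialX F i y D then h.choose else 0

/-- `F` is, locally on `U`, a polynomial in the graded fibre coordinates whose coefficients are
smooth functions of `x`. -/
def IsSmoothOn (F : Euc n → FibreAlg n r) (U : Set (Euc n)) : Prop :=
  ∀ y ∈ U, ∃ O : Set (Euc n), IsOpen O ∧ y ∈ O ∧
    ∃ (N : Type) (_ : Fintype N) (f : N → Euc n → ℝ) (m : N → FibreAlg n r),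
      (∀ s, ContDiffOn ℝ ∞ (f s) O) ∧ ∀ y' ∈ O, F y' = ∑ s, f s y' • m s

/-- The canonical `r`-Poisson bracket in Darboux coordinates, i.e. the graded biderivation with
`{Pᵢ, xʲ} = δ = -{xʲ, Pᵢ}`, `{pᵢ, vʲ} = δ = (-1)^r {vʲ, pᵢ}`, all other brackets of coordinates
being zero. -/
def poisson (F G : Euc n → FibreAlg n r) (y : Euc n) : FibreAlg n r :=
  ∑ i, (rightPartial (.P i) (F y) * partialX G i y
    - partialX F i y * leftPartial (.P i) (G y)
    + rightPartial (.p i) (F y) * leftPartial (.v i) (G y)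
    + ((-1 : ℝ) ^ r) • (rightPartial (.v i) (F y) * leftPartial (.p i) (G y)))

end LocalFunctions

/-! ## The DGLA of functions on `T*[r]T[1]M` -/

section Large

open FibreAlg

variable {n r : ℕ} {M : Type*} [TopologicalSpace M] [ChartedSpace (Euc n) M]

/-- The Jacobian `∂x'ⁱ/∂xʲ` of the coordinate change from `e` (coordinates `x`) to `e'`
(coordinates `x'`). -/
def jac (e e' : Chart n M) (i j : Fin n) (y : Euc n) : ℝ :=
  (fderiv ℝ (fun z ↦ e'.1 (e.1.symm z)) y (basisVec j) : Euc n) i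

/-- The second derivatives `∂²x'ⁱ/∂xʲ∂xᵏ` of the coordinate change. -/
def hess (e e' : Chart n M) (i j k : Fin n) (y : Euc n) : ℝ :=
  fderiv ℝ (jac e e' i j) y (basisVec k)

/-- The change of fibre coordinates of `T*[r]T[1]M` over the point `y` of the chart `e`, from the
fibre coordinates of `e` to those of `e'`. -/
def transition (e e' : Chart n M) (y : Euc n) : FibreAlg n r →ₐ[ℝ] FibreAlg n r :=
  subst (fun i j ↦ jac e e' i j y) (fun i j ↦ jac e' e i j (e'.1 (e.1.symm y)))
    (fun i j k ↦ hess e e' i j k y)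

variable (n r M) in
/-- Ambient space for functions on `T*[r]T[1]M`: a local expression in each chart. -/
abbrev Large := Chart n M → Euc n → FibreAlg n r

/-- The degree `k` component of `C(T*[r]T[1]M)[r]`: global functions on `T*[r]T[1]M` of degree
`k + r`, that is, families of local polynomials in the fibre coordinates with smooth coefficients,
one on each coordinate domain (and extended by zero to `ℝⁿ`), that agree on overlaps. -/
def gLarge (n : ℕ) (M : Type*) [TopologicalSpace M] [ChartedSpace (Euc n) M] (r : ℕ) (k : ℤ) :
    Submodule ℝ (Large n r M) where
  carrier := {F | (∀ e : Chart n M, IsSmoothOn (F e) e.1.target) ∧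
    (∀ e : Chart n M, ∀ y ∈ e.1.target, F e y ∈ degree n r (k + r)) ∧
    (∀ e : Chart n M, ∀ y ∉ e.1.target, F e y = 0) ∧
    ∀ e e' : Chart n M, ∀ y ∈ e.1.target, e.1.symm y ∈ e'.1.source →
      transition e e' y (F e y) = F e' (e'.1 (e.1.symm y))}
  add_mem' := by
    rintro F G ⟨h1, h2, h3, h4⟩ ⟨k1, k2, k3, k4⟩
    refine ⟨fun e y hy ↦ ?_, fun e y hy ↦ add_mem (h2 e y hy) (k2 e y hy), fun e y hy ↦ ?_,
      fun e e' y hy hy' ↦ ?_⟩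
    · obtain ⟨O, hO, hyO, N, _, f, m, hf, hF⟩ := h1 e y hy
      obtain ⟨O', hO', hyO', N', _, f', m', hf', hF'⟩ := k1 e y hy
      refine ⟨O ∩ O', hO.inter hO', ⟨hyO, hyO'⟩, N ⊕ N', inferInstance, Sum.elim f f',
        Sum.elim m m', ?_, fun y' hy' ↦ ?_⟩
      · rintro (s | s)
        · exact (hf s).mono Set.inter_subset_left
        · exact (hf' s).mono Set.inter_subset_right
      · simp [Fintype.sum_sum_type, hF y' hy'.1, hF' y' hy'.2]
    · simp [h3 e y hy, k3 e y hy]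
    · simp [h4 e e' y hy hy', k4 e e' y hy hy']
  zero_mem' := by
    refine ⟨fun e y _ ↦ ⟨Set.univ, isOpen_univ, trivial, Empty, inferInstance, fun s ↦ s.elim,
      fun s ↦ s.elim, fun s ↦ s.elim, fun _ _ ↦ by simp⟩, fun e y _ ↦ zero_mem _,
      fun _ _ _ ↦ rfl, fun _ _ _ _ _ ↦ map_zero _⟩
  smul_mem' := by
    rintro c F ⟨h1, h2, h3, h4⟩
    refine ⟨fun e y hy ↦ ?_, fun e y hy ↦ Submodule.smul_mem _ _ (h2 e y hy), fun e y hy ↦ ?_,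
      fun e e' y hy hy' ↦ ?_⟩
    · obtain ⟨O, hO, hyO, N, _, f, m, hf, hF⟩ := h1 e y hy
      refine ⟨O, hO, hyO, N, inferInstance, f, fun s ↦ c • m s, hf, fun y' hy' ↦ ?_⟩
      simp [hF y' hy', Finset.smul_sum, smul_comm c]
    · simp [h3 e y hy]
    · simp [h4 e e' y hy hy']

open Classical in
/-- The `r`-Poisson bracket of functions on `T*[r]T[1]M`, computed in every chart. -/
def largeBracket (F G : Large n r M) : Large n r M := fun e y ↦
  if y ∈ e.1.target then poisson (F e) (G e) y else 0

variable (n r M) in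
open Classical in
/-- The function `𝒮 = vⁱ Pᵢ`. -/
def canonicalS : Large n r M := fun e y ↦
  if y ∈ e.1.target then ∑ i, var r (.v i) * var r (.P i) else 0

/-- The component `Xⁱ` of a vector field in a chart. -/
def vcoord (e : Chart n M) (X : VField n M) (i : Fin n) (y : Euc n) : ℝ :=
  let w : Euc n := mfderiv 𝓘(ℝ, Euc n) 𝓘(ℝ, Euc n) e.1 (e.1.symm y) (X (e.1.symm y))
  w i

/-- The component `α_I` of a `k`-form in a chart, i.e. its value on `∂_{I 0}, …, ∂_{I (k-1)}`. -/
def fcoord (e : Chart n M) {k : ℕ} (α : Form n M k) (I : Fin k → Fin n) (y : Euc n) : ℝ :=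
  formInChart e.1 α y (fun a ↦ basisVec (I a))

open Classical in
/-- The polynomial `α_I vᴵ`, the sum being over increasing multi-indices `I`. -/
def formPoly (r : ℕ) (e : Chart n M) {k : ℕ} (α : Form n M k) (y : Euc n) : FibreAlg n r :=
  ∑ I : Fin k → Fin n with StrictMono I,
    fcoord e α I y • (List.ofFn (fun a ↦ var r (.v (I a)))).prod

open Classical in
/-- A differential form as a function on `T*[r]T[1]M`. -/
def formFun (r : ℕ) {k : ℕ} (α : Form n M k) : Large n r M := fun e y ↦
  if y ∈ e.1.target then formPoly r e α y else 0

/-- The twisted differential `{𝒮 + σ, -}`. -/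
def largeD (σ : Form n M (r + 1)) (F : Large n r M) : Large n r M :=
  largeBracket (canonicalS n r M + formFun r σ) F

end Large

end HigherCourant

end

open HigherCourant HigherCourant.FibreAlg

namespace HigherCourant

/-! The proof rests on the derived-bracket picture of Cartan calculus. Write `i_X = Xⁱ pᵢ`. The
image of `L_X` is `{𝒮, i_X}`: its term with the derivatives of `Xⁱ` is exactly what the bracket with
`𝒮 = vⁱ Pᵢ` produces. Hence only a few brackets have to be computed in coordinates: `{𝒮, 𝒮} = 0`,
`{i_X, i_Y} = 0`, `{i_X, α} = ι_X α`, `{𝒮, α} = dα`, `{α, β} = 0` and `{L_Y, i_X} = i_[Y,X]`. The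
Jacobi identity gives the others: `{L_X, L_Y} = {L_X, {𝒮, i_Y}} = {𝒮, i_[X,Y]}` because `{L_X, 𝒮} =
0`, and `{L_X, α} = {𝒮, {i_X, α}} + {i_X, {𝒮, α}}`, which is Cartan's formula.

The large algebra is a graded Lie algebra for two reasons. Locally the bracket is a sum over
conjugate pairs of coordinates, and its skew symmetry and Jacobi identity follow formally from the
Leibniz rule and the commutation of partial derivatives (`DarbouxData.bracket_jacobi`, applied
through `darbouxData_locFun`). Globally the bracket is independent of the chart
(`CoordChange.compat`): by the Leibniz rule and skew symmetry it is enough to compare brackets of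
coordinates and of functions of `x`. There the key observation is that, in new coordinates, the old
`pⱼ` and `Pⱼ` are the functions `i_X` and `{𝒮, i_X}` of the coordinate field `X = ∂ⱼ`; coordinate
fields commute, and the remaining relations come from Jacobi. The differential is inner, so the
differential graded axioms reduce to the master equation `{𝒮 + σ, 𝒮 + σ} = 0`, which holds because
`σ` is closed (`isDGLA_gLarge`).

The map `toLarge` intertwines differentials and brackets (`toLarge_smallD`, `toLarge_smallBracket`).
It is injective and also reflects degrees: the components of `X` and `Y` are the coefficients of
`pᵢ` and `Pᵢ`, and `α` is what remains at `p = P = 0` (`mem_gSmall_of_toLarge_mem`). So the axioms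
of the small algebra are pulled back from the large one (`IsDGLA.of_injective`), and the identities
of Cartan calculus on `M` never need a separate proof. Uniqueness holds because a function on
`T*[r]T[1]M` is determined by its local expressions. -/

lemma neg_one_zpow_congr {a b : ℤ} (h : Even (a - b)) : (-1 : ℝ) ^ a = (-1 : ℝ) ^ b := by
  have : a = (a - b) + b := by ring
  rw [this, zpow_add₀ (by norm_num), h.neg_one_zpow, one_mul]

lemma neg_one_zpow_mul (a b : ℤ) : (-1 : ℝ) ^ a * (-1 : ℝ) ^ b = (-1 : ℝ) ^ (a + b) :=
  (zpow_add₀ (by norm_num) a b).symm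

lemma neg_one_zpow_mul_self (a : ℤ) : (-1 : ℝ) ^ a * (-1 : ℝ) ^ a = 1 := by
  rw [← mul_zpow]; simp

/-! ### The graded Poisson bracket of an abstract Darboux system -/

/-- Left and right partial derivatives on a graded commutative algebra, in coordinates indexed by
`ι`, together with an involution of the index set pairing conjugate coordinates. -/
structure DarbouxData {A ι : Type*} [Ring A] [Algebra ℝ A] (𝒜 : ℤ → Submodule ℝ A)
    (L R : ι → A → A) (deg : ι → ℤ) (conj : ι → ι) (ε : ι → ℝ) (r : ℤ) : Prop where
  mul_mem : ∀ i j, ∀ a ∈ 𝒜 i, ∀ b ∈ 𝒜 j, a * b ∈ 𝒜 (i + j)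
  comm : ∀ i j, ∀ a ∈ 𝒜 i, ∀ b ∈ 𝒜 j, a * b = ((-1 : ℝ) ^ (i * j)) • (b * a)
  L_mem : ∀ z i, ∀ a ∈ 𝒜 i, L z a ∈ 𝒜 (i - deg z)
  R_eq : ∀ z i, ∀ a ∈ 𝒜 i, R z a = ((-1 : ℝ) ^ (deg z * (i - deg z))) • L z a
  L_add : ∀ z i, ∀ a ∈ 𝒜 i, ∀ b ∈ 𝒜 i, L z (a + b) = L z a + L z b
  L_smul : ∀ z i (c : ℝ), ∀ a ∈ 𝒜 i, L z (c • a) = c • L z a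
  L_mul : ∀ z i j, ∀ a ∈ 𝒜 i, ∀ b ∈ 𝒜 j,
    L z (a * b) = L z a * b + ((-1 : ℝ) ^ (deg z * i)) • (a * L z b)
  L_L : ∀ y z i, ∀ a ∈ 𝒜 i, L y (L z a) = ((-1 : ℝ) ^ (deg y * deg z)) • L z (L y a)
  conj_conj : ∀ z, conj (conj z) = z
  deg_conj : ∀ z, deg (conj z) = r - deg z
  eps_conj : ∀ z, ε (conj z) = -((-1 : ℝ) ^ (deg z * (r - deg z))) * ε z

namespace DarbouxData

variable {A ι : Type*} [Ring A] [Algebra ℝ A] {𝒜 : ℤ → Submodule ℝ A}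
  {L R : ι → A → A} {deg : ι → ℤ} {conj : ι → ι} {ε : ι → ℝ} {r : ℤ}

lemma L_sum (h : DarbouxData 𝒜 L R deg conj ε r) (z : ι) (i : ℤ) {κ : Type*} (s : Finset κ)
    (f : κ → A) (hf : ∀ k ∈ s, f k ∈ 𝒜 i) : L z (∑ k ∈ s, f k) = ∑ k ∈ s, L z (f k) := by
  classical
  have h0 : L z 0 = 0 := by simpa using h.L_smul z i 0 0 (zero_mem _)
  induction s using Finset.induction_on with
  | empty => simpa using h0
  | insert k s hk ih =>
    rw [Finset.sum_insert hk, Finset.sum_insert hk, h.L_add z i, ih]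
    · exact fun k hk ↦ hf k (Finset.mem_insert_of_mem hk)
    · exact hf k (Finset.mem_insert_self _ _)
    · exact sum_mem fun k hk ↦ hf k (Finset.mem_insert_of_mem hk)

lemma R_mem (h : DarbouxData 𝒜 L R deg conj ε r) (z : ι) (i : ℤ) (a : A) (ha : a ∈ 𝒜 i) :
    R z a ∈ 𝒜 (i - deg z) := by
  rw [h.R_eq z i a ha]
  exact Submodule.smul_mem _ _ (h.L_mem z i a ha)

lemma R_sum (h : DarbouxData 𝒜 L R deg conj ε r) (z : ι) (i : ℤ) {κ : Type*} (s : Finset κ)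
    (f : κ → A) (hf : ∀ k ∈ s, f k ∈ 𝒜 i) : R z (∑ k ∈ s, f k) = ∑ k ∈ s, R z (f k) := by
  rw [h.R_eq z i _ (sum_mem hf), h.L_sum z i s f hf, Finset.smul_sum]
  exact Finset.sum_congr rfl fun k hk ↦ (h.R_eq z i _ (hf k hk)).symm

lemma R_smul (h : DarbouxData 𝒜 L R deg conj ε r) (z : ι) (i : ℤ) (c : ℝ) (a : A)
    (ha : a ∈ 𝒜 i) : R z (c • a) = c • R z a := by
  rw [h.R_eq z i _ (Submodule.smul_mem _ _ ha), h.L_smul z i c a ha, h.R_eq z i a ha, smul_comm]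

lemma R_mul (h : DarbouxData 𝒜 L R deg conj ε r) (z : ι) (i j : ℤ) (a : A) (ha : a ∈ 𝒜 i)
    (b : A) (hb : b ∈ 𝒜 j) :
    R z (a * b) = a * R z b + ((-1 : ℝ) ^ (deg z * j)) • (R z a * b) := by
  rw [h.R_eq z _ _ (h.mul_mem i j a ha b hb), h.L_mul z i j a ha b hb, h.R_eq z i a ha,
    h.R_eq z j b hb, smul_add, add_comm]
  simp only [smul_mul_assoc, mul_smul_comm, smul_smul, neg_one_zpow_mul]
  congr 2 <;> refine neg_one_zpow_congr ?_ <;> grind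

/-- No sign appears: the sign from exchanging the two left derivatives is absorbed by the shift of
degree in the sign that converts left into right derivatives. -/
lemma L_R (h : DarbouxData 𝒜 L R deg conj ε r) (y z : ι) (i : ℤ) (a : A) (ha : a ∈ 𝒜 i) :
    L y (R z a) = R z (L y a) := by
  rw [h.R_eq z i a ha, h.R_eq z _ _ (h.L_mem y i a ha), h.L_smul y _ _ _ (h.L_mem z i a ha),
    h.L_L y z i a ha, smul_smul, neg_one_zpow_mul]
  congr 1; refine neg_one_zpow_congr ?_; grind

/-- The bracket `{a, b} = ∑ ε_z (a ∂_{z*}) (∂_z b)`. -/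
def bracket [Fintype ι] (L R : ι → A → A) (conj : ι → ι) (ε : ι → ℝ) (a b : A) : A :=
  ∑ z, ε z • (R (conj z) a * L z b)

variable [Fintype ι]

lemma bracket_mem (h : DarbouxData 𝒜 L R deg conj ε r) (i j : ℤ) (a : A) (ha : a ∈ 𝒜 i)
    (b : A) (hb : b ∈ 𝒜 j) : bracket L R conj ε a b ∈ 𝒜 (i + j - r) := by
  refine sum_mem fun z _ ↦ Submodule.smul_mem _ _ ?_
  have := h.mul_mem _ _ _ (h.R_mem (conj z) i a ha) _ (h.L_mem z j b hb)
  rw [h.deg_conj] at this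
  convert this using 2
  ring

/-- Reindexing the sum by the involution `conj` exchanges the roles of the two arguments; the
condition `eps_conj` on the signs is what makes the result skew. -/
lemma bracket_skew (h : DarbouxData 𝒜 L R deg conj ε r) (i j : ℤ) (a : A) (ha : a ∈ 𝒜 i)
    (b : A) (hb : b ∈ 𝒜 j) : bracket L R conj ε a b =
      -(((-1 : ℝ) ^ ((i - r) * (j - r))) • bracket L R conj ε b a) := by
  unfold bracket
  rw [← (Equiv.sum_comp (Function.Involutive.toPerm conj h.conj_conj)), Finset.smul_sum,
    ← Finset.sum_neg_distrib]
  refine Finset.sum_congr rfl fun z _ ↦ ?_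
  simp only [show ∀ w, Function.Involutive.toPerm conj h.conj_conj w = conj w from fun _ ↦ rfl, h.conj_conj, h.eps_conj]
  have h1 := h.R_mem z i a ha
  have h2 := h.R_mem (conj z) j b hb
  rw [h.R_eq z i a ha, h.R_eq _ j b hb, smul_mul_assoc,
    h.comm _ _ _ (h.L_mem z i a ha) _ (h.L_mem _ j b hb)]
  simp only [smul_mul_assoc, smul_smul, ← neg_smul, h.deg_conj]
  congr 1
  have : (-1 : ℝ) ^ (deg z * (r - deg z)) * (-1) ^ (deg z * (i - deg z)) *
      (-1) ^ ((i - deg z) * (j - (r - deg z))) =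
      (-1) ^ ((i - r) * (j - r)) * (-1) ^ ((r - deg z) * (j - (r - deg z))) := by
    simp only [neg_one_zpow_mul]
    refine neg_one_zpow_congr ?_; grind
  linear_combination (-ε z) * this

lemma bracket_mul_right (h : DarbouxData 𝒜 L R deg conj ε r) (i j k : ℤ) (a : A) (ha : a ∈ 𝒜 i)
    (b : A) (hb : b ∈ 𝒜 j) (c : A) (hc : c ∈ 𝒜 k) :
    bracket L R conj ε a (b * c) = bracket L R conj ε a b * c +
      ((-1 : ℝ) ^ ((i - r) * j)) • (b * bracket L R conj ε a c) := by
  simp only [bracket, Finset.sum_mul, Finset.mul_sum, Finset.smul_sum, ← Finset.sum_add_distrib]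
  refine Finset.sum_congr rfl fun z _ ↦ ?_
  rw [h.L_mul z j k b hb c hc, mul_add, smul_add, smul_mul_assoc, mul_assoc, mul_smul_comm,
    mul_smul_comm, ← mul_assoc, ← mul_assoc, h.comm _ _ _ (h.R_mem (conj z) i a ha) b hb]
  simp only [smul_mul_assoc, smul_smul, h.deg_conj]
  rw [mul_comm _ (ε z), mul_assoc, neg_one_zpow_mul]
  congr 2
  · congr 1; refine neg_one_zpow_congr ?_; grind
  · rw [mul_assoc]

lemma bracket_bracket_right (h : DarbouxData 𝒜 L R deg conj ε r) (j k : ℤ) (a : A)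
    (b : A) (hb : b ∈ 𝒜 j) (c : A) (hc : c ∈ 𝒜 k) :
    bracket L R conj ε a (bracket L R conj ε b c) = ∑ y, ∑ z,
      (ε y * ε z) • (R (conj y) a * L y (R (conj z) b) * L z c +
        ((-1 : ℝ) ^ (deg y * (j - deg (conj z)))) •
          (R (conj y) a * R (conj z) b * L y (L z c))) := by
  unfold bracket
  refine Finset.sum_congr rfl fun y _ ↦ ?_
  have hm : ∀ z, R (conj z) b * L z c ∈ 𝒜 (j + k - r) := fun z ↦ by
    have := h.mul_mem _ _ _ (h.R_mem (conj z) j b hb) _ (h.L_mem z k c hc)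
    rw [h.deg_conj] at this
    convert this using 2
    ring
  rw [h.L_sum y (j + k - r) _ _ fun z _ ↦ Submodule.smul_mem _ _ (hm z), Finset.mul_sum,
    Finset.smul_sum]
  refine Finset.sum_congr rfl fun z _ ↦ ?_
  rw [h.L_smul y _ _ _ (hm z), h.L_mul y _ _ _ (h.R_mem (conj z) j b hb) _ (h.L_mem z k c hc),
    mul_smul_comm, smul_smul, mul_add, mul_smul_comm, mul_assoc, mul_assoc]

lemma bracket_bracket_left (h : DarbouxData 𝒜 L R deg conj ε r) (i j : ℤ) (a : A)
    (ha : a ∈ 𝒜 i) (b : A) (hb : b ∈ 𝒜 j) (c : A) :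
    bracket L R conj ε (bracket L R conj ε a b) c = ∑ y, ∑ z,
      (ε y * ε z) • (R (conj y) a * R (conj z) (L y b) * L z c +
        ((-1 : ℝ) ^ (deg (conj z) * (j - deg y))) •
          (R (conj z) (R (conj y) a) * L y b * L z c)) := by
  unfold bracket
  rw [Finset.sum_comm]
  refine Finset.sum_congr rfl fun z _ ↦ ?_
  have hm : ∀ y, R (conj y) a * L y b ∈ 𝒜 (i + j - r) := fun y ↦ by
    have := h.mul_mem _ _ _ (h.R_mem (conj y) i a ha) _ (h.L_mem y j b hb)
    rw [h.deg_conj] at this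
    convert this using 2
    ring
  rw [h.R_sum _ (i + j - r) _ _ fun y _ ↦ Submodule.smul_mem _ _ (hm y), Finset.sum_mul,
    Finset.smul_sum]
  refine Finset.sum_congr rfl fun y _ ↦ ?_
  rw [h.R_smul _ _ _ _ (hm y), h.R_mul _ _ _ _ (h.R_mem (conj y) i a ha) _ (h.L_mem y j b hb),
    smul_mul_assoc, smul_smul, add_mul, smul_mul_assoc, mul_comm (ε z)]

/-- After expansion each term carries a second derivative of exactly one argument. Those of `b`
agree on both sides because left and right derivatives commute (`e1`), those of `c` agree after
exchanging the two summation indices (`e2`), and those of `a` cancel within the right-hand side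
after replacing one index by its conjugate (`e3`). -/
lemma bracket_jacobi (h : DarbouxData 𝒜 L R deg conj ε r) (i j k : ℤ) (a : A) (ha : a ∈ 𝒜 i)
    (b : A) (hb : b ∈ 𝒜 j) (c : A) (hc : c ∈ 𝒜 k) :
    bracket L R conj ε a (bracket L R conj ε b c) =
      bracket L R conj ε (bracket L R conj ε a b) c +
        ((-1 : ℝ) ^ ((i - r) * (j - r))) • bracket L R conj ε b (bracket L R conj ε a c) := by
  rw [h.bracket_bracket_right j k a b hb c hc, h.bracket_bracket_left i j a ha b hb c,
    h.bracket_bracket_right i k b a ha c hc]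
  simp only [smul_add, Finset.sum_add_distrib, Finset.smul_sum]
  have e1 : ∀ y z, R (conj y) a * R (conj z) (L y b) * L z c =
      R (conj y) a * L y (R (conj z) b) * L z c := fun y z ↦ by rw [h.L_R y (conj z) j b hb]
  have e2 : ∑ y, ∑ z, (-1 : ℝ) ^ ((i - r) * (j - r)) • (ε y * ε z) •
        (-1 : ℝ) ^ (deg y * (i - deg (conj z))) • (R (conj y) b * R (conj z) a * L y (L z c)) =
      ∑ y, ∑ z, (ε y * ε z) • (-1 : ℝ) ^ (deg y * (j - deg (conj z))) •
        (R (conj y) a * R (conj z) b * L y (L z c)) := by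
    rw [Finset.sum_comm]
    refine Finset.sum_congr rfl fun y _ ↦ Finset.sum_congr rfl fun z _ ↦ ?_
    rw [h.L_L z y k c hc, h.comm _ _ _ (h.R_mem (conj z) j b hb) _ (h.R_mem (conj y) i a ha)]
    simp only [smul_mul_assoc, mul_smul_comm, smul_smul, h.deg_conj]
    congr 1
    rw [mul_comm (ε y)]
    have : (-1 : ℝ) ^ ((i - r) * (j - r)) * (-1) ^ (deg z * (i - (r - deg y))) *
        (-1) ^ (deg z * deg y) * (-1) ^ ((j - (r - deg z)) * (i - (r - deg y))) =
        (-1) ^ (deg y * (j - (r - deg z))) := by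
      simp only [neg_one_zpow_mul]
      refine neg_one_zpow_congr ?_; grind
    rw [← this]
    ring
  have e3 : ∑ y, ∑ z, (-1 : ℝ) ^ ((i - r) * (j - r)) • (ε y * ε z) •
        (R (conj y) b * L y (R (conj z) a) * L z c) =
      -∑ y, ∑ z, (ε y * ε z) • (-1 : ℝ) ^ (deg (conj z) * (j - deg y)) •
          (R (conj z) (R (conj y) a) * L y b * L z c) := by
    rw [← (Equiv.sum_comp (Function.Involutive.toPerm conj h.conj_conj)), ← Finset.sum_neg_distrib]
    refine Finset.sum_congr rfl fun y _ ↦ ?_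
    rw [← Finset.sum_neg_distrib]
    refine Finset.sum_congr rfl fun z _ ↦ ?_
    simp only [show ∀ w, Function.Involutive.toPerm conj h.conj_conj w = conj w from fun _ ↦ rfl, h.conj_conj, h.eps_conj]
    have m1 := h.R_mem (conj z) i a ha
    have m2 := h.R_mem (conj y) i a ha
    rw [h.R_eq y j b hb, h.L_R _ _ i a ha, h.R_eq (conj y) i a ha,
      h.R_smul _ _ _ _ (h.L_mem (conj y) i a ha), smul_mul_assoc,
      h.comm _ _ _ (h.L_mem y j b hb) _ (h.R_mem (conj z) _ _ (h.L_mem (conj y) i a ha))]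
    simp only [smul_mul_assoc, smul_smul, ← neg_smul, h.deg_conj]
    congr 1
    have : (-1 : ℝ) ^ ((i - r) * (j - r)) * (-1) ^ (deg y * (r - deg y)) *
        (-1) ^ (deg y * (j - deg y)) * (-1) ^ ((j - deg y) * (i - (r - deg y) - (r - deg z))) =
        (-1) ^ ((r - deg z) * (j - deg y)) * (-1) ^ ((r - deg y) * (i - (r - deg y))) := by
      simp only [neg_one_zpow_mul]
      refine neg_one_zpow_congr ?_; grind
    linear_combination (-ε y * ε z) * this
  rw [e2, e3]
  simp only [e1]
  abel

end DarbouxData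

end HigherCourant

/-! ### The free graded commutative algebra: degrees, signs, partial derivatives -/

namespace HigherCourant

lemma iSupIndep_of_proj {V : Type*} [AddCommGroup V] [Module ℝ V] {𝒢 : ℤ → Submodule ℝ V}
    (π : ℤ → V →ₗ[ℝ] V) (h1 : ∀ i, ∀ a ∈ 𝒢 i, π i a = a)
    (h2 : ∀ i j, i ≠ j → ∀ a ∈ 𝒢 j, π i a = 0) : iSupIndep 𝒢 := by
  intro i
  rw [Submodule.disjoint_def]
  intro x hx hx'
  have : (⨆ j, ⨆ (_ : j ≠ i), 𝒢 j) ≤ LinearMap.ker (π i) :=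
    iSup_le fun j ↦ iSup_le fun hj a ha ↦ h2 i j hj.symm a ha
  rw [← h1 i x hx]
  exact this hx'

namespace FibreAlg

variable {n r : ℕ}

@[simp] lemma lift_var {A : Type*} [Ring A] [Algebra ℝ A] (f : Gen n → A)
    (h : ∀ a b, f a * f b = ((-1 : ℝ) ^ (a.deg r * b.deg r)) • (f b * f a)) (a : Gen n) :
    lift f h (var r a) = f a := by
  simp [lift, var]

/-- The monomial `a₁ ⋯ aₖ` attached to a list of generators. -/
def mon (r : ℕ) (l : List (Gen n)) : FibreAlg n r := (l.map (var r)).prod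

/-- The degree of a monomial. -/
def monDeg (r : ℕ) (l : List (Gen n)) : ℤ := (l.map (Gen.deg r)).sum

@[simp] lemma monDeg_nil : monDeg r ([] : List (Gen n)) = 0 := rfl
@[simp] lemma mon_nil : mon r ([] : List (Gen n)) = 1 := rfl
@[simp] lemma mon_cons (a : Gen n) (l : List (Gen n)) : mon r (a :: l) = var r a * mon r l := by
  simp [mon]
lemma mon_append (l l' : List (Gen n)) : mon r (l ++ l') = mon r l * mon r l' := by
  simp [mon]
@[simp] lemma monDeg_cons (a : Gen n) (l : List (Gen n)) :
    monDeg r (a :: l) = a.deg r + monDeg r l := by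
  simp [monDeg]

/-- Linear identities can now be tested on monomials. Linear independence of monomials is not
needed: coefficients will be read off by homomorphisms out of the algebra (`aug`, `degreeProj`,
`formPart`) and by partial derivatives. -/
lemma span_mon : Submodule.span ℝ (Set.range (mon (n := n) r)) = ⊤ := by
  rw [eq_top_iff]
  rintro x -
  obtain ⟨x, rfl⟩ := RingQuot.mkAlgHom_surjective ℝ (GradedComm n r) x
  have hmul : ∀ x ∈ Submodule.span ℝ (Set.range (mon (n := n) r)),
      ∀ y ∈ Submodule.span ℝ (Set.range (mon (n := n) r)),
      x * y ∈ Submodule.span ℝ (Set.range (mon (n := n) r)) := by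
    intro x hx y hy
    refine Submodule.span_induction₂ (p := fun x y _ _ ↦
      x * y ∈ Submodule.span ℝ (Set.range (mon (n := n) r))) ?_ ?_ ?_ ?_ ?_ ?_ ?_ hx hy
    · rintro _ _ ⟨l, rfl⟩ ⟨l', rfl⟩
      exact Submodule.subset_span ⟨l ++ l', mon_append l l'⟩
    · intros; simp
    · intros; simp
    · intro x y z _ _ _ h1 h2; rw [add_mul]; exact add_mem h1 h2
    · intro x y z _ _ _ h1 h2; rw [mul_add]; exact add_mem h1 h2
    · intro c x y _ _ h; rw [smul_mul_assoc]; exact Submodule.smul_mem _ _ h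
    · intro c x y _ _ h; rw [mul_smul_comm]; exact Submodule.smul_mem _ _ h
  induction x using FreeAlgebra.induction with
  | grade0 c =>
    rw [AlgHom.commutes, Algebra.algebraMap_eq_smul_one]
    exact Submodule.smul_mem _ _ (Submodule.subset_span ⟨[], rfl⟩)
  | grade1 a => exact Submodule.subset_span ⟨[a], by simp [mon, var]⟩
  | mul x y hx hy => rw [map_mul]; exact hmul _ hx _ hy
  | add x y hx hy => rw [map_add]; exact add_mem hx hy

lemma linearMap_ext {W : Type*} [AddCommGroup W] [Module ℝ W] {f g : FibreAlg n r →ₗ[ℝ] W}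
    (h : ∀ l, f (mon r l) = g (mon r l)) : f = g :=
  LinearMap.ext_on span_mon (by rintro _ ⟨l, rfl⟩; exact h l)

lemma mon_mem_degree (l : List (Gen n)) : mon r l ∈ degree n r (monDeg r l) :=
  Submodule.subset_span ⟨l, rfl, rfl⟩

lemma degree_induction {m : ℤ} {p : (x : FibreAlg n r) → x ∈ degree n r m → Prop}
    (hm : ∀ (l : List (Gen n)) (hl : monDeg r l = m), p (mon r l) (hl ▸ mon_mem_degree l))
    (hadd : ∀ x y hx hy, p x hx → p y hy → p (x + y) (add_mem hx hy))
    (hsmul : ∀ (c : ℝ) x hx, p x hx → p (c • x) (Submodule.smul_mem _ c hx))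
    (h0 : p 0 (zero_mem _)) {x : FibreAlg n r} (hx : x ∈ degree n r m) : p x hx := by
  induction hx using Submodule.span_induction with
  | mem x h => obtain ⟨l, hl, rfl⟩ := h; exact hm l hl
  | zero => exact h0
  | add x y hx hy h1 h2 => exact hadd x y hx hy h1 h2
  | smul c x hx h => exact hsmul c x hx h

lemma var_mem_degree (a : Gen n) : var r a ∈ degree n r (a.deg r) := by
  simpa using mon_mem_degree (r := r) [a]

lemma one_mem_degree : (1 : FibreAlg n r) ∈ degree n r 0 := by
  simpa using mon_mem_degree (r := r) ([] : List (Gen n))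

lemma mul_mem_degree {i j : ℤ} {x y : FibreAlg n r} (hx : x ∈ degree n r i)
    (hy : y ∈ degree n r j) : x * y ∈ degree n r (i + j) := by
  refine Submodule.span_induction₂ (p := fun x y _ _ ↦ x * y ∈ degree n r (i + j)) ?_ ?_ ?_ ?_ ?_ ?_ ?_ hx hy
  · rintro _ _ ⟨l, rfl, rfl⟩ ⟨l', rfl, rfl⟩
    exact Submodule.subset_span ⟨l ++ l', by simp, by simp⟩
  · intros; simp
  · intros; simp
  · intro x y z _ _ _ h1 h2; rw [add_mul]; exact add_mem h1 h2
  · intro x y z _ _ _ h1 h2; rw [mul_add]; exact add_mem h1 h2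
  · intro c x y _ _ h; rw [smul_mul_assoc]; exact Submodule.smul_mem _ _ h
  · intro c x y _ _ h; rw [mul_smul_comm]; exact Submodule.smul_mem _ _ h

lemma algHom_mem_degree (f : FibreAlg n r →ₐ[ℝ] FibreAlg n r)
    (hf : ∀ a, f (var r a) ∈ degree n r (a.deg r)) {m : ℤ} {x : FibreAlg n r}
    (hx : x ∈ degree n r m) : f x ∈ degree n r m := by
  refine degree_induction (p := fun x _ ↦ f x ∈ degree n r m) ?_ ?_ ?_ ?_ hx
  · rintro l rfl
    clear hx
    induction l with
    | nil => simpa using one_mem_degree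
    | cons a l ih =>
      rw [mon_cons, map_mul, monDeg_cons]
      exact mul_mem_degree (hf a) ih
  · intro x y _ _ hx hy; rw [map_add]; exact add_mem hx hy
  · intro c x _ hx; rw [map_smul]; exact Submodule.smul_mem _ _ hx
  · simp

lemma var_mul_comm (a : Gen n) {j : ℤ} {y : FibreAlg n r} (hy : y ∈ degree n r j) :
    var r a * y = ((-1 : ℝ) ^ (a.deg r * j)) • (y * var r a) := by
  refine degree_induction (p := fun y _ ↦ var r a * y = ((-1 : ℝ) ^ (a.deg r * j)) • (y * var r a))
    ?_ ?_ ?_ ?_ hy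
  · rintro l rfl
    clear hy
    induction l with
    | nil => simp
    | cons b l ih =>
      rw [mon_cons, monDeg_cons, ← mul_assoc, var_mul_var, smul_mul_assoc, mul_assoc, ih,
        mul_smul_comm, smul_smul, ← mul_assoc, mul_add, neg_one_zpow_mul]
  · intro x y _ _ hx hy; rw [mul_add, add_mul, smul_add, hx, hy]
  · intro c x _ hx; rw [mul_smul_comm, smul_mul_assoc, hx, smul_comm]
  · simp

lemma mul_comm_degree {i j : ℤ} {x y : FibreAlg n r} (hx : x ∈ degree n r i)
    (hy : y ∈ degree n r j) : x * y = ((-1 : ℝ) ^ (i * j)) • (y * x) := by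
  refine degree_induction (p := fun x _ ↦ x * y = ((-1 : ℝ) ^ (i * j)) • (y * x)) ?_ ?_ ?_ ?_ hx
  · rintro l rfl
    clear hx
    induction l with
    | nil => simp
    | cons b l ih =>
      rw [mon_cons, monDeg_cons, mul_assoc, ih, mul_smul_comm, ← mul_assoc, var_mul_comm _ hy,
        smul_mul_assoc, smul_smul, mul_assoc, add_mul, neg_one_zpow_mul, add_comm]
  · intro x z _ _ hx hz; rw [mul_add, add_mul, smul_add, hx, hz]
  · intro c x _ hx; rw [mul_smul_comm, smul_mul_assoc, hx, smul_comm]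
  · simp

/-- The projection to the homogeneous component of degree `m`. -/
noncomputable def degreeProj (n r : ℕ) (m : ℤ) : FibreAlg n r →ₗ[ℝ] FibreAlg n r :=
  Finsupp.lapply m ∘ₗ (AddMonoidAlgebra.coeffLinearEquiv ℝ).toLinearMap ∘ₗ
    (lift (A := AddMonoidAlgebra (FibreAlg n r) ℤ)
    (fun a ↦ AddMonoidAlgebra.single (a.deg r) (var r a)) fun a b ↦ by
      rw [AddMonoidAlgebra.single_mul_single, AddMonoidAlgebra.single_mul_single,
        AddMonoidAlgebra.smul_single, var_mul_var, add_comm]).toLinearMap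

/-- The homomorphism behind `degreeProj` sends a generator `a` to `a T^|a|` in the group algebra of
`ℤ`. By multiplicativity a homogeneous `x` goes to `x T^m'`, and the projection takes the
coefficient of `T^m`. -/
lemma degreeProj_of_mem {m m' : ℤ} {x : FibreAlg n r} (hx : x ∈ degree n r m') :
    degreeProj n r m x = if m' = m then x else 0 := by
  have key : lift (A := AddMonoidAlgebra (FibreAlg n r) ℤ)
      (fun a ↦ AddMonoidAlgebra.single (a.deg r) (var r a)) (fun a b ↦ by
      rw [AddMonoidAlgebra.single_mul_single, AddMonoidAlgebra.single_mul_single,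
        AddMonoidAlgebra.smul_single, var_mul_var, add_comm]) x = AddMonoidAlgebra.single m' x := by
    induction hx using degree_induction with
    | hm l hl =>
      subst hl
      induction l with
      | nil => rw [mon_nil, map_one]; rfl
      | cons a l ih =>
        rw [mon_cons, map_mul, ih, lift_var, AddMonoidAlgebra.single_mul_single, monDeg_cons]
    | hadd x y _ _ hx hy => rw [map_add, hx, hy, AddMonoidAlgebra.single_add]
    | hsmul c x _ hx => rw [map_smul, hx, AddMonoidAlgebra.smul_single]
    | h0 => rw [map_zero, AddMonoidAlgebra.single_zero]
  simp only [degreeProj, LinearMap.coe_comp, Function.comp_apply, AlgHom.toLinearMap_apply]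
  rw [key]
  exact Finsupp.single_apply

/-- The value of a polynomial at the zero section. -/
noncomputable def aug (n r : ℕ) : FibreAlg n r →ₐ[ℝ] ℝ := lift (fun _ ↦ 0) (by simp)

@[simp] lemma aug_var (a : Gen n) : aug n r (var r a) = 0 := by simp [aug]

/-- The sign on the diagonal is defined generator by generator; on homogeneous elements it collapses
to the single sign `(-1)^(|z| m)`. Multiplying two such matrices then yields the graded Leibniz rule
in the upper right entry. -/
lemma leftPartial_matrix (z : Gen n) (x : FibreAlg n r) {m : ℤ} (hx : x ∈ degree n r m) :
    lift (fun a ↦ !![((-1 : ℝ) ^ (z.deg r * a.deg r)) • var r a, if a = z then 1 else 0;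
      0, var r a]) (leftAux z) x =
      !![((-1 : ℝ) ^ (z.deg r * m)) • x, leftPartial z x; 0, x] := by
  have h01 : ∀ x, leftPartial z x = lift (fun a ↦ !![((-1 : ℝ) ^ (z.deg r * a.deg r)) • var r a,
      if a = z then 1 else 0; 0, var r a]) (leftAux z) x 0 1 := fun _ ↦ rfl
  rw [h01]
  induction hx using degree_induction with
  | hm l hl =>
    subst hl
    induction l with
    | nil => ext i j; fin_cases i <;> fin_cases j <;> simp
    | cons a l ih =>
      rw [mon_cons, map_mul, ih, lift_var]
      ext i j
      fin_cases i <;> fin_cases j <;>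
        simp [Matrix.mul_apply, Fin.sum_univ_two, smul_smul, mul_add, neg_one_zpow_mul,
          add_comm (z.deg r * monDeg r l)]
  | hadd x y _ _ hx hy =>
    rw [map_add, hx, hy]
    ext i j; fin_cases i <;> fin_cases j <;> simp
  | hsmul c x _ hx =>
    rw [map_smul, hx]
    ext i j; fin_cases i <;> fin_cases j <;> simp
    exact smul_comm _ _ _
  | h0 => rw [map_zero]; ext i j; fin_cases i <;> fin_cases j <;> simp

lemma rightPartial_matrix (z : Gen n) (x : FibreAlg n r) {m : ℤ} (hx : x ∈ degree n r m) :
    lift (fun a ↦ !![var r a, if a = z then 1 else 0;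
      0, ((-1 : ℝ) ^ (z.deg r * a.deg r)) • var r a]) (rightAux z) x =
      !![x, rightPartial z x; 0, ((-1 : ℝ) ^ (z.deg r * m)) • x] := by
  have h01 : ∀ x, rightPartial z x = lift (fun a ↦ !![var r a, if a = z then 1 else 0;
      0, ((-1 : ℝ) ^ (z.deg r * a.deg r)) • var r a]) (rightAux z) x 0 1 := fun _ ↦ rfl
  rw [h01]
  induction hx using degree_induction with
  | hm l hl =>
    subst hl
    induction l with
    | nil => ext i j; fin_cases i <;> fin_cases j <;> simp
    | cons a l ih =>
      rw [mon_cons, map_mul, ih, lift_var]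
      ext i j
      fin_cases i <;> fin_cases j <;>
        simp [Matrix.mul_apply, Fin.sum_univ_two, smul_smul, mul_add, neg_one_zpow_mul,
          add_comm (z.deg r * monDeg r l)]
  | hadd x y _ _ hx hy =>
    rw [map_add, hx, hy]
    ext i j; fin_cases i <;> fin_cases j <;> simp
  | hsmul c x _ hx =>
    rw [map_smul, hx]
    ext i j; fin_cases i <;> fin_cases j <;> simp
    exact smul_comm _ _ _
  | h0 => rw [map_zero]; ext i j; fin_cases i <;> fin_cases j <;> simp

@[simp] lemma leftPartial_var (z a : Gen n) :
    leftPartial z (var r a) = if a = z then 1 else 0 := by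
  simp [leftPartial]

@[simp] lemma rightPartial_var (z a : Gen n) :
    rightPartial z (var r a) = if a = z then 1 else 0 := by
  simp [rightPartial]

@[simp] lemma leftPartial_one (z : Gen n) : leftPartial z (1 : FibreAlg n r) = 0 := by
  simp [leftPartial]

@[simp] lemma rightPartial_one (z : Gen n) : rightPartial z (1 : FibreAlg n r) = 0 := by
  simp [rightPartial]

lemma leftPartial_mul (z : Gen n) {i j : ℤ} {x y : FibreAlg n r} (hx : x ∈ degree n r i)
    (hy : y ∈ degree n r j) : leftPartial z (x * y) =
      leftPartial z x * y + ((-1 : ℝ) ^ (z.deg r * i)) • (x * leftPartial z y) := by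
  have h := leftPartial_matrix z _ (mul_mem_degree hx hy)
  rw [map_mul, leftPartial_matrix z x hx, leftPartial_matrix z y hy] at h
  have h2 := congrFun (congrFun h 0) 1
  simpa [Matrix.mul_apply, Fin.sum_univ_two, add_comm] using h2.symm

lemma rightPartial_mul (z : Gen n) {i j : ℤ} {x y : FibreAlg n r} (hx : x ∈ degree n r i)
    (hy : y ∈ degree n r j) : rightPartial z (x * y) =
      x * rightPartial z y + ((-1 : ℝ) ^ (z.deg r * j)) • (rightPartial z x * y) := by
  have h := rightPartial_matrix z _ (mul_mem_degree hx hy)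
  rw [map_mul, rightPartial_matrix z x hx, rightPartial_matrix z y hy] at h
  have h2 := congrFun (congrFun h 0) 1
  simpa [Matrix.mul_apply, Fin.sum_univ_two] using h2.symm

lemma leftPartial_var_mul (z a : Gen n) {j : ℤ} {y : FibreAlg n r} (hy : y ∈ degree n r j) :
    leftPartial z (var r a * y) =
      (if a = z then 1 else 0 : ℝ) • y +
        ((-1 : ℝ) ^ (z.deg r * a.deg r)) • (var r a * leftPartial z y) := by
  rw [leftPartial_mul z (var_mem_degree a) hy, leftPartial_var]
  split_ifs <;> simp

lemma rightPartial_var_mul (z a : Gen n) {j : ℤ} {y : FibreAlg n r} (hy : y ∈ degree n r j) :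
    rightPartial z (var r a * y) = var r a * rightPartial z y +
      ((-1 : ℝ) ^ (z.deg r * j) * (if a = z then 1 else 0 : ℝ)) • y := by
  rw [rightPartial_mul z (var_mem_degree a) hy, rightPartial_var]
  split_ifs <;> simp

lemma leftPartial_mem_degree (z : Gen n) {m : ℤ} {x : FibreAlg n r} (hx : x ∈ degree n r m) :
    leftPartial z x ∈ degree n r (m - z.deg r) := by
  induction hx using degree_induction with
  | hm l hl =>
    subst hl
    induction l with
    | nil => simp
    | cons a l ih =>
      rw [mon_cons, leftPartial_var_mul z a (mon_mem_degree l), monDeg_cons]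
      refine add_mem ?_ (Submodule.smul_mem _ _ ?_)
      · split_ifs with h
        · subst h; simpa using mon_mem_degree l
        · simp
      · rw [add_sub_assoc]; exact mul_mem_degree (var_mem_degree a) ih
  | hadd x y _ _ hx hy => rw [map_add]; exact add_mem hx hy
  | hsmul c x _ hx => rw [map_smul]; exact Submodule.smul_mem _ _ hx
  | h0 => simp

/-- Induction on monomials: the sign is that of carrying `z` across the factors that remain after it
has been removed. -/
lemma rightPartial_eq (z : Gen n) {m : ℤ} {x : FibreAlg n r} (hx : x ∈ degree n r m) :
    rightPartial z x = ((-1 : ℝ) ^ (z.deg r * (m - z.deg r))) • leftPartial z x := by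
  induction hx using degree_induction with
  | hm l hl =>
    subst hl
    induction l with
    | nil => simp
    | cons a l ih =>
      rw [mon_cons, leftPartial_var_mul z a (mon_mem_degree l),
        rightPartial_var_mul z a (mon_mem_degree l), monDeg_cons, ih, smul_add, smul_smul,
        smul_smul, mul_smul_comm, neg_one_zpow_mul, add_comm]
      congr 2
      · split_ifs with h
        · subst h; congr 1; refine neg_one_zpow_congr ?_; grind
        · simp
      · refine neg_one_zpow_congr ?_; grind
  | hadd x y _ _ hx hy => rw [map_add, map_add, hx, hy, smul_add]
  | hsmul c x _ hx => rw [map_smul, map_smul, hx, smul_comm]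
  | h0 => simp

/-- Induction on monomials. When the first generator is removed by one of the two derivatives, the
other acts on the tail; the two orders produce the same terms up to the stated sign, with the two
removal terms exchanged. -/
lemma leftPartial_comm (y z : Gen n) (x : FibreAlg n r) :
    leftPartial y (leftPartial z x) =
      ((-1 : ℝ) ^ (y.deg r * z.deg r)) • leftPartial z (leftPartial y x) := by
  suffices h : leftPartial y ∘ₗ leftPartial z =
      ((-1 : ℝ) ^ (y.deg r * z.deg r)) • (leftPartial (r := r) z ∘ₗ leftPartial y) from
    LinearMap.congr_fun h x
  refine linearMap_ext fun l ↦ ?_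
  simp only [LinearMap.comp_apply, LinearMap.smul_apply]
  induction l with
  | nil => simp
  | cons a l ih =>
    have hl := mon_mem_degree (r := r) l
    rw [mon_cons, leftPartial_var_mul z a hl, leftPartial_var_mul y a hl, map_add, map_add,
      map_smul, map_smul, map_smul, map_smul, leftPartial_var_mul y a (leftPartial_mem_degree z hl),
      leftPartial_var_mul z a (leftPartial_mem_degree y hl), ih]
    simp only [smul_add, mul_smul_comm, smul_smul, neg_one_zpow_mul]
    have h1 : (if a = z then 1 else 0 : ℝ) = (-1) ^ (y.deg r * z.deg r) *
        ((-1) ^ (y.deg r * a.deg r) * (if a = z then 1 else 0 : ℝ)) := by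
      split_ifs with h
      · rw [h, mul_one, neg_one_zpow_mul_self]
      · simp
    have h2 : (-1 : ℝ) ^ (z.deg r * a.deg r) * (if a = y then 1 else 0 : ℝ) =
        (-1) ^ (y.deg r * z.deg r) * (if a = y then 1 else 0 : ℝ) := by
      split_ifs with h
      · rw [h, mul_comm (z.deg r)]
      · simp
    rw [h2]
    nth_rewrite 1 [h1]
    rw [show z.deg r * a.deg r + (y.deg r * a.deg r + y.deg r * z.deg r) =
      y.deg r * z.deg r + (y.deg r * a.deg r + z.deg r * a.deg r) by ring]
    abel

end FibreAlg
end HigherCourant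

/-! ### Coefficientwise calculus of polynomial-valued functions of `x` -/

namespace HigherCourant

variable {n r : ℕ}

/-- Linear functionals separate the points of a real vector space, so coefficientwise derivatives
are unique without a topology on the fibre algebra. -/
lemma HasPartialX.unique {F : Euc n → FibreAlg n r} {i : Fin n} {y : Euc n} {D D' : FibreAlg n r}
    (h : HasPartialX F i y D) (h' : HasPartialX F i y D') : D = D' := by
  rw [← sub_eq_zero, ← Module.forall_dual_apply_eq_zero_iff ℝ]
  intro ℓ
  rw [map_sub, sub_eq_zero]
  exact HasLineDerivAt.unique (h ℓ) (h' ℓ)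

lemma HasPartialX.partialX_eq {F : Euc n → FibreAlg n r} {i : Fin n} {y : Euc n}
    {D : FibreAlg n r} (h : HasPartialX F i y D) : partialX F i y = D := by
  have h' : ∃ D, HasPartialX F i y D := ⟨D, h⟩
  rw [partialX, dif_pos h']
  exact h'.choose_spec.unique h

lemma HasPartialX.congr {F G : Euc n → FibreAlg n r} {i : Fin n} {y : Euc n} {D : FibreAlg n r}
    (h : HasPartialX F i y D) (hFG : F =ᶠ[𝓝 y] G) : HasPartialX G i y D := fun ℓ ↦
  (hFG.symm.fun_comp ℓ).hasLineDerivAt_iff.2 (h ℓ)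

lemma partialX_congr {F G : Euc n → FibreAlg n r} {y : Euc n} (hFG : F =ᶠ[𝓝 y] G) (i : Fin n) :
    partialX F i y = partialX G i y := by
  by_cases h : ∃ D, HasPartialX F i y D
  · obtain ⟨D, hD⟩ := h
    rw [hD.partialX_eq, (hD.congr hFG).partialX_eq]
  · rw [partialX, dif_neg h, partialX, dif_neg fun ⟨D, hD⟩ ↦ h ⟨D, hD.congr hFG.symm⟩]

lemma HasPartialX.map {F : Euc n → FibreAlg n r} {i : Fin n} {y : Euc n} {D : FibreAlg n r}
    (h : HasPartialX F i y D) (φ : FibreAlg n r →ₗ[ℝ] FibreAlg n r) :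
    HasPartialX (fun y ↦ φ (F y)) i y (φ D) := fun ℓ ↦ h (ℓ ∘ₗ φ)

lemma HasPartialX.add {F G : Euc n → FibreAlg n r} {i : Fin n} {y : Euc n} {D E : FibreAlg n r}
    (h : HasPartialX F i y D) (h' : HasPartialX G i y E) :
    HasPartialX (fun y ↦ F y + G y) i y (D + E) := fun ℓ ↦ by
  simpa [HasLineDerivAt] using HasDerivAt.fun_add (h ℓ) (h' ℓ)

lemma hasPartialX_smul {f : Euc n → ℝ} {i : Fin n} {y : Euc n} (hf : DifferentiableAt ℝ f y)
    (m : FibreAlg n r) :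
    HasPartialX (fun y ↦ f y • m) i y (fderiv ℝ f y (basisVec i) • m) := fun ℓ ↦ by
  simpa [mul_comm] using (hf.hasFDerivAt.mul_const (ℓ m)).hasLineDerivAt (basisVec i)

lemma hasPartialX_sum {N : Type*} (s : Finset N) {F : N → Euc n → FibreAlg n r} {i : Fin n}
    {y : Euc n} {D : N → FibreAlg n r} (h : ∀ k ∈ s, HasPartialX (F k) i y (D k)) :
    HasPartialX (fun y ↦ ∑ k ∈ s, F k y) i y (∑ k ∈ s, D k) := fun ℓ ↦ by
  have := HasDerivAt.fun_sum fun k hk ↦ h k hk ℓ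
  simpa [HasLineDerivAt, map_sum] using this

/-- A finite sum presentation of a local function near a point. -/
lemma IsSmoothOn.exists_eventuallyEq {F : Euc n → FibreAlg n r} {U : Set (Euc n)}
    (hF : IsSmoothOn F U) {y : Euc n} (hy : y ∈ U) :
    ∃ O : Set (Euc n), IsOpen O ∧ y ∈ O ∧ ∃ (N : Type) (_ : Fintype N) (f : N → Euc n → ℝ)
      (m : N → FibreAlg n r), (∀ s, ContDiffOn ℝ ∞ (f s) O) ∧
      (∀ y' ∈ O, F y' = ∑ s, f s y' • m s) ∧
      ∀ i, ∀ y' ∈ O, HasPartialX F i y' (∑ s, fderiv ℝ (f s) y' (basisVec i) • m s) := by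
  obtain ⟨O, hO, hyO, N, hN, f, m, hf, hF⟩ := hF y hy
  refine ⟨O, hO, hyO, N, hN, f, m, hf, hF, fun i y' hy' ↦ ?_⟩
  refine HasPartialX.congr (hasPartialX_sum Finset.univ fun s _ ↦ hasPartialX_smul
    (((hf s).contDiffAt (hO.mem_nhds hy')).differentiableAt (by simp)) (m s)) ?_
  filter_upwards [hO.mem_nhds hy'] with z hz
  rw [hF z hz]

lemma IsSmoothOn.hasPartialX {F : Euc n → FibreAlg n r} {U : Set (Euc n)} (hF : IsSmoothOn F U)
    {y : Euc n} (hy : y ∈ U) (i : Fin n) : HasPartialX F i y (partialX F i y) := by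
  obtain ⟨O, hO, hyO, N, _, f, m, hf, h, hD⟩ := hF.exists_eventuallyEq hy
  rw [(hD i y hyO).partialX_eq]
  exact hD i y hyO

lemma IsSmoothOn.congr {F G : Euc n → FibreAlg n r} {U : Set (Euc n)} (hF : IsSmoothOn F U)
    (hU : IsOpen U) (h : ∀ y ∈ U, G y = F y) : IsSmoothOn G U := by
  intro y hy
  obtain ⟨O, hO, hyO, N, hN, f, m, hf, hF⟩ := hF y hy
  exact ⟨O ∩ U, hO.inter hU, ⟨hyO, hy⟩, N, hN, f, m, fun s ↦ (hf s).mono Set.inter_subset_left,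
    fun y' hy' ↦ by rw [h y' hy'.2, hF y' hy'.1]⟩

lemma IsSmoothOn.mono {F : Euc n → FibreAlg n r} {U V : Set (Euc n)} (hF : IsSmoothOn F U)
    (hV : V ⊆ U) : IsSmoothOn F V := fun y hy ↦ hF y (hV hy)

lemma IsSmoothOn.add {F G : Euc n → FibreAlg n r} {U : Set (Euc n)} (hF : IsSmoothOn F U)
    (hG : IsSmoothOn G U) : IsSmoothOn (fun y ↦ F y + G y) U := by
  intro y hy
  obtain ⟨O, hO, hyO, N, _, f, m, hf, hF⟩ := hF y hy
  obtain ⟨O', hO', hyO', N', _, f', m', hf', hG⟩ := hG y hy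
  refine ⟨O ∩ O', hO.inter hO', ⟨hyO, hyO'⟩, N ⊕ N', inferInstance, Sum.elim f f',
    Sum.elim m m', ?_, fun y' hy' ↦ ?_⟩
  · rintro (s | s)
    · exact (hf s).mono Set.inter_subset_left
    · exact (hf' s).mono Set.inter_subset_right
  · simp [Fintype.sum_sum_type, hF y' hy'.1, hG y' hy'.2]

lemma IsSmoothOn.mul {F G : Euc n → FibreAlg n r} {U : Set (Euc n)} (hF : IsSmoothOn F U)
    (hG : IsSmoothOn G U) : IsSmoothOn (fun y ↦ F y * G y) U := by
  intro y hy
  obtain ⟨O, hO, hyO, N, _, f, m, hf, hF⟩ := hF y hy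
  obtain ⟨O', hO', hyO', N', _, f', m', hf', hG⟩ := hG y hy
  refine ⟨O ∩ O', hO.inter hO', ⟨hyO, hyO'⟩, N × N', inferInstance,
    fun s y ↦ f s.1 y * f' s.2 y, fun s ↦ m s.1 * m' s.2, fun s ↦ ?_, fun y' hy' ↦ ?_⟩
  · exact ((hf _).mono Set.inter_subset_left).mul ((hf' _).mono Set.inter_subset_right)
  · simp only [hF y' hy'.1, hG y' hy'.2, Fintype.sum_prod_type, Finset.sum_mul_sum,
      smul_mul_smul_comm]

lemma IsSmoothOn.map {F : Euc n → FibreAlg n r} {U : Set (Euc n)} (hF : IsSmoothOn F U)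
    (φ : FibreAlg n r →ₗ[ℝ] FibreAlg n r) : IsSmoothOn (fun y ↦ φ (F y)) U := by
  intro y hy
  obtain ⟨O, hO, hyO, N, hN, f, m, hf, hF⟩ := hF y hy
  exact ⟨O, hO, hyO, N, hN, f, fun s ↦ φ (m s), hf, fun y' hy' ↦ by simp [hF y' hy']⟩

lemma isSmoothOn_smul {f : Euc n → ℝ} {U : Set (Euc n)} (hU : IsOpen U) (hf : ContDiffOn ℝ ∞ f U)
    (m : FibreAlg n r) : IsSmoothOn (fun y ↦ f y • m) U := fun y hy ↦
  ⟨U, hU, hy, Unit, inferInstance, fun _ ↦ f, fun _ ↦ m, fun _ ↦ hf, fun _ _ ↦ by simp⟩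

lemma isSmoothOn_const (U : Set (Euc n)) (m : FibreAlg n r) : IsSmoothOn (fun _ ↦ m) U :=
  ((isSmoothOn_smul isOpen_univ (f := fun _ ↦ 1) contDiffOn_const m).congr isOpen_univ
    (by simp)).mono (Set.subset_univ U)

lemma IsSmoothOn.sum {N : Type*} (s : Finset N) {F : N → Euc n → FibreAlg n r} {U : Set (Euc n)}
    (h : ∀ k ∈ s, IsSmoothOn (F k) U) : IsSmoothOn (fun y ↦ ∑ k ∈ s, F k y) U := by
  classical
  induction s using Finset.induction_on with
  | empty => simpa using isSmoothOn_const U 0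
  | insert k s hk ih =>
    simp only [Finset.sum_insert hk]
    exact (h k (by simp)).add (ih fun k hk ↦ h k (by simp [hk]))

lemma contDiffOn_fderiv_apply {f : Euc n → ℝ} {U : Set (Euc n)} (hU : IsOpen U)
    (hf : ContDiffOn ℝ ∞ f U) (v : Euc n) : ContDiffOn ℝ ∞ (fun y ↦ fderiv ℝ f y v) U :=
  (hf.fderiv_of_isOpen hU (by simp)).clm_apply contDiffOn_const

lemma IsSmoothOn.partialX {F : Euc n → FibreAlg n r} {U : Set (Euc n)} (hF : IsSmoothOn F U)
    (i : Fin n) : IsSmoothOn (partialX F i) U := by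
  intro y hy
  obtain ⟨O, hO, hyO, N, hN, f, m, hf, h, hD⟩ := hF.exists_eventuallyEq hy
  exact ⟨O, hO, hyO, N, hN, fun s y ↦ fderiv ℝ (f s) y (basisVec i), m,
    fun s ↦ contDiffOn_fderiv_apply hO (hf s) _, fun y' hy' ↦ (hD i y' hy').partialX_eq⟩

lemma HasPartialX.mul {F G : Euc n → FibreAlg n r} {U : Set (Euc n)} (hF : IsSmoothOn F U)
    (hG : IsSmoothOn G U) {y : Euc n} (hy : y ∈ U) (i : Fin n) :
    HasPartialX (fun y ↦ F y * G y) i y (HigherCourant.partialX F i y * G y +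
      F y * HigherCourant.partialX G i y) := by
  obtain ⟨O, hO, hyO, N, _, f, m, hf, h, hD⟩ := hF.exists_eventuallyEq hy
  obtain ⟨O', hO', hyO', N', _, f', m', hf', h', hD'⟩ := hG.exists_eventuallyEq hy
  rw [(hD i y hyO).partialX_eq, (hD' i y hyO').partialX_eq, h y hyO, h' y hyO']
  have hd : ∀ s, DifferentiableAt ℝ (f s) y := fun s ↦
    ((hf s).contDiffAt (hO.mem_nhds hyO)).differentiableAt (by simp)
  have hd' : ∀ s, DifferentiableAt ℝ (f' s) y := fun s ↦
    ((hf' s).contDiffAt (hO'.mem_nhds hyO')).differentiableAt (by simp)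
  have key := hasPartialX_sum (n := n) (r := r) Finset.univ (i := i) (y := y)
    (F := fun (s : N × N') y ↦ (f s.1 y * f' s.2 y) • (m s.1 * m' s.2))
    fun s _ ↦ hasPartialX_smul ((hd s.1).mul (hd' s.2)) (m s.1 * m' s.2)
  convert key.congr ?_ using 1
  · simp only [Fintype.sum_prod_type, Finset.sum_mul_sum, ← Finset.sum_add_distrib]
    refine Finset.sum_congr rfl fun s _ ↦ Finset.sum_congr rfl fun t _ ↦ ?_
    have : fderiv ℝ (fun y ↦ f s y * f' t y) y = f s y • fderiv ℝ (f' t) y +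
        f' t y • fderiv ℝ (f s) y := fderiv_fun_mul (hd s) (hd' t)
    change _ = (fderiv ℝ (fun y ↦ f s y * f' t y) y) (basisVec i) • _
    rw [this]
    simp only [smul_mul_assoc, mul_smul_comm, smul_smul, ← add_smul,
      add_apply, smul_apply, smul_eq_mul]
    congr 1
    ring
  · filter_upwards [hO.mem_nhds hyO, hO'.mem_nhds hyO'] with z hz hz'
    simp only [h z hz, h' z hz', Fintype.sum_prod_type, Finset.sum_mul_sum, smul_mul_smul_comm]

/-- A functional that vanishes on `p` vanishes along `F` near `y`, hence on the derivative; if the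
derivative were outside `p`, some such functional would detect it. With `p` a homogeneous component,
this says that `∂/∂xⁱ` has degree `0`. -/
lemma partialX_mem {F : Euc n → FibreAlg n r} {U : Set (Euc n)} (hU : IsOpen U)
    (hF : IsSmoothOn F U) {p : Submodule ℝ (FibreAlg n r)} (hp : ∀ y ∈ U, F y ∈ p)
    {y : Euc n} (hy : y ∈ U) (i : Fin n) : partialX F i y ∈ p := by
  by_contra hn
  obtain ⟨ℓ, hℓ, hp'⟩ := Submodule.exists_le_ker_of_notMem hn
  refine hℓ ?_
  have h1 := hF.hasPartialX hy i ℓ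
  have h2 : HasLineDerivAt ℝ (fun y' ↦ ℓ (F y')) 0 y (basisVec i) := by
    have : (fun y' ↦ ℓ (F y')) =ᶠ[𝓝 y] fun _ ↦ 0 := by
      filter_upwards [hU.mem_nhds hy] with z hz
      exact hp' (hp z hz)
    exact this.hasLineDerivAt_iff.2 (hasDerivAt_const _ _)
  exact HasLineDerivAt.unique h1 h2

lemma two_le_infty : (2 : WithTop ℕ∞) ≤ ∞ :=
  WithTop.coe_le_coe.2 (le_top (a := (2 : ℕ∞)))

lemma partialX_partialX {F : Euc n → FibreAlg n r} {U : Set (Euc n)} (hF : IsSmoothOn F U)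
    {y : Euc n} (hy : y ∈ U) (i j : Fin n) :
    partialX (partialX F i) j y = partialX (partialX F j) i y := by
  obtain ⟨O, hO, hyO, N, _, f, m, hf, h, hD⟩ := hF.exists_eventuallyEq hy
  have key : ∀ i j, HasPartialX (partialX F i) j y
      (∑ s, fderiv ℝ (fun z ↦ fderiv ℝ (f s) z (basisVec i)) y (basisVec j) • m s) := by
    intro i j
    refine HasPartialX.congr (hasPartialX_sum Finset.univ fun s _ ↦ hasPartialX_smul
      (((contDiffOn_fderiv_apply hO (hf s) (basisVec i)).contDiffAt
        (hO.mem_nhds hyO)).differentiableAt (by simp)) (m s)) ?_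
    filter_upwards [hO.mem_nhds hyO] with z hz
    rw [(hD i z hz).partialX_eq]
  rw [(key i j).partialX_eq, (key j i).partialX_eq]
  refine Finset.sum_congr rfl fun s _ ↦ ?_
  have hfs : ContDiffAt ℝ ∞ (f s) y := (hf s).contDiffAt (hO.mem_nhds hyO)
  have hd : DifferentiableAt ℝ (fderiv ℝ (f s)) y :=
    (hfs.fderiv_right (m := ∞) (by simp)).differentiableAt (by simp)
  have hsym : IsSymmSndFDerivAt ℝ (f s) y :=
    hfs.isSymmSndFDerivAt (by simp [two_le_infty])
  have : ∀ v w : Euc n, fderiv ℝ (fun z ↦ fderiv ℝ (f s) z v) y w =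
      fderiv ℝ (fderiv ℝ (f s)) y w v := fun v w ↦ by
    rw [fderiv_clm_apply hd (differentiableAt_const v)]
    simp
  rw [this, this, hsym]

end HigherCourant

/-! ### Local functions form a Darboux system -/

namespace HigherCourant

variable {n r : ℕ}

lemma FibreAlg.neg_smul' (c : ℝ) (x : FibreAlg n r) : (-c) • x = -(c • x) := neg_smul c x

/-- Local functions of degree `m` over `U`, extended by zero. -/
def locFun (n r : ℕ) (U : Set (Euc n)) (m : ℤ) : Submodule ℝ (Euc n → FibreAlg n r) where
  carrier := {F | IsSmoothOn F U ∧ (∀ y ∈ U, F y ∈ degree n r m) ∧ ∀ y ∉ U, F y = 0}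
  add_mem' := by
    rintro F G ⟨h1, h2, h3⟩ ⟨k1, k2, k3⟩
    exact ⟨h1.add k1, fun y hy ↦ add_mem (h2 y hy) (k2 y hy), fun y hy ↦ by simp [h3 y hy, k3 y hy]⟩
  zero_mem' := ⟨isSmoothOn_const U 0, fun _ _ ↦ zero_mem _, fun _ _ ↦ rfl⟩
  smul_mem' := by
    rintro c F ⟨h1, h2, h3⟩
    exact ⟨h1.map (LinearMap.lsmul ℝ _ c), fun y hy ↦ Submodule.smul_mem _ _ (h2 y hy),
      fun y hy ↦ by simp [h3 y hy]⟩

/-- Indices of the coordinates `xⁱ`, `Pᵢ`, `vⁱ`, `pᵢ`. -/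
abbrev Coord (n : ℕ) := (Fin n ⊕ Fin n) ⊕ (Fin n ⊕ Fin n)

namespace Coord

/-- The degree of a coordinate. -/
def deg (r : ℕ) : Coord n → ℤ
  | .inl (.inl _) => 0
  | .inl (.inr _) => r
  | .inr (.inl _) => 1
  | .inr (.inr _) => r - 1

/-- The conjugate coordinate. -/
def conj : Coord n → Coord n := Sum.map Sum.swap Sum.swap

/-- The sign of a coordinate in the Poisson bracket. -/
def sign (r : ℕ) : Coord n → ℝ
  | .inl (.inl _) => 1
  | .inl (.inr _) => -1
  | .inr (.inl _) => 1
  | .inr (.inr _) => (-1) ^ r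

open Classical in
/-- Left partial derivatives of local functions. -/
noncomputable def left (U : Set (Euc n)) : Coord n → (Euc n → FibreAlg n r) → Euc n → FibreAlg n r
  | .inl (.inl i), F => fun y ↦ if y ∈ U then partialX F i y else 0
  | .inl (.inr i), F => fun y ↦ leftPartial (.P i) (F y)
  | .inr (.inl i), F => fun y ↦ leftPartial (.v i) (F y)
  | .inr (.inr i), F => fun y ↦ leftPartial (.p i) (F y)

open Classical in
/-- Right partial derivatives of local functions. -/
noncomputable def right (U : Set (Euc n)) : Coord n → (Euc n → FibreAlg n r) → Euc n → FibreAlg n r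
  | .inl (.inl i), F => fun y ↦ if y ∈ U then partialX F i y else 0
  | .inl (.inr i), F => fun y ↦ rightPartial (.P i) (F y)
  | .inr (.inl i), F => fun y ↦ rightPartial (.v i) (F y)
  | .inr (.inr i), F => fun y ↦ rightPartial (.p i) (F y)

lemma left_gen (U : Set (Euc n)) (z : Coord n) : (∃ i, z = .inl (.inl i)) ∨
    ∃ g : Gen n, g.deg r = deg r z ∧
      (∀ F : Euc n → FibreAlg n r, left U z F = fun y ↦ leftPartial g (F y)) ∧
      ∀ F : Euc n → FibreAlg n r, right U z F = fun y ↦ rightPartial g (F y) := by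
  rcases z with (i | i) | (i | i)
  · exact Or.inl ⟨i, rfl⟩
  · exact Or.inr ⟨.P i, rfl, fun _ ↦ rfl, fun _ ↦ rfl⟩
  · exact Or.inr ⟨.v i, rfl, fun _ ↦ rfl, fun _ ↦ rfl⟩
  · exact Or.inr ⟨.p i, rfl, fun _ ↦ rfl, fun _ ↦ rfl⟩

end Coord

lemma map_leftPartial_partialX {F : Euc n → FibreAlg n r} {U : Set (Euc n)} (hF : IsSmoothOn F U)
    {y : Euc n} (hy : y ∈ U) (i : Fin n) (φ : FibreAlg n r →ₗ[ℝ] FibreAlg n r) :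
    partialX (fun y ↦ φ (F y)) i y = φ (partialX F i y) :=
  ((hF.hasPartialX hy i).map φ).partialX_eq

open Coord Classical in
-- Fibre derivatives act pointwise and are governed by the algebra; `∂/∂xⁱ` is an even derivation of
-- degree `0` commuting with them. Extending everything by zero off `U` turns the identities into
-- equalities of functions on all of `ℝⁿ`.
lemma darbouxData_locFun {U : Set (Euc n)} (hU : IsOpen U) :
    DarbouxData (locFun n r U) (left U) (right U) (deg r) conj (sign r) r where
  mul_mem := by
    rintro i j F ⟨h1, h2, h3⟩ G ⟨k1, k2, k3⟩
    exact ⟨h1.mul k1, fun y hy ↦ mul_mem_degree (h2 y hy) (k2 y hy), fun y hy ↦ by simp [h3 y hy]⟩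
  comm := by
    rintro i j F ⟨h1, h2, h3⟩ G ⟨k1, k2, k3⟩
    ext1 y
    by_cases hy : y ∈ U
    · exact mul_comm_degree (h2 y hy) (k2 y hy)
    · simp [h3 y hy]
  L_mem := by
    rintro z m F ⟨h1, h2, h3⟩
    rcases left_gen (r := r) U z with ⟨i, rfl⟩ | ⟨g, hg, hl, hr⟩
    · refine ⟨(h1.partialX i).congr hU fun y hy ↦ if_pos hy, fun y hy ↦ ?_, fun y hy ↦ if_neg hy⟩
      change ite _ _ _ ∈ _
      rw [if_pos hy]
      simpa [deg] using partialX_mem hU h1 h2 hy i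
    · rw [hl, ← hg]
      exact ⟨h1.map _, fun y hy ↦ leftPartial_mem_degree g (h2 y hy), fun y hy ↦ by simp [h3 y hy]⟩
  R_eq := by
    rintro z m F ⟨h1, h2, h3⟩
    rcases left_gen (r := r) U z with ⟨i, rfl⟩ | ⟨g, hg, hl, hr⟩
    · simp [deg, left, right]
    · rw [hl, hr, ← hg]
      ext1 y
      by_cases hy : y ∈ U
      · exact rightPartial_eq g (h2 y hy)
      · simp [h3 y hy]
  L_add := by
    rintro z m F ⟨h1, h2, h3⟩ G ⟨k1, k2, k3⟩
    rcases left_gen (r := r) U z with ⟨i, rfl⟩ | ⟨g, hg, hl, hr⟩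
    · ext1 y
      by_cases hy : y ∈ U
      · simp only [left, if_pos hy, Pi.add_apply]
        exact ((h1.hasPartialX hy i).add (k1.hasPartialX hy i)).partialX_eq
      · simp [left, hy]
    · ext1 y; simp [hl]
  L_smul := by
    rintro z m c F ⟨h1, h2, h3⟩
    rcases left_gen (r := r) U z with ⟨i, rfl⟩ | ⟨g, hg, hl, hr⟩
    · ext1 y
      by_cases hy : y ∈ U
      · simp only [left, if_pos hy, Pi.smul_apply]
        exact ((h1.hasPartialX hy i).map (LinearMap.lsmul ℝ _ c)).partialX_eq
      · simp [left, hy]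
    · ext1 y; simp [hl]
  L_mul := by
    rintro z i j F ⟨h1, h2, h3⟩ G ⟨k1, k2, k3⟩
    rcases left_gen (r := r) U z with ⟨i, rfl⟩ | ⟨g, hg, hl, hr⟩
    · ext1 y
      by_cases hy : y ∈ U
      · simp only [left, if_pos hy, Pi.add_apply, Pi.mul_apply, deg, zero_mul,
          zpow_zero, one_smul]
        exact (HasPartialX.mul h1 k1 hy i).partialX_eq
      · simp [left, hy]
    · ext1 y
      by_cases hy : y ∈ U
      · simp only [hl, Pi.add_apply, Pi.mul_apply, Pi.smul_apply, ← hg]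
        exact leftPartial_mul g (h2 y hy) (k2 y hy)
      · simp [hl, h3 y hy, k3 y hy]
  L_L := by
    rintro y z m F ⟨h1, h2, h3⟩
    -- The derivative extended by zero coincides with `partialX` only on `U`; openness of `U` gives
    -- equality of germs, which is what a second derivative requires.
    have hloc : ∀ i, ∀ x ∈ U, (left U (.inl (.inl i)) F) =ᶠ[𝓝 x] partialX F i := fun i x hx ↦ by
      filter_upwards [hU.mem_nhds hx] with w hw
      simp [left, hw]
    rcases left_gen (r := r) U y with ⟨i, rfl⟩ | ⟨g, hg, hl, hr⟩ <;>
    rcases left_gen (r := r) U z with ⟨j, rfl⟩ | ⟨g', hg', hl', hr'⟩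
    · ext1 x
      by_cases hx : x ∈ U
      · simp only [deg, zero_mul, zpow_zero, one_smul]
        have hij : ∀ i j, left U (.inl (.inl i)) (left U (.inl (.inl j)) F) x =
            partialX (partialX F j) i x := fun i j ↦
          (if_pos hx).trans (partialX_congr (hloc j x hx) i)
        rw [hij, hij, partialX_partialX h1 hx]
      · simp [left, hx]
    · ext1 x
      by_cases hx : x ∈ U
      · simp only [deg, zero_mul, zpow_zero, one_smul, hl']
        simp only [left, if_pos hx]
        rw [map_leftPartial_partialX h1 hx]
      · rw [hl', hl']
        simp [left, hx]
    · ext1 x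
      by_cases hx : x ∈ U
      · simp only [deg, mul_zero, zpow_zero, one_smul, hl]
        simp only [left, if_pos hx]
        rw [map_leftPartial_partialX h1 hx]
      · rw [hl, hl]
        simp [left, hx]
    · ext1 x
      simp only [hl, hl', ← hg, ← hg', Pi.smul_apply]
      exact leftPartial_comm g g' (F x)
  conj_conj := by rintro ((i | i) | (i | i)) <;> rfl
  deg_conj := by rintro ((i | i) | (i | i)) <;> simp [conj, deg]
  eps_conj := by
    rintro ((i | i) | (i | i))
    · simp [conj, deg, sign]
    · simp [conj, deg, sign]
    · simp only [conj, deg, sign, Sum.map_inr, Sum.swap_inl, one_mul]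
      rw [zpow_sub₀ (by norm_num)]; simp [div_neg]
    · simp only [conj, deg, sign, Sum.map_inr, Sum.swap_inr, sub_sub_cancel, mul_one]
      rw [zpow_sub₀ (by norm_num)]; simp [div_neg, ← mul_pow]

open Coord in
lemma bracket_eq_poisson {U : Set (Euc n)} (F G : Euc n → FibreAlg n r) {y : Euc n} (hy : y ∈ U) :
    DarbouxData.bracket (left U) (right U) conj (sign r) F G y = poisson F G y := by
  simp only [DarbouxData.bracket, poisson, Fintype.sum_sum_type, Finset.sum_apply,
    Pi.smul_apply, Pi.mul_apply, sign, conj, Sum.map_inl, Sum.map_inr, Sum.swap_inl, Sum.swap_inr,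
    left, right, if_pos hy, one_smul, Finset.sum_add_distrib, Finset.sum_sub_distrib]
  simp only [neg_smul', one_smul, Finset.sum_neg_distrib]
  abel

end HigherCourant

/-! ### Brackets of the basic local functions -/

namespace HigherCourant

variable {n r : ℕ}

lemma FibreAlg.leftPartial_var_mul_var (z a b : Gen n) :
    leftPartial z (var r a * var r b) = (if a = z then 1 else 0 : ℝ) • var r b +
      ((-1 : ℝ) ^ (z.deg r * a.deg r) * (if b = z then 1 else 0 : ℝ)) • var r a := by
  rw [leftPartial_var_mul z a (var_mem_degree b), leftPartial_var]
  split_ifs <;> simp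

lemma FibreAlg.rightPartial_var_mul_var (z a b : Gen n) :
    rightPartial z (var r a * var r b) = (if b = z then 1 else 0 : ℝ) • var r a +
      ((-1 : ℝ) ^ (z.deg r * b.deg r) * (if a = z then 1 else 0 : ℝ)) • var r b := by
  rw [rightPartial_var_mul z a (var_mem_degree b), rightPartial_var]
  split_ifs <;> simp

lemma poisson_congr {F F' G G' : Euc n → FibreAlg n r} {y : Euc n} (hF : F =ᶠ[𝓝 y] F')
    (hG : G =ᶠ[𝓝 y] G') : poisson F G y = poisson F' G' y := by
  simp only [poisson, partialX_congr hF, partialX_congr hG, hF.eq_of_nhds, hG.eq_of_nhds]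

/-- The local function `Xⁱ pᵢ`. -/
noncomputable def vecP (r : ℕ) (X : Fin n → Euc n → ℝ) (y : Euc n) : FibreAlg n r :=
  ∑ i, X i y • var r (.p i)

/-- The local function `Kᵢ vⁱ`. -/
noncomputable def covV (r : ℕ) (K : Fin n → Euc n → ℝ) (y : Euc n) : FibreAlg n r :=
  ∑ i, K i y • var r (.v i)

/-- The local function `Yⁱ Pᵢ + (∂Yⁱ/∂xʲ) vʲ pᵢ`. -/
noncomputable def vecL (r : ℕ) (Y : Fin n → Euc n → ℝ) (y : Euc n) : FibreAlg n r :=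
  ∑ i, (Y i y • var r (.P i) +
    ∑ j, fderiv ℝ (Y i) y (basisVec j) • (var r (.v j) * var r (.p i)))

/-- The polynomial `vⁱ Pᵢ`. -/
noncomputable def polyS (n r : ℕ) : FibreAlg n r := ∑ i, var r (.v i) * var r (.P i)

section partials

lemma hasPartialX_const (m : FibreAlg n r) (i : Fin n) (y : Euc n) :
    HasPartialX (fun _ ↦ m) i y 0 := fun ℓ ↦ by
  rw [map_zero]; exact hasDerivAt_const _ _

@[simp] lemma partialX_const (m : FibreAlg n r) (i : Fin n) (y : Euc n) :
    partialX (fun _ ↦ m) i y = 0 := (hasPartialX_const m i y).partialX_eq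

lemma partialX_smul {f : Euc n → ℝ} {y : Euc n} (hf : DifferentiableAt ℝ f y)
    (m : FibreAlg n r) (i : Fin n) :
    partialX (fun y ↦ f y • m) i y = fderiv ℝ f y (basisVec i) • m :=
  (hasPartialX_smul hf m).partialX_eq

lemma partialX_vecP {X : Fin n → Euc n → ℝ} {y : Euc n} (hX : ∀ i, DifferentiableAt ℝ (X i) y)
    (i : Fin n) : partialX (vecP r X) i y = ∑ j, fderiv ℝ (X j) y (basisVec i) • var r (.p j) :=
  (hasPartialX_sum _ fun j _ ↦ hasPartialX_smul (hX j) _).partialX_eq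

lemma partialX_covV {X : Fin n → Euc n → ℝ} {y : Euc n} (hX : ∀ i, DifferentiableAt ℝ (X i) y)
    (i : Fin n) : partialX (covV r X) i y = ∑ j, fderiv ℝ (X j) y (basisVec i) • var r (.v j) :=
  (hasPartialX_sum _ fun j _ ↦ hasPartialX_smul (hX j) _).partialX_eq

variable (X : Fin n → Euc n → ℝ) (y : Euc n) (i : Fin n)

@[simp] lemma leftPartial_p_vecP : leftPartial (.p i) (vecP r X y) = algebraMap ℝ _ (X i y) := by
  simp [vecP, Algebra.algebraMap_eq_smul_one]
@[simp] lemma leftPartial_v_vecP : leftPartial (.v i) (vecP r X y) = 0 := by simp [vecP]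
@[simp] lemma leftPartial_P_vecP : leftPartial (.P i) (vecP r X y) = 0 := by simp [vecP]
@[simp] lemma rightPartial_p_vecP : rightPartial (.p i) (vecP r X y) = algebraMap ℝ _ (X i y) := by
  simp [vecP, Algebra.algebraMap_eq_smul_one]
@[simp] lemma rightPartial_v_vecP : rightPartial (.v i) (vecP r X y) = 0 := by simp [vecP]
@[simp] lemma rightPartial_P_vecP : rightPartial (.P i) (vecP r X y) = 0 := by simp [vecP]
@[simp] lemma leftPartial_v_covV : leftPartial (.v i) (covV r X y) = algebraMap ℝ _ (X i y) := by
  simp [covV, Algebra.algebraMap_eq_smul_one]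
@[simp] lemma leftPartial_p_covV : leftPartial (.p i) (covV r X y) = 0 := by simp [covV]
@[simp] lemma leftPartial_P_covV : leftPartial (.P i) (covV r X y) = 0 := by simp [covV]
@[simp] lemma rightPartial_v_covV : rightPartial (.v i) (covV r X y) = algebraMap ℝ _ (X i y) := by
  simp [covV, Algebra.algebraMap_eq_smul_one]
@[simp] lemma rightPartial_p_covV : rightPartial (.p i) (covV r X y) = 0 := by simp [covV]
@[simp] lemma rightPartial_P_covV : rightPartial (.P i) (covV r X y) = 0 := by simp [covV]

@[simp] lemma rightPartial_P_polyS : rightPartial (.P i) (polyS n r) = var r (.v i) := by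
  simp [polyS, rightPartial_var_mul_var]
@[simp] lemma rightPartial_p_polyS : rightPartial (.p i) (polyS n r) = 0 := by
  simp [polyS, rightPartial_var_mul_var]
@[simp] lemma rightPartial_v_polyS :
    rightPartial (.v i) (polyS n r) = ((-1 : ℝ) ^ r) • var r (.P i) := by
  simp [polyS, rightPartial_var_mul_var, Gen.deg]
@[simp] lemma leftPartial_p_polyS : leftPartial (.p i) (polyS n r) = 0 := by
  simp [polyS, leftPartial_var_mul_var]

@[simp] lemma leftPartial_algebraMap (z : Gen n) (c : ℝ) :
    leftPartial z (algebraMap ℝ (FibreAlg n r) c) = 0 := by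
  simp [Algebra.algebraMap_eq_smul_one]
@[simp] lemma rightPartial_P_vecL :
    rightPartial (.P i) (vecL r X y) = algebraMap ℝ _ (X i y) := by
  simp [vecL, rightPartial_var_mul_var, Algebra.algebraMap_eq_smul_one]
@[simp] lemma rightPartial_p_vecL : rightPartial (.p i) (vecL r X y) =
    ∑ j, fderiv ℝ (X i) y (basisVec j) • var r (.v j) := by
  simp [vecL, rightPartial_var_mul_var, Finset.sum_add_distrib]
@[simp] lemma rightPartial_v_vecL : rightPartial (.v i) (vecL r X y) =
    ((-1 : ℝ) ^ ((r : ℤ) - 1)) • ∑ j, fderiv ℝ (X j) y (basisVec i) • var r (.p j) := by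
  simp [vecL, rightPartial_var_mul_var, Finset.sum_add_distrib, Gen.deg, Finset.smul_sum,
    smul_comm ((-1 : ℝ) ^ ((r : ℤ) - 1))]

end partials

/-- Coordinates of the Lie bracket `[Y, X]` in `ℝⁿ`. -/
noncomputable def coordLie (Y X : Fin n → Euc n → ℝ) (k : Fin n) (y : Euc n) : ℝ :=
  ∑ i, (Y i y * fderiv ℝ (X k) y (basisVec i) - X i y * fderiv ℝ (Y k) y (basisVec i))

variable {X Y : Fin n → Euc n → ℝ} {y : Euc n}

lemma poisson_vecP_vecP : poisson (vecP r X) (vecP r Y) y = 0 := by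
  simp [poisson]

lemma poisson_vecP_covV : poisson (vecP r X) (covV r Y) y = algebraMap ℝ _ (∑ i, X i y * Y i y) := by
  simp [poisson]

lemma poisson_covV_covV : poisson (covV r X) (covV r Y) y = 0 := by
  simp [poisson]

/-- The two derivatives of `𝒮` that contribute are `𝒮∂_P = v`, which differentiates the coefficients
`Xⁱ`, and `𝒮∂_v = ± P`, which replaces `pᵢ` by `Pᵢ`. Since `vecL` is thus a bracket with `𝒮`, its
properties can be deduced from the Jacobi identity. -/
lemma poisson_S_vecP (hX : ∀ i, DifferentiableAt ℝ (X i) y) :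
    poisson (fun _ ↦ polyS n r) (vecP r X) y = vecL r X y := by
  simp only [poisson, rightPartial_P_polyS, partialX_vecP hX, partialX_const, zero_mul, sub_zero,
    rightPartial_p_polyS, add_zero, rightPartial_v_polyS, leftPartial_p_vecP, smul_mul_assoc,
    smul_smul, ← mul_pow]
  simp only [neg_mul_neg, mul_one, one_pow, one_smul, vecL, Finset.sum_add_distrib, Finset.mul_sum,
    mul_smul_comm, Algebra.algebraMap_eq_smul_one]
  rw [add_comm, Finset.sum_comm]

lemma poisson_S_covV (hX : ∀ i, DifferentiableAt ℝ (X i) y) :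
    poisson (fun _ ↦ polyS n r) (covV r X) y =
      ∑ i, ∑ j, fderiv ℝ (X j) y (basisVec i) • (var r (.v i) * var r (.v j)) := by
  simp [poisson, partialX_covV hX, Finset.mul_sum]

lemma poisson_S_S : poisson (fun _ ↦ polyS n r) (fun _ ↦ polyS n r) y = 0 := by
  simp [poisson]

lemma poisson_vecL_smul_one {f : Euc n → ℝ} (hf : DifferentiableAt ℝ f y) :
    poisson (vecL r Y) (fun y ↦ f y • 1) y =
      (∑ i, Y i y * fderiv ℝ f y (basisVec i)) • (1 : FibreAlg n r) := by
  simp [poisson, partialX_smul hf, Finset.sum_smul, Algebra.algebraMap_eq_smul_one, smul_smul, mul_comm]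

lemma poisson_vecL_vecP (hX : ∀ i, DifferentiableAt ℝ (X i) y) :
    poisson (vecL r Y) (vecP r X) y = vecP r (coordLie Y X) y := by
  -- The sign of the bracket and the sign of moving `∂_v` past `pᵢ` multiply to `-1`; this is the
  -- minus sign in the Lie bracket of vector fields.
  have hs : (-1 : ℝ) ^ r * (-1) ^ ((r : ℤ) - 1) = -1 := by
    rw [← zpow_natCast, neg_one_zpow_mul, neg_one_zpow_congr (b := 1) (by grind), zpow_one]
  simp only [poisson, rightPartial_P_vecL, partialX_vecP hX, leftPartial_P_vecP, mul_zero, sub_zero,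
    leftPartial_v_vecP, add_zero, rightPartial_v_vecL, leftPartial_p_vecP, smul_mul_assoc,
    smul_smul, hs]
  simp only [vecP, coordLie, Algebra.algebraMap_eq_smul_one, smul_mul_assoc, one_mul,
    Finset.smul_sum, smul_smul, mul_smul_comm, mul_one, ← Finset.sum_add_distrib, ← add_smul,
    Finset.sum_smul]
  rw [Finset.sum_comm]
  refine Finset.sum_congr rfl fun i _ ↦ Finset.sum_congr rfl fun j _ ↦ ?_
  congr 1
  ring

end HigherCourant

/-! ### Pointwise bracket identities on an open set -/

namespace HigherCourant

variable {n r : ℕ}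

/-- `F` is a local function of degree `m` over `U`. -/
def HomOn (U : Set (Euc n)) (m : ℤ) (F : Euc n → FibreAlg n r) : Prop :=
  IsSmoothOn F U ∧ ∀ y ∈ U, F y ∈ degree n r m

lemma indicator_mem_locFun {U : Set (Euc n)} (hU : IsOpen U) {m : ℤ} {F : Euc n → FibreAlg n r}
    (hF : HomOn U m F) : U.indicator F ∈ locFun n r U m :=
  ⟨hF.1.congr hU fun y hy ↦ Set.indicator_of_mem hy F,
    fun y hy ↦ by rw [Set.indicator_of_mem hy]; exact hF.2 y hy,
    fun y hy ↦ Set.indicator_of_notMem hy F⟩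

lemma indicator_eventuallyEq {U : Set (Euc n)} (hU : IsOpen U) (F : Euc n → FibreAlg n r)
    {y : Euc n} (hy : y ∈ U) : U.indicator F =ᶠ[𝓝 y] F := by
  filter_upwards [hU.mem_nhds hy] with z hz using Set.indicator_of_mem hz F

section
open Coord
variable {U : Set (Euc n)} {i j k : ℤ} {F G H : Euc n → FibreAlg n r} {y : Euc n}

/-- The bracket at `y` depends only on the germs of its arguments, so cutting off to `U` changes
nothing there. This carries the identities of the abstract system over to functions that need not
vanish outside `U`. -/
lemma bracket_indicator (hU : IsOpen U) (hy : y ∈ U) :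
    DarbouxData.bracket (left U) (right U) conj (sign r) (U.indicator F) (U.indicator G) y =
      poisson F G y := by
  rw [bracket_eq_poisson _ _ hy]
  exact poisson_congr (indicator_eventuallyEq hU F hy) (indicator_eventuallyEq hU G hy)

lemma bracket_indicator_eventuallyEq (hU : IsOpen U) (hy : y ∈ U) :
    DarbouxData.bracket (left U) (right U) conj (sign r) (U.indicator F) (U.indicator G) =ᶠ[𝓝 y]
      poisson F G := by
  filter_upwards [hU.mem_nhds hy] with z hz using bracket_indicator hU hz

lemma HomOn.poisson (hU : IsOpen U) (hF : HomOn U i F) (hG : HomOn U j G) :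
    HomOn U (i + j - r) (poisson F G) := by
  obtain ⟨h1, h2, h3⟩ := (darbouxData_locFun hU).bracket_mem i j _ (indicator_mem_locFun hU hF) _
    (indicator_mem_locFun hU hG)
  exact ⟨h1.congr hU fun y hy ↦ (bracket_indicator hU hy).symm,
    fun y hy ↦ by rw [← bracket_indicator hU hy]; exact h2 y hy⟩

lemma poisson_skew (hU : IsOpen U) (hF : HomOn U i F) (hG : HomOn U j G) (hy : y ∈ U) :
    HigherCourant.poisson F G y =
      -(((-1 : ℝ) ^ ((i - r) * (j - r))) • HigherCourant.poisson G F y) := by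
  have := congrFun ((darbouxData_locFun hU).bracket_skew i j _ (indicator_mem_locFun hU hF) _
    (indicator_mem_locFun hU hG)) y
  rwa [Pi.neg_apply, Pi.smul_apply, bracket_indicator hU hy, bracket_indicator hU hy] at this

lemma poisson_mul_right (hU : IsOpen U) (hF : HomOn U i F) (hG : HomOn U j G) (hH : HomOn U k H)
    (hy : y ∈ U) : HigherCourant.poisson F (fun y ↦ G y * H y) y =
      HigherCourant.poisson F G y * H y +
        ((-1 : ℝ) ^ ((i - r) * j)) • (G y * HigherCourant.poisson F H y) := by
  have := congrFun ((darbouxData_locFun hU).bracket_mul_right i j k _ (indicator_mem_locFun hU hF) _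
    (indicator_mem_locFun hU hG) _ (indicator_mem_locFun hU hH)) y
  rw [show U.indicator G * U.indicator H = U.indicator fun y ↦ G y * H y from
    (Set.indicator_mul U G H).symm] at this
  rwa [Pi.add_apply, Pi.smul_apply, Pi.mul_apply, Pi.mul_apply, bracket_indicator hU hy,
    bracket_indicator hU hy, bracket_indicator hU hy, Set.indicator_of_mem hy,
    Set.indicator_of_mem hy] at this

lemma poisson_jacobi (hU : IsOpen U) (hF : HomOn U i F) (hG : HomOn U j G) (hH : HomOn U k H)
    (hy : y ∈ U) : HigherCourant.poisson F (HigherCourant.poisson G H) y =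
      HigherCourant.poisson (HigherCourant.poisson F G) H y +
        ((-1 : ℝ) ^ ((i - r) * (j - r))) •
          HigherCourant.poisson G (HigherCourant.poisson F H) y := by
  have := congrFun ((darbouxData_locFun hU).bracket_jacobi i j k _ (indicator_mem_locFun hU hF) _
    (indicator_mem_locFun hU hG) _ (indicator_mem_locFun hU hH)) y
  rw [Pi.add_apply, Pi.smul_apply, bracket_eq_poisson _ _ hy, bracket_eq_poisson _ _ hy,
    bracket_eq_poisson _ _ hy] at this
  have hF' := indicator_eventuallyEq hU F hy
  have hG' := indicator_eventuallyEq hU G hy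
  have hH' := indicator_eventuallyEq hU H hy
  rwa [poisson_congr hF' (bracket_indicator_eventuallyEq hU hy),
    poisson_congr hG' (bracket_indicator_eventuallyEq hU hy),
    poisson_congr (bracket_indicator_eventuallyEq hU hy) hH'] at this

lemma HomOn.mul (hF : HomOn U i F) (hG : HomOn U j G) : HomOn U (i + j) (fun y ↦ F y * G y) :=
  ⟨hF.1.mul hG.1, fun y hy ↦ mul_mem_degree (hF.2 y hy) (hG.2 y hy)⟩

lemma poisson_sum_right {N : Type*} (s : Finset N) {G : N → Euc n → FibreAlg n r}
    (hG : ∀ k ∈ s, IsSmoothOn (G k) U) (hy : y ∈ U) :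
    HigherCourant.poisson F (fun y ↦ ∑ k ∈ s, G k y) y =
      ∑ k ∈ s, HigherCourant.poisson F (G k) y := by
  have : ∀ i, partialX (fun y ↦ ∑ k ∈ s, G k y) i y = ∑ k ∈ s, partialX (G k) i y := fun i ↦
    (hasPartialX_sum s fun k hk ↦ (hG k hk).hasPartialX hy i).partialX_eq
  simp only [HigherCourant.poisson, this, map_sum, Finset.mul_sum, Finset.smul_sum,
    ← Finset.sum_sub_distrib, ← Finset.sum_add_distrib]
  rw [Finset.sum_comm]

lemma poisson_sum_left {N : Type*} (s : Finset N) {F : N → Euc n → FibreAlg n r}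
    (hF : ∀ k ∈ s, IsSmoothOn (F k) U) (hy : y ∈ U) :
    HigherCourant.poisson (fun y ↦ ∑ k ∈ s, F k y) G y =
      ∑ k ∈ s, HigherCourant.poisson (F k) G y := by
  have : ∀ i, partialX (fun y ↦ ∑ k ∈ s, F k y) i y = ∑ k ∈ s, partialX (F k) i y := fun i ↦
    (hasPartialX_sum s fun k hk ↦ (hF k hk).hasPartialX hy i).partialX_eq
  simp only [HigherCourant.poisson, this, map_sum, Finset.sum_mul, Finset.smul_sum,
    ← Finset.sum_sub_distrib, ← Finset.sum_add_distrib]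
  rw [Finset.sum_comm]

end

/-- A local function is locally a finite combination of monomials with smooth coefficients. -/
lemma IsSmoothOn.exists_sum_mon {F : Euc n → FibreAlg n r} {U : Set (Euc n)}
    (hF : IsSmoothOn F U) {y : Euc n} (hy : y ∈ U) :
    ∃ O : Set (Euc n), IsOpen O ∧ y ∈ O ∧ ∃ (N : Type) (_ : Fintype N) (f : N → Euc n → ℝ)
      (l : N → List (Gen n)), (∀ s, ContDiffOn ℝ ∞ (f s) O) ∧
      ∀ y' ∈ O, F y' = ∑ s, f s y' • mon r (l s) := by
  obtain ⟨O, hO, hyO, N, _, f, m, hf, hF⟩ := hF y hy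
  have hm : ∀ s, ∃ c : List (Gen n) →₀ ℝ, c.sum (fun l a ↦ a • mon r l) = m s := fun s ↦ by
    rw [← Finsupp.mem_span_range_iff_exists_finsupp, span_mon]
    trivial
  choose c hc using hm
  refine ⟨O, hO, hyO, (s : N) × (c s).support, inferInstance, fun s y ↦ f s.1 y * c s.1 s.2,
    fun s ↦ s.2, fun s ↦ (hf s.1).mul contDiffOn_const, fun y' hy' ↦ ?_⟩
  rw [hF y' hy', Fintype.sum_sigma]
  refine Finset.sum_congr rfl fun s _ ↦ ?_
  rw [← hc s, Finsupp.sum, Finset.smul_sum, ← Finset.sum_coe_sort]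
  simp only [smul_smul]

/-! ### Changes of coordinates -/

/-- Mutually inverse smooth maps between open sets. -/
structure CoordChange (φ ψ : Euc n → Euc n) (U U' : Set (Euc n)) : Prop where
  isOpen : IsOpen U
  isOpen' : IsOpen U'
  maps : ∀ y ∈ U, φ y ∈ U'
  maps' : ∀ y ∈ U', ψ y ∈ U
  left_inv : ∀ y ∈ U, ψ (φ y) = y
  right_inv : ∀ y ∈ U', φ (ψ y) = y
  smooth : ContDiffOn ℝ ∞ φ U
  smooth' : ContDiffOn ℝ ∞ ψ U'

/-- The entries of the Jacobian matrix. -/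
noncomputable def jacobian (φ : Euc n → Euc n) (i j : Fin n) (y : Euc n) : ℝ :=
  (fderiv ℝ φ y (basisVec j) : Euc n) i

/-- The change of fibre coordinates over `y`. -/
noncomputable def fibreChange (r : ℕ) (φ ψ : Euc n → Euc n) (y : Euc n) :
    FibreAlg n r →ₐ[ℝ] FibreAlg n r :=
  subst (fun i j ↦ jacobian φ i j y) (fun i j ↦ jacobian ψ i j (φ y))
    (fun i j k ↦ fderiv ℝ (jacobian φ i j) y (basisVec k))

lemma clm_apply_eq_sum {E : Type*} [NormedAddCommGroup E] [NormedSpace ℝ E] (L : Euc n →L[ℝ] E)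
    (v : Euc n) : L v = ∑ i, v i • L (basisVec i) := by
  conv_lhs => rw [← (EuclideanSpace.basisFun (Fin n) ℝ).sum_repr v]
  simp [map_sum]

lemma jacobian_eq_fderiv {φ : Euc n → Euc n} {y : Euc n} (h : DifferentiableAt ℝ φ y)
    (i j : Fin n) : jacobian φ i j y = fderiv ℝ (fun z ↦ φ z i) y (basisVec j) := by
  have : HasFDerivAt (fun z ↦ φ z i) ((EuclideanSpace.proj i : Euc n →L[ℝ] ℝ).comp (fderiv ℝ φ y)) y :=
    (EuclideanSpace.proj i : Euc n →L[ℝ] ℝ).hasFDerivAt.comp y h.hasFDerivAt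
  rw [this.fderiv]
  rfl

lemma contDiffOn_jacobian {φ : Euc n → Euc n} {U : Set (Euc n)} (hU : IsOpen U)
    (h : ContDiffOn ℝ ∞ φ U) (i j : Fin n) : ContDiffOn ℝ ∞ (jacobian φ i j) U :=
  (EuclideanSpace.proj i : Euc n →L[ℝ] ℝ).contDiff.comp_contDiffOn
    ((h.fderiv_of_isOpen hU (by simp)).clm_apply contDiffOn_const)

lemma jacobian_symm {φ : Euc n → Euc n} {U : Set (Euc n)} (hU : IsOpen U)
    (h : ContDiffOn ℝ ∞ φ U) {y : Euc n} (hy : y ∈ U) (i j k : Fin n) :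
    fderiv ℝ (jacobian φ i j) y (basisVec k) = fderiv ℝ (jacobian φ i k) y (basisVec j) := by
  have hφ : ContDiffAt ℝ ∞ φ y := h.contDiffAt (hU.mem_nhds hy)
  have hd : DifferentiableAt ℝ (fderiv ℝ φ) y :=
    (hφ.fderiv_right (m := ∞) (by simp)).differentiableAt (by simp)
  have hsym : IsSymmSndFDerivAt ℝ φ y := hφ.isSymmSndFDerivAt (by simp [two_le_infty])
  have : ∀ j k, fderiv ℝ (jacobian φ i j) y (basisVec k) =
      (fderiv ℝ (fderiv ℝ φ) y (basisVec k) (basisVec j) : Euc n) i := fun j k ↦ by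
    have h1 : HasFDerivAt (fun z ↦ fderiv ℝ φ z (basisVec j))
        ((ContinuousLinearMap.apply ℝ (Euc n) (basisVec j)).comp (fderiv ℝ (fderiv ℝ φ) y)) y :=
      (ContinuousLinearMap.apply ℝ (Euc n) (basisVec j)).hasFDerivAt.comp y hd.hasFDerivAt
    have h2 : HasFDerivAt (jacobian φ i j) ((EuclideanSpace.proj i : Euc n →L[ℝ] ℝ).comp
        ((ContinuousLinearMap.apply ℝ (Euc n) (basisVec j)).comp (fderiv ℝ (fderiv ℝ φ) y))) y :=
      (EuclideanSpace.proj i : Euc n →L[ℝ] ℝ).hasFDerivAt.comp y h1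
    rw [h2.fderiv]
    rfl
  rw [this, this, hsym]

lemma fderiv_comp_basisVec {g : Euc n → ℝ} {ψ : Euc n → Euc n} {y : Euc n}
    (hg : DifferentiableAt ℝ g (ψ y)) (hψ : DifferentiableAt ℝ ψ y) (l : Fin n) :
    fderiv ℝ (fun z ↦ g (ψ z)) y (basisVec l) =
      ∑ k, fderiv ℝ g (ψ y) (basisVec k) * jacobian ψ k l y := by
  rw [fderiv_fun_comp y hg hψ, ContinuousLinearMap.comp_apply, clm_apply_eq_sum]
  exact Finset.sum_congr rfl fun k _ ↦ mul_comm _ _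

namespace CoordChange

variable {φ ψ : Euc n → Euc n} {U U' : Set (Euc n)}

lemma symm (h : CoordChange φ ψ U U') : CoordChange ψ φ U' U :=
  ⟨h.isOpen', h.isOpen, h.maps', h.maps, h.right_inv, h.left_inv, h.smooth', h.smooth⟩

lemma restrict (h : CoordChange φ ψ U U') {O : Set (Euc n)} (hO : IsOpen O) :
    CoordChange φ ψ (U ∩ O) (U' ∩ ψ ⁻¹' O) where
  isOpen := h.isOpen.inter hO
  isOpen' := h.smooth'.continuousOn.isOpen_inter_preimage h.isOpen' hO
  maps y hy := ⟨h.maps y hy.1, by rw [Set.mem_preimage, h.left_inv y hy.1]; exact hy.2⟩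
  maps' y hy := ⟨h.maps' y hy.1, hy.2⟩
  left_inv y hy := h.left_inv y hy.1
  right_inv y hy := h.right_inv y hy.1
  smooth := h.smooth.mono Set.inter_subset_left
  smooth' := h.smooth'.mono Set.inter_subset_left

lemma differentiableAt (h : CoordChange φ ψ U U') {y : Euc n} (hy : y ∈ U) :
    DifferentiableAt ℝ φ y :=
  (h.smooth.contDiffAt (h.isOpen.mem_nhds hy)).differentiableAt (by simp)

lemma differentiableAt' (h : CoordChange φ ψ U U') {y : Euc n} (hy : y ∈ U') :
    DifferentiableAt ℝ ψ y := h.symm.differentiableAt hy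

lemma differentiableAt_jacobian (h : CoordChange φ ψ U U') {y : Euc n} (hy : y ∈ U) (i j : Fin n) :
    DifferentiableAt ℝ (jacobian φ i j) y :=
  ((contDiffOn_jacobian h.isOpen h.smooth i j).contDiffAt
    (h.isOpen.mem_nhds hy)).differentiableAt (by simp)

lemma jacobian_mul_jacobian (h : CoordChange φ ψ U U') {y : Euc n} (hy : y ∈ U') (i k : Fin n) :
    ∑ j, jacobian φ i j (ψ y) * jacobian ψ j k y = if i = k then 1 else 0 := by
  have h1 := h.differentiableAt (h.maps' y hy)
  have hi : DifferentiableAt ℝ (fun z ↦ φ z i) (ψ y) :=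
    (EuclideanSpace.proj i : Euc n →L[ℝ] ℝ).differentiableAt.comp _ h1
  have h2 := fderiv_comp_basisVec hi (h.differentiableAt' hy) k
  simp only [← jacobian_eq_fderiv h1] at h2
  rw [← h2]
  have h3 : (fun z ↦ φ (ψ z) i) =ᶠ[𝓝 y] fun z ↦ (EuclideanSpace.proj i : Euc n →L[ℝ] ℝ) z := by
    filter_upwards [h.isOpen'.mem_nhds hy] with z hz
    rw [h.right_inv z hz]; rfl
  rw [h3.fderiv_eq, ContinuousLinearMap.fderiv]
  simp

/-- The `j`-th coordinate vector field of the source in the coordinates of the target. -/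
noncomputable def coordVec (φ ψ : Euc n → Euc n) (j i : Fin n) (y : Euc n) : ℝ :=
  jacobian φ i j (ψ y)

lemma differentiableAt_coordVec (h : CoordChange φ ψ U U') {y : Euc n} (hy : y ∈ U') (i j : Fin n) :
    DifferentiableAt ℝ (coordVec φ ψ j i) y :=
  (h.differentiableAt_jacobian (h.maps' y hy) i j).comp y (h.differentiableAt' hy)

lemma fibreChange_v (h : CoordChange φ ψ U U') {y : Euc n} (hy : y ∈ U') (j : Fin n) :
    fibreChange r φ ψ (ψ y) (var r (.v j)) = covV r (jacobian ψ j) y := by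
  simp [fibreChange, subst, substGen, covV, h.right_inv y hy]

lemma fibreChange_p (j : Fin n) (y : Euc n) :
    fibreChange r φ ψ (ψ y) (var r (.p j)) = vecP r (coordVec φ ψ j) y := by
  simp [fibreChange, subst, substGen, vecP, coordVec]

/-- The second-derivative term in the transformation law of `Pⱼ` becomes, by the chain rule, the
derivative of the components of `∂ⱼ` in the target coordinates. So just as `pⱼ` turns into `i_X` for
`X = ∂ⱼ`, `Pⱼ` turns into `{𝒮, i_X}`. -/
lemma fibreChange_P (h : CoordChange φ ψ U U') {y : Euc n} (hy : y ∈ U') (j : Fin n) :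
    fibreChange r φ ψ (ψ y) (var r (.P j)) = vecL r (coordVec φ ψ j) y := by
  have : ∀ i l, fderiv ℝ (coordVec φ ψ j i) y (basisVec l) =
      ∑ k, fderiv ℝ (jacobian φ i j) (ψ y) (basisVec k) * jacobian ψ k l y := fun i l ↦
    fderiv_comp_basisVec (h.differentiableAt_jacobian (h.maps' y hy) i j)
      (h.differentiableAt' hy) l
  simp only [fibreChange, subst, lift_var, substGen, vecL, this, h.right_inv y hy,
    Finset.sum_add_distrib]
  congr 1
  refine Finset.sum_congr rfl fun i _ ↦ ?_
  simp only [Finset.sum_mul, Finset.smul_sum, smul_mul_assoc, smul_smul, Finset.sum_smul]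
  rw [Finset.sum_comm]

end CoordChange

end HigherCourant

/-! ### Independence of the Poisson bracket from the coordinates -/

namespace HigherCourant

variable {n r : ℕ}

lemma eq_zero_of_eq_neg {V : Type*} [AddCommGroup V] [Module ℝ V] {x : V} (h : x = -x) : x = 0 := by
  have h2 : (2 : ℝ) • x = 0 := by rw [two_smul]; nth_rewrite 2 [h]; exact add_neg_cancel x
  exact (smul_eq_zero.1 h2).resolve_left two_ne_zero

lemma HomOn.congr {U : Set (Euc n)} (hU : IsOpen U) {m : ℤ} {F G : Euc n → FibreAlg n r}
    (hF : HomOn U m F) (h : ∀ y ∈ U, G y = F y) : HomOn U m G :=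
  ⟨hF.1.congr hU h, fun y hy ↦ by rw [h y hy]; exact hF.2 y hy⟩

lemma homOn_const (U : Set (Euc n)) {m : ℤ} {x : FibreAlg n r} (hx : x ∈ degree n r m) :
    HomOn U m fun _ ↦ x := ⟨isSmoothOn_const U x, fun _ _ ↦ hx⟩

lemma homOn_smul {U : Set (Euc n)} (hU : IsOpen U) {f : Euc n → ℝ} (hf : ContDiffOn ℝ ∞ f U)
    {m : ℤ} {x : FibreAlg n r} (hx : x ∈ degree n r m) : HomOn U m fun y ↦ f y • x :=
  ⟨isSmoothOn_smul hU hf x, fun _ _ ↦ Submodule.smul_mem _ _ hx⟩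

lemma HomOn.sum {U : Set (Euc n)} {m : ℤ} {N : Type*} (s : Finset N)
    {F : N → Euc n → FibreAlg n r} (h : ∀ k ∈ s, HomOn U m (F k)) :
    HomOn U m fun y ↦ ∑ k ∈ s, F k y :=
  ⟨IsSmoothOn.sum s fun k hk ↦ (h k hk).1, fun y hy ↦ sum_mem fun k hk ↦ (h k hk).2 y hy⟩

lemma polyS_mem_degree : polyS n r ∈ degree n r (r + 1) :=
  sum_mem fun i _ ↦ by
    have := mul_mem_degree (var_mem_degree (r := r) (.v i)) (var_mem_degree (.P i))
    simpa only [Gen.deg, add_comm] using this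

lemma homOn_vecP {U : Set (Euc n)} (hU : IsOpen U) {X : Fin n → Euc n → ℝ}
    (hX : ∀ i, ContDiffOn ℝ ∞ (X i) U) : HomOn U (r - 1) (vecP r X) :=
  HomOn.sum _ fun i _ ↦ homOn_smul hU (hX i) (var_mem_degree (.p i))

lemma homOn_covV {U : Set (Euc n)} (hU : IsOpen U) {X : Fin n → Euc n → ℝ}
    (hX : ∀ i, ContDiffOn ℝ ∞ (X i) U) : HomOn U 1 (covV r X) :=
  HomOn.sum _ fun i _ ↦ homOn_smul hU (hX i) (var_mem_degree (.v i))

lemma homOn_polyS (U : Set (Euc n)) : HomOn U (r + 1) fun _ ↦ polyS n r :=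
  homOn_const U polyS_mem_degree

lemma poisson_S_vecP_eventuallyEq {U : Set (Euc n)} (hU : IsOpen U) {X : Fin n → Euc n → ℝ}
    (hX : ∀ i, ∀ y ∈ U, DifferentiableAt ℝ (X i) y) {y : Euc n} (hy : y ∈ U) :
    poisson (fun _ ↦ polyS n r) (vecP r X) =ᶠ[𝓝 y] vecL r X := by
  filter_upwards [hU.mem_nhds hy] with z hz using poisson_S_vecP fun i ↦ hX i z hz

lemma homOn_vecL {U : Set (Euc n)} (hU : IsOpen U) {X : Fin n → Euc n → ℝ}
    (hX : ∀ i, ContDiffOn ℝ ∞ (X i) U) : HomOn U r (vecL r X) := by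
  have h := (homOn_polyS (r := r) U).poisson hU (homOn_vecP hU hX)
  rw [show (r : ℤ) + 1 + (r - 1) - r = r by ring] at h
  exact h.congr hU fun y hy ↦ (poisson_S_vecP fun i ↦
    ((hX i).contDiffAt (hU.mem_nhds hy)).differentiableAt (by simp)).symm

lemma poisson_zero_right {F G : Euc n → FibreAlg n r} {y : Euc n} (hG : G =ᶠ[𝓝 y] fun _ ↦ 0) :
    poisson F G y = 0 := by
  rw [poisson_congr (Filter.EventuallyEq.refl _ F) hG]
  simp [poisson]

lemma poisson_zero_left {F G : Euc n → FibreAlg n r} {y : Euc n} (hF : F =ᶠ[𝓝 y] fun _ ↦ 0) :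
    poisson F G y = 0 := by
  rw [poisson_congr hF (Filter.EventuallyEq.refl _ G)]
  simp [poisson]

/-- After the shift by `r`, `𝒮` has degree `1`, so Jacobi and `{𝒮, 𝒮} = 0` show that the left side
equals its own negative. -/
lemma poisson_S_poisson_S {U : Set (Euc n)} (hU : IsOpen U) {m : ℤ} {F : Euc n → FibreAlg n r}
    (hF : HomOn U m F) {y : Euc n} (hy : y ∈ U) :
    poisson (fun _ ↦ polyS n r) (poisson (fun _ ↦ polyS n r) F) y = 0 := by
  have h := poisson_jacobi hU (homOn_polyS (r := r) U) (homOn_polyS (r := r) U) hF hy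
  rw [poisson_zero_left (F := poisson _ _) (Filter.Eventually.of_forall fun z ↦ poisson_S_S),
    zero_add, show ((r : ℤ) + 1 - r) * (r + 1 - r) = 1 by ring, zpow_one, neg_smul', one_smul] at h
  exact eq_zero_of_eq_neg h

lemma poisson_smul_one {F : Euc n → FibreAlg n r} {f : Euc n → ℝ} {y : Euc n}
    (hf : DifferentiableAt ℝ f y) : poisson F (fun y ↦ f y • 1) y =
      ∑ i, fderiv ℝ f y (basisVec i) • rightPartial (.P i) (F y) := by
  simp [poisson, partialX_smul hf]

/-- Symmetric coefficients are paired with anticommuting elements. This is how the second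
derivatives of a coordinate change disappear. -/
lemma sum_symm_smul_v_mul_v {H : Fin n → Fin n → ℝ} (hH : ∀ i j, H i j = H j i)
    {V : Fin n → FibreAlg n r} (hV : ∀ i, V i ∈ degree n r 1) :
    ∑ i, ∑ j, H i j • (V i * V j) = 0 := by
  have h : ∑ i, ∑ j, H i j • (V i * V j) = -∑ i, ∑ j, H i j • (V i * V j) := by
    conv_lhs => rw [Finset.sum_comm]
    simp only [← Finset.sum_neg_distrib]
    refine Finset.sum_congr rfl fun i _ ↦ Finset.sum_congr rfl fun j _ ↦ ?_
    rw [mul_comm_degree (hV j) (hV i), hH, mul_one, zpow_one, neg_smul', one_smul, smul_neg]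
  exact eq_zero_of_eq_neg h

namespace CoordChange

variable {φ ψ : Euc n → Euc n} {U U' : Set (Euc n)}

/-- A local function in the coordinates of the target. -/
noncomputable def push (φ ψ : Euc n → Euc n) (F : Euc n → FibreAlg n r) (y : Euc n) :
    FibreAlg n r := fibreChange r φ ψ (ψ y) (F (ψ y))

lemma contDiffOn_coordVec (h : CoordChange φ ψ U U') (j i : Fin n) :
    ContDiffOn ℝ ∞ (coordVec φ ψ j i) U' :=
  (contDiffOn_jacobian h.isOpen h.smooth i j).comp h.smooth' h.maps'

lemma contDiffOn_jacobian' (h : CoordChange φ ψ U U') (j i : Fin n) :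
    ContDiffOn ℝ ∞ (jacobian ψ j i) U' := contDiffOn_jacobian h.isOpen' h.smooth' j i

lemma homOn_push_var (h : CoordChange φ ψ U U') (a : Gen n) :
    HomOn U' (a.deg r) (push φ ψ fun _ ↦ var r a) := by
  rcases a with j | j | j
  · exact (homOn_covV h.isOpen' fun i ↦ h.contDiffOn_jacobian' j i).congr h.isOpen'
      (G := push φ ψ fun _ ↦ var r (.v j)) fun y hy ↦ h.fibreChange_v hy j
  · exact (homOn_vecP h.isOpen' fun i ↦ h.contDiffOn_coordVec j i).congr h.isOpen'
      (G := push φ ψ fun _ ↦ var r (.p j)) fun y _ ↦ fibreChange_p j y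
  · exact (homOn_vecL h.isOpen' fun i ↦ h.contDiffOn_coordVec j i).congr h.isOpen'
      (G := push φ ψ fun _ ↦ var r (.P j)) fun y hy ↦ h.fibreChange_P hy j

lemma homOn_push_mon (h : CoordChange φ ψ U U') (l : List (Gen n)) :
    HomOn U' (monDeg r l) (push φ ψ fun _ ↦ mon r l) := by
  induction l with
  | nil =>
    have : (push φ ψ fun _ ↦ mon r ([] : List (Gen n))) = fun _ ↦ 1 := by ext1 y; simp [push]
    rw [this]
    exact homOn_const U' one_mem_degree
  | cons a l ih =>
    rw [monDeg_cons]
    refine ((h.homOn_push_var a).mul ih).congr h.isOpen' fun y _ ↦ ?_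
    simp [push]

lemma isSmoothOn_push_mem (h : CoordChange φ ψ U U') {F : Euc n → FibreAlg n r}
    (hF : IsSmoothOn F U) : IsSmoothOn (push φ ψ F) U' := by
  intro y hy
  obtain ⟨O, hO, hyO, N, _, f, l, hf, hF⟩ := hF.exists_sum_mon (h.maps' y hy)
  have h' := h.restrict hO
  refine IsSmoothOn.congr (F := fun y ↦ ∑ s, f s (ψ y) • push φ ψ (fun _ ↦ mon r (l s)) y)
    (U := U' ∩ ψ ⁻¹' O) (IsSmoothOn.sum _ fun s _ ↦ ?_) h'.isOpen' (fun z hz ↦ ?_) y ⟨hy, hyO⟩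
  · have h1 : IsSmoothOn (fun y ↦ f s (ψ y) • (1 : FibreAlg n r)) (U' ∩ ψ ⁻¹' O) :=
      isSmoothOn_smul h'.isOpen' ((hf s).comp h'.smooth' fun z hz ↦ hz.2) 1
    simpa using h1.mul (h'.homOn_push_mon (l s)).1
  · simp [push, hF _ hz.2]

lemma homOn_push (h : CoordChange φ ψ U U') {m : ℤ} {F : Euc n → FibreAlg n r}
    (hF : HomOn U m F) : HomOn U' m (push φ ψ F) :=
  ⟨h.isSmoothOn_push_mem hF.1, fun y hy ↦ algHom_mem_degree _
    (fun a ↦ (h.homOn_push_var a).2 y hy) (hF.2 _ (h.maps' y hy))⟩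

/-- The first-order part cancels because the two Jacobians are mutually inverse. The inhomogeneous
part of `Pⱼ`, multiplied by `vʲ`, contracts a symmetric second derivative with two odd variables and
vanishes. -/
lemma fibreChange_polyS (h : CoordChange φ ψ U U') {y : Euc n} (hy : y ∈ U') :
    fibreChange r φ ψ (ψ y) (polyS n r) = polyS n r := by
  set V : Fin n → FibreAlg n r := fun k ↦ ∑ l, jacobian ψ k l y • var r (.v l) with hV
  have hVdeg : ∀ k, V k ∈ degree n r 1 := fun k ↦
    sum_mem fun l _ ↦ Submodule.smul_mem _ _ (var_mem_degree (.v l))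
  have h1 : ∀ i, ∑ j, jacobian φ i j (ψ y) • V j = var r (.v i) := fun i ↦ by
    simp only [hV, Finset.smul_sum, smul_smul]
    rw [Finset.sum_comm]
    simp only [← Finset.sum_smul, h.jacobian_mul_jacobian hy]
    simp
  have h2 : ∀ i, ∑ j, ∑ k, fderiv ℝ (jacobian φ i j) (ψ y) (basisVec k) • (V j * V k) = 0 :=
    fun i ↦ sum_symm_smul_v_mul_v (fun j k ↦ jacobian_symm h.isOpen h.smooth (h.maps' y hy) i j k)
      hVdeg
  have hv : ∀ j, fibreChange r φ ψ (ψ y) (var r (.v j)) = V j := h.fibreChange_v hy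
  have hP : ∀ j, fibreChange r φ ψ (ψ y) (var r (.P j)) =
      (∑ i, jacobian φ i j (ψ y) • var r (.P i)) +
      ∑ i, ∑ k, fderiv ℝ (jacobian φ i j) (ψ y) (basisVec k) • (V k * var r (.p i)) := fun j ↦ by
    simp only [fibreChange, subst, lift_var, substGen, h.right_inv y hy, hV]
  simp only [polyS, map_sum, map_mul, hv, hP, mul_add, Finset.sum_add_distrib]
  have e1 : ∑ j, V j * ∑ i, jacobian φ i j (ψ y) • var r (.P i) =
      ∑ i, var r (.v i) * var r (.P i) := by
    simp only [Finset.mul_sum, mul_smul_comm]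
    rw [Finset.sum_comm]
    simp only [← h1, Finset.sum_mul, smul_mul_assoc]
  have e2 : ∑ j, V j * ∑ i, ∑ k, fderiv ℝ (jacobian φ i j) (ψ y) (basisVec k) •
      (V k * var r (.p i)) = 0 := by
    simp only [Finset.mul_sum, mul_smul_comm, ← mul_assoc]
    rw [Finset.sum_comm]
    refine Finset.sum_eq_zero fun i _ ↦ ?_
    have := congrArg (· * var r (.p i)) (h2 i)
    simpa only [Finset.sum_mul, smul_mul_assoc, zero_mul] using this
  rw [e1, e2, add_zero]

/-- The old `vʲ` is the differential of a coordinate function, and this is `d² = 0` for it. -/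
lemma poisson_S_push_v (h : CoordChange φ ψ U U') {y : Euc n} (hy : y ∈ U') (j : Fin n) :
    poisson (fun _ ↦ polyS n r) (covV r (jacobian ψ j)) y = 0 := by
  rw [poisson_S_covV fun i ↦ h.symm.differentiableAt_jacobian hy j i]
  exact sum_symm_smul_v_mul_v (fun i k ↦ jacobian_symm h.isOpen' h.smooth' hy j k i)
    fun i ↦ var_mem_degree (.v i)

lemma sum_coordVec_mul_jacobian (h : CoordChange φ ψ U U') {y : Euc n} (hy : y ∈ U')
    (j k : Fin n) : ∑ i, coordVec φ ψ j i y * jacobian ψ k i y = if k = j then 1 else 0 := by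
  have hK := h.symm.jacobian_mul_jacobian (h.maps' y hy) k j
  rw [h.right_inv y hy] at hK
  rw [← hK]
  exact Finset.sum_congr rfl fun i _ ↦ mul_comm _ _

lemma sum_coordVec_mul_fderiv (h : CoordChange φ ψ U U') {g : Euc n → ℝ} {y : Euc n} (hy : y ∈ U')
    (hg : DifferentiableAt ℝ g (ψ y)) (j : Fin n) :
    ∑ i, coordVec φ ψ j i y * fderiv ℝ (fun z ↦ g (ψ z)) y (basisVec i) =
      fderiv ℝ g (ψ y) (basisVec j) := by
  have e : ∀ i, fderiv ℝ (fun z ↦ g (ψ z)) y (basisVec i) =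
      ∑ k, fderiv ℝ g (ψ y) (basisVec k) * jacobian ψ k i y :=
    fun i ↦ fderiv_comp_basisVec hg (h.differentiableAt' hy) i
  simp only [e, Finset.mul_sum]
  rw [Finset.sum_comm]
  simp only [mul_left_comm _ (fderiv ℝ g (ψ y) _), ← Finset.mul_sum,
    h.sum_coordVec_mul_jacobian hy]
  simp

/-- Coordinate vector fields commute: `∂ⱼ` applied to the components of `∂ₖ` gives second
derivatives of the coordinate change, which are symmetric in `j` and `k`. -/
lemma coordLie_coordVec (h : CoordChange φ ψ U U') {y : Euc n} (hy : y ∈ U') (j k i : Fin n) :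
    coordLie (coordVec φ ψ j) (coordVec φ ψ k) i y = 0 := by
  simp only [coordLie, Finset.sum_sub_distrib]
  have := fun j k ↦ h.sum_coordVec_mul_fderiv hy
    (h.differentiableAt_jacobian (h.maps' y hy) i k) j
  rw [sub_eq_zero]
  refine (this j k).trans (Eq.trans ?_ (this k j).symm)
  exact jacobian_symm h.isOpen h.smooth (h.maps' y hy) i k j

/-- Compatibility of the bracket of `F` and `G` with the change of coordinates at `y`. -/
def Compat (φ ψ : Euc n → Euc n) (F G : Euc n → FibreAlg n r) (y : Euc n) : Prop :=
  poisson (push φ ψ F) (push φ ψ G) y = fibreChange r φ ψ (ψ y) (poisson F G (ψ y))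

lemma compat_symm (h : CoordChange φ ψ U U') {y : Euc n} (hy : y ∈ U') {i j : ℤ}
    {F G : Euc n → FibreAlg n r} (hF : HomOn U i F) (hG : HomOn U j G) (hc : Compat φ ψ F G y) :
    Compat φ ψ G F y := by
  unfold Compat at *
  rw [poisson_skew h.isOpen' (h.homOn_push hG) (h.homOn_push hF) hy, hc,
    poisson_skew h.isOpen hG hF (h.maps' y hy), map_neg, map_smul]

/-- Both sides are biderivations and `push` is multiplicative, so invariance passes to products;
together with `compat_symm` this reduces invariance to generators and functions of `x`. -/
lemma compat_mul_right (h : CoordChange φ ψ U U') {y : Euc n} (hy : y ∈ U') {i j k : ℤ}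
    {F G H : Euc n → FibreAlg n r} (hF : HomOn U i F) (hG : HomOn U j G) (hH : HomOn U k H)
    (hc : Compat φ ψ F G y) (hc' : Compat φ ψ F H y) :
    Compat φ ψ F (fun y ↦ G y * H y) y := by
  unfold Compat at *
  rw [poisson_mul_right h.isOpen hF hG hH (h.maps' y hy), map_add, map_smul, map_mul, map_mul,
    ← hc, ← hc']
  have : push φ ψ (fun y ↦ G y * H y) = fun y ↦ push φ ψ G y * push φ ψ H y := by
    ext1 z; simp [push]
  rw [this, poisson_mul_right h.isOpen' (h.homOn_push hF) (h.homOn_push hG) (h.homOn_push hH) hy]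
  rfl

lemma push_v_eventuallyEq (h : CoordChange φ ψ U U') {y : Euc n} (hy : y ∈ U') (j : Fin n) :
    (push φ ψ fun _ ↦ var r (.v j)) =ᶠ[𝓝 y] covV r (jacobian ψ j) := by
  filter_upwards [h.isOpen'.mem_nhds hy] with z hz using h.fibreChange_v hz j

lemma push_P_eventuallyEq (h : CoordChange φ ψ U U') {y : Euc n} (hy : y ∈ U') (j : Fin n) :
    (push φ ψ fun _ ↦ var r (.P j)) =ᶠ[𝓝 y] vecL r (coordVec φ ψ j) := by
  filter_upwards [h.isOpen'.mem_nhds hy] with z hz using h.fibreChange_P hz j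

lemma push_p (j : Fin n) : (push φ ψ fun _ ↦ var r (.p j)) = vecP r (coordVec φ ψ j) :=
  funext fun y ↦ fibreChange_p j y

lemma push_smul_one (f : Euc n → ℝ) :
    (push φ ψ fun y ↦ f y • (1 : FibreAlg n r)) = fun y ↦ f (ψ y) • 1 := by
  ext1 y; simp [push]

lemma poisson_S_vecL (h : CoordChange φ ψ U U') {y : Euc n} (hy : y ∈ U') (j : Fin n) :
    poisson (fun _ ↦ polyS n r) (vecL r (coordVec φ ψ j)) y = 0 := by
  rw [← poisson_congr (Filter.EventuallyEq.refl _ _) (poisson_S_vecP_eventuallyEq h.isOpen'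
    (fun i z hz ↦ h.differentiableAt_coordVec hz i j) hy)]
  exact poisson_S_poisson_S h.isOpen' (homOn_vecP h.isOpen' fun i ↦ h.contDiffOn_coordVec j i) hy

/-- Writing `vecL` as `{𝒮, i_X}`, Jacobi expresses the bracket through `{𝒮, {i_X, G}}` and `{i_X,
{𝒮, G}}`. The second vanishes by `h1`; the first is `{𝒮, c}`, which vanishes since `c` is
independent of `x` and killed by the derivatives in `hc`. -/
lemma poisson_vecL_eq_zero (h : CoordChange φ ψ U U') {y : Euc n} (hy : y ∈ U') (j : Fin n) {m : ℤ}
    {G : Euc n → FibreAlg n r} (hG : HomOn U' m G)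
    (h1 : ∀ z ∈ U', poisson (fun _ ↦ polyS n r) G z = 0) {c : FibreAlg n r}
    (h2 : ∀ z ∈ U', poisson (vecP r (coordVec φ ψ j)) G z = c)
    (hc : ∀ i, leftPartial (.v i) c = 0 ∧ leftPartial (.p i) c = 0) :
    poisson (vecL r (coordVec φ ψ j)) G y = 0 := by
  have hX := homOn_vecP (r := r) h.isOpen' fun i ↦ h.contDiffOn_coordVec j i
  rw [← poisson_congr (poisson_S_vecP_eventuallyEq h.isOpen'
    (fun i z hz ↦ h.differentiableAt_coordVec hz i j) hy) (Filter.EventuallyEq.refl _ _)]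
  have hj := poisson_jacobi h.isOpen' (homOn_polyS (r := r) U') hX hG hy
  have e1 : poisson (fun _ ↦ polyS n r) G =ᶠ[𝓝 y] fun _ ↦ 0 := by
    filter_upwards [h.isOpen'.mem_nhds hy] with z hz using h1 z hz
  have e2 : poisson (vecP r (coordVec φ ψ j)) G =ᶠ[𝓝 y] fun _ ↦ c := by
    filter_upwards [h.isOpen'.mem_nhds hy] with z hz using h2 z hz
  rw [poisson_zero_right e1, smul_zero, add_zero,
    poisson_congr (Filter.EventuallyEq.refl _ _) e2] at hj
  rw [← hj]
  simp [poisson, hc]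

/-- The transformed coordinates must again satisfy the Darboux relations. For `p` with `v` this is
the inverse Jacobian, for `P` with `p` the commutation of coordinate fields; `P` with `v` and `P`
with `P` follow from `poisson_vecL_eq_zero`, and reversed pairs from skew symmetry. -/
lemma compat_var_var (h : CoordChange φ ψ U U') {y : Euc n} (hy : y ∈ U') (a b : Gen n) :
    Compat (r := r) φ ψ (fun _ ↦ var r a) (fun _ ↦ var r b) y := by
  have hv : ∀ i, HomOn U (Gen.deg r (.v i)) fun _ ↦ var r (.v i) := fun i ↦
    homOn_const U (var_mem_degree (.v i))
  have hp : ∀ i, HomOn U (Gen.deg r (.p i)) fun _ ↦ var r (.p i) := fun i ↦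
    homOn_const U (var_mem_degree (.p i))
  have hP : ∀ i, HomOn U (Gen.deg r (.P i)) fun _ ↦ var r (.P i) := fun i ↦
    homOn_const U (var_mem_degree (.P i))
  have hpv : ∀ i j, Compat (r := r) φ ψ (fun _ ↦ var r (.p i)) (fun _ ↦ var r (.v j)) y := by
    intro i j
    rw [Compat, push_p, poisson_congr (Filter.EventuallyEq.refl _ _) (h.push_v_eventuallyEq hy j),
      poisson_vecP_covV, h.sum_coordVec_mul_jacobian hy]
    by_cases hij : i = j <;> simp [poisson, hij, eq_comm]
  have hPp : ∀ i j, Compat (r := r) φ ψ (fun _ ↦ var r (.P i)) (fun _ ↦ var r (.p j)) y := by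
    intro i j
    rw [Compat, push_p, poisson_congr (h.push_P_eventuallyEq hy i) (Filter.EventuallyEq.refl _ _),
      poisson_vecL_vecP fun k ↦ h.differentiableAt_coordVec hy k j]
    simp [poisson, vecP, h.coordLie_coordVec hy]
  have hPv : ∀ i j, Compat (r := r) φ ψ (fun _ ↦ var r (.P i)) (fun _ ↦ var r (.v j)) y := by
    intro i j
    rw [Compat, poisson_congr (h.push_P_eventuallyEq hy i) (h.push_v_eventuallyEq hy j),
      h.poisson_vecL_eq_zero hy i (homOn_covV h.isOpen' fun k ↦ h.contDiffOn_jacobian' j k)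
      (fun z hz ↦ h.poisson_S_push_v hz j) (fun z hz ↦ by
        rw [poisson_vecP_covV, h.sum_coordVec_mul_jacobian hz])
      fun k ↦ ⟨leftPartial_algebraMap _ _, leftPartial_algebraMap _ _⟩]
    simp [poisson]
  have hPP : ∀ i j, Compat (r := r) φ ψ (fun _ ↦ var r (.P i)) (fun _ ↦ var r (.P j)) y := by
    intro i j
    rw [Compat, poisson_congr (h.push_P_eventuallyEq hy i) (h.push_P_eventuallyEq hy j),
      h.poisson_vecL_eq_zero hy i (c := 0) (homOn_vecL h.isOpen' fun k ↦ h.contDiffOn_coordVec j k)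
      (fun z hz ↦ h.poisson_S_vecL hz j) (fun z hz ↦ ?_) (by simp)]
    · simp [poisson]
    · rw [poisson_skew h.isOpen' (homOn_vecP h.isOpen' fun k ↦ h.contDiffOn_coordVec i k)
        (homOn_vecL h.isOpen' fun k ↦ h.contDiffOn_coordVec j k) hz,
        poisson_vecL_vecP fun k ↦ h.differentiableAt_coordVec hz k i]
      simp [vecP, h.coordLie_coordVec hz]
  rcases a with i | i | i <;> rcases b with j | j | j
  · rw [Compat, poisson_congr (h.push_v_eventuallyEq hy i) (h.push_v_eventuallyEq hy j),
      poisson_covV_covV]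
    simp [poisson]
  · exact h.compat_symm hy (hp j) (hv i) (hpv j i)
  · exact h.compat_symm hy (hP j) (hv i) (hPv j i)
  · exact hpv i j
  · rw [Compat, push_p, push_p, poisson_vecP_vecP]
    simp [poisson]
  · exact h.compat_symm hy (hP j) (hp i) (hPp j i)
  · exact hPv i j
  · exact hPp i j
  · exact hPP i j

lemma compat_var_smul_one (h : CoordChange φ ψ U U') {y : Euc n} (hy : y ∈ U') (a : Gen n)
    {f : Euc n → ℝ} (hf : ContDiffOn ℝ ∞ f U) :
    Compat (r := r) φ ψ (fun _ ↦ var r a) (fun y ↦ f y • 1) y := by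
  have hf' : DifferentiableAt ℝ f (ψ y) :=
    (hf.contDiffAt (h.isOpen.mem_nhds (h.maps' y hy))).differentiableAt (by simp)
  have hfψ : DifferentiableAt ℝ (fun z ↦ f (ψ z)) y := hf'.comp y (h.differentiableAt' hy)
  rw [Compat, push_smul_one, poisson_smul_one hf']
  rcases a with j | j | j
  · rw [poisson_congr (h.push_v_eventuallyEq hy j) (Filter.EventuallyEq.refl _ _),
      poisson_smul_one hfψ]
    simp
  · rw [push_p, poisson_smul_one hfψ]
    simp
  · rw [poisson_congr (h.push_P_eventuallyEq hy j) (Filter.EventuallyEq.refl _ _),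
      poisson_vecL_smul_one hfψ, h.sum_coordVec_mul_fderiv hy hf']
    simp

lemma compat_smul_one_smul_one (h : CoordChange φ ψ U U') {y : Euc n} (hy : y ∈ U')
    {f g : Euc n → ℝ} (hg : ContDiffOn ℝ ∞ g U) :
    Compat (r := r) φ ψ (fun y ↦ f y • 1) (fun y ↦ g y • 1) y := by
  have hg' : DifferentiableAt ℝ g (ψ y) :=
    (hg.contDiffAt (h.isOpen.mem_nhds (h.maps' y hy))).differentiableAt (by simp)
  have hgψ : DifferentiableAt ℝ (fun z ↦ g (ψ z)) y := hg'.comp y (h.differentiableAt' hy)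
  rw [Compat, push_smul_one, push_smul_one, poisson_smul_one hg', poisson_smul_one hgψ]
  simp

lemma compat_mon_right (h : CoordChange φ ψ U U') {y : Euc n} (hy : y ∈ U')
    {F : Euc n → FibreAlg n r} {m : ℤ} (hF : HomOn U m F)
    (h1 : ∀ a, Compat φ ψ F (fun _ ↦ var r a) y)
    (h2 : ∀ f : Euc n → ℝ, ContDiffOn ℝ ∞ f U → Compat φ ψ F (fun y ↦ f y • 1) y)
    {f : Euc n → ℝ} (hf : ContDiffOn ℝ ∞ f U) (l : List (Gen n)) :
    Compat φ ψ F (fun y ↦ f y • mon r l) y := by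
  induction l with
  | nil => exact h2 f hf
  | cons a l ih =>
    have := h.compat_mul_right hy hF (homOn_const U (var_mem_degree a))
      (homOn_smul h.isOpen hf (mon_mem_degree l)) (h1 a) ih
    simpa using this

/-- The Leibniz rule is available in the second argument only. It is used there first, and then,
after exchanging the arguments, for the other monomial. -/
lemma compat_mon_mon (h : CoordChange φ ψ U U') {y : Euc n} (hy : y ∈ U')
    {f g : Euc n → ℝ} (hf : ContDiffOn ℝ ∞ f U) (hg : ContDiffOn ℝ ∞ g U) (k l : List (Gen n)) :
    Compat (r := r) φ ψ (fun y ↦ f y • mon r k) (fun y ↦ g y • mon r l) y := by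
  have hG := homOn_smul (r := r) h.isOpen hg (mon_mem_degree l)
  refine h.compat_symm hy hG (homOn_smul h.isOpen hf (mon_mem_degree k))
    (h.compat_mon_right hy hG (fun a ↦ ?_) (fun f' hf' ↦ ?_) hf k)
  · exact h.compat_symm hy (homOn_const U (var_mem_degree a)) hG
      (h.compat_mon_right hy (homOn_const U (var_mem_degree a)) (h.compat_var_var hy a)
        (fun f hf ↦ h.compat_var_smul_one hy a hf) hg l)
  · have h1 := homOn_smul (r := r) h.isOpen hf' one_mem_degree
    exact h.compat_symm hy h1 hG (h.compat_mon_right hy h1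
      (fun a ↦ h.compat_symm hy (homOn_const U (var_mem_degree a)) h1
        (h.compat_var_smul_one hy a hf')) (fun f hf ↦ h.compat_smul_one_smul_one hy hf) hg l)

lemma push_eventuallyEq (h : CoordChange φ ψ U U') {y : Euc n} (hy : y ∈ U')
    {F G : Euc n → FibreAlg n r} (hFG : F =ᶠ[𝓝 (ψ y)] G) : push φ ψ F =ᶠ[𝓝 y] push φ ψ G := by
  filter_upwards [(h.differentiableAt' hy).continuousAt.eventually hFG] with z hz
  simp only [push, hz]

/-- The Poisson bracket does not depend on the coordinates. -/
theorem compat (h : CoordChange φ ψ U U') {y : Euc n} (hy : y ∈ U') {F G : Euc n → FibreAlg n r}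
    (hF : IsSmoothOn F U) (hG : IsSmoothOn G U) : Compat φ ψ F G y := by
  obtain ⟨O, hO, hyO, N, _, f, l, hf, hF⟩ := hF.exists_sum_mon (h.maps' y hy)
  obtain ⟨O', hO', hyO', N', _, f', l', hf', hG⟩ := hG.exists_sum_mon (h.maps' y hy)
  -- The bracket is local, so both functions may be replaced by finite sums of monomials with smooth
  -- coefficients on a common smaller domain.
  have hr := h.restrict (hO.inter hO')
  have hyr : y ∈ U' ∩ ψ ⁻¹' (O ∩ O') := ⟨hy, hyO, hyO'⟩
  have eF : F =ᶠ[𝓝 (ψ y)] fun z ↦ ∑ s, f s z • mon r (l s) := by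
    filter_upwards [hO.mem_nhds hyO] with z hz using hF z hz
  have eG : G =ᶠ[𝓝 (ψ y)] fun z ↦ ∑ s, f' s z • mon r (l' s) := by
    filter_upwards [hO'.mem_nhds hyO'] with z hz using hG z hz
  have sf : ∀ s, ContDiffOn ℝ ∞ (f s) (U ∩ (O ∩ O')) := fun s ↦
    (hf s).mono (Set.inter_subset_right.trans Set.inter_subset_left)
  have sf' : ∀ s, ContDiffOn ℝ ∞ (f' s) (U ∩ (O ∩ O')) := fun s ↦
    (hf' s).mono (Set.inter_subset_right.trans Set.inter_subset_right)
  have hs : ∀ s, HomOn (U ∩ (O ∩ O')) (monDeg r (l s)) fun z ↦ f s z • mon r (l s) := fun s ↦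
    homOn_smul hr.isOpen (sf s) (mon_mem_degree _)
  have hs' : ∀ s, HomOn (U ∩ (O ∩ O')) (monDeg r (l' s)) fun z ↦ f' s z • mon r (l' s) := fun s ↦
    homOn_smul hr.isOpen (sf' s) (mon_mem_degree _)
  have push_sum : ∀ {N : Type} [Fintype N] (F : N → Euc n → FibreAlg n r),
      push φ ψ (fun z ↦ ∑ s, F s z) = fun z ↦ ∑ s, push φ ψ (F s) z := fun F ↦ by
    ext1 z; simp [push]
  rw [Compat, poisson_congr (h.push_eventuallyEq hy eF) (h.push_eventuallyEq hy eG),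
    poisson_congr eF eG, push_sum, push_sum,
    poisson_sum_left _ (fun s _ ↦ (hr.homOn_push (hs s)).1) hyr,
    poisson_sum_left _ (fun s _ ↦ (hs s).1) (hr.maps' y hyr), map_sum]
  refine Finset.sum_congr rfl fun s _ ↦ ?_
  rw [poisson_sum_right _ (fun s _ ↦ (hr.homOn_push (hs' s)).1) hyr,
    poisson_sum_right _ (fun s _ ↦ (hs' s).1) (hr.maps' y hyr), map_sum]
  exact Finset.sum_congr rfl fun t _ ↦ hr.compat_mon_mon hyr (sf s) (sf' t) _ _

end CoordChange

end HigherCourant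

/-! ### Alternating forms as polynomials in the `vⁱ` -/

namespace HigherCourant

variable {n r : ℕ}

open Classical in
-- An injective multi-index is, in exactly one way, an increasing one composed with a permutation,
-- so each increasing multi-index is counted `k!` times.
lemma sum_eq_factorial_smul_sum_strictMono {k : ℕ} {V : Type*} [AddCommGroup V]
    (g : (Fin k → Fin n) → V) (hg : ∀ I (σ : Equiv.Perm (Fin k)), g (I ∘ σ) = g I)
    (h0 : ∀ I, ¬ Function.Injective I → g I = 0) :
    ∑ I, g I = k.factorial • ∑ I : Fin k → Fin n with StrictMono I, g I := by
  have h1 : ∑ I, g I = ∑ I : Fin k → Fin n with Function.Injective I, g I :=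
    (Finset.sum_filter_of_ne fun I _ hI ↦ not_not.1 fun h ↦ hI (h0 I h)).symm
  have h2 : ∑ p ∈ (Finset.univ.filter fun I : Fin k → Fin n ↦ StrictMono I) ×ˢ
      (Finset.univ : Finset (Equiv.Perm (Fin k))), g p.1 =
      ∑ I : Fin k → Fin n with Function.Injective I, g I := by
    refine Finset.sum_bij (fun p _ ↦ p.1 ∘ p.2) ?_ ?_ ?_ ?_
    · rintro ⟨J, σ⟩ h
      simp only [Finset.mem_product, Finset.mem_filter, Finset.mem_univ, true_and, and_true] at h ⊢
      exact h.injective.comp σ.injective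
    · rintro ⟨J, σ⟩ h ⟨J', σ'⟩ h' heq
      simp only [Finset.mem_product, Finset.mem_filter, Finset.mem_univ, true_and, and_true] at h h'
      simp only at heq
      have hr : Set.range J = Set.range J' := by
        rw [← σ.surjective.range_comp J, heq, σ'.surjective.range_comp J']
      have hJ : J = J' := (h.range_inj h').1 hr
      subst hJ
      have : σ = σ' := Equiv.ext fun a ↦ h.injective (congrFun heq a)
      rw [this]
    · intro I hI
      simp only [Finset.mem_filter, Finset.mem_univ, true_and] at hI
      -- Sorting provides the increasing multi-index, and the inverse of the sorting permutation
      -- recovers `I`.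
      refine ⟨(I ∘ Tuple.sort I, (Tuple.sort I)⁻¹), ?_, ?_⟩
      · simp only [Finset.mem_product, Finset.mem_filter, Finset.mem_univ, true_and, and_true]
        exact (Tuple.monotone_sort I).strictMono_of_injective
          (hI.comp (Tuple.sort I).injective)
      · ext a
        simp
    · rintro ⟨J, σ⟩ _
      exact (hg J σ).symm
  rw [h1, ← h2, Finset.sum_product]
  simp [Finset.card_univ, Fintype.card_perm, Finset.smul_sum]

/-- The linear function `wᵢ vⁱ`. -/
noncomputable def linV (n r : ℕ) : Euc n →ₗ[ℝ] FibreAlg n r where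
  toFun w := ∑ i, w i • var r (.v i)
  map_add' w w' := by simp [add_smul, Finset.sum_add_distrib]
  map_smul' c w := by simp [Finset.smul_sum, smul_smul]

lemma linV_basisVec (i : Fin n) : linV n r (basisVec i) = var r (.v i) := by
  simp [linV]

lemma linV_mem_degree (w : Euc n) : linV n r w ∈ degree n r 1 := by
  change ∑ i, w i • var r (.v i) ∈ _
  exact sum_mem fun i _ ↦ Submodule.smul_mem _ _ (var_mem_degree (.v i))

lemma linV_mul_self (w : Euc n) : linV n r w * linV n r w = 0 := by
  have h := mul_comm_degree (linV_mem_degree (r := r) w) (linV_mem_degree w)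
  rw [mul_one, zpow_one, neg_smul', one_smul] at h
  exact eq_zero_of_eq_neg h

/-- The alternating product `w₁ ⋯ wₖ` of linear functions of the `vⁱ`. -/
noncomputable def altV (n r k : ℕ) : (Euc n) [⋀^Fin k]→ₗ[ℝ] FibreAlg n r :=
  (ExteriorAlgebra.lift ℝ ⟨linV n r, linV_mul_self⟩).toLinearMap.compAlternatingMap
    (ExteriorAlgebra.ιMulti ℝ k)

lemma altV_apply {k : ℕ} (w : Fin k → Euc n) :
    altV n r k w = (List.ofFn fun a ↦ linV n r (w a)).prod := by
  simp [altV, ExteriorAlgebra.ιMulti_apply, map_list_prod, List.map_ofFn, Function.comp_def]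

open Classical in
/-- The polynomial `η_I vᴵ` attached to an alternating form. -/
noncomputable def altPoly (r : ℕ) {k : ℕ} (η : (Euc n) [⋀^Fin k]→L[ℝ] ℝ) : FibreAlg n r :=
  ∑ I : Fin k → Fin n with StrictMono I,
    η (fun a ↦ basisVec (I a)) • (List.ofFn (fun a ↦ var r (.v (I a)))).prod

/-- The coefficient `η_I` and the monomial `vᴵ` change by the same sign when `I` is permuted, so
their product is symmetric, and it vanishes when an index repeats. A sum over all multi-indices,
unlike one over increasing ones, is easily split along its first index. -/
lemma altPoly_eq_sum {k : ℕ} (η : (Euc n) [⋀^Fin k]→L[ℝ] ℝ) :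
    altPoly r η = ((k.factorial : ℝ)⁻¹) • ∑ I : Fin k → Fin n,
      η (fun a ↦ basisVec (I a)) • (List.ofFn (fun a ↦ var r (.v (I a)))).prod := by
  have hV : ∀ I : Fin k → Fin n, (List.ofFn (fun a ↦ var r (.v (I a)))).prod =
      altV n r k (fun a ↦ basisVec (I a)) := fun I ↦ by simp [altV_apply, linV_basisVec]
  rw [sum_eq_factorial_smul_sum_strictMono, ← Nat.cast_smul_eq_nsmul ℝ, smul_smul,
    inv_mul_cancel₀ (by exact_mod_cast k.factorial_ne_zero), one_smul, altPoly]
  · intro I σ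
    simp only [hV]
    have h1 := η.toAlternatingMap.map_perm (fun a ↦ basisVec (I a)) σ
    have h2 := (altV n r k).map_perm (fun a ↦ basisVec (I a)) σ
    change η ((fun a ↦ basisVec (I a)) ∘ σ) • altV n r k ((fun a ↦ basisVec (I a)) ∘ σ) = _
    rw [h2]
    change η ((fun a ↦ basisVec (I a)) ∘ σ) = _ at h1
    rw [h1]
    rcases Int.units_eq_one_or (Equiv.Perm.sign σ) with h | h <;> simp [h]
  · intro I hI
    rw [η.map_eq_zero_of_not_injective, zero_smul]
    intro h
    exact hI fun a b hab ↦ h (by simp [hab])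

/-- Euler's identity in the odd variables. This recursion on the degree drives the inductions that
follow. -/
lemma altPoly_succ {k : ℕ} (η : (Euc n) [⋀^Fin (k + 1)]→L[ℝ] ℝ) :
    altPoly r η = ((k + 1 : ℝ)⁻¹) • ∑ i, var r (.v i) * altPoly r (η.curryLeft (basisVec i)) := by
  simp only [altPoly_eq_sum]
  rw [← (Fin.consEquiv fun _ ↦ Fin n).sum_comp, Fintype.sum_prod_type]
  simp only [mul_smul_comm, Finset.mul_sum, ← Finset.smul_sum, smul_smul]
  congr 1
  · rw [Nat.factorial_succ]; push_cast; rw [mul_inv]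
  · refine Finset.sum_congr rfl fun i _ ↦ Finset.sum_congr rfl fun I _ ↦ ?_
    have : (fun a ↦ basisVec (Fin.cons (α := fun _ ↦ Fin n) i I a) : Fin (k + 1) → Euc n) =
        Matrix.vecCons (basisVec i) fun a ↦ basisVec (I a) := by
      ext1 a; refine Fin.cases ?_ (fun a ↦ ?_) a <;> simp
    simp [Fin.consEquiv, this]

lemma altPoly_zero_eq (η : (Euc n) [⋀^Fin 0]→L[ℝ] ℝ) :
    altPoly r η = η ![] • (1 : FibreAlg n r) := by
  rw [altPoly_eq_sum]
  simp only [Nat.factorial_zero, Nat.cast_one, inv_one, one_smul, Finset.univ_unique,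
    Finset.sum_singleton, List.ofFn_zero, List.prod_nil]
  congr 2
  exact Subsingleton.elim _ _

/-- `altPoly` as a linear map. -/
noncomputable def altPolyₗ (n r k : ℕ) : ((Euc n) [⋀^Fin k]→L[ℝ] ℝ) →ₗ[ℝ] FibreAlg n r where
  toFun η := altPoly r η
  map_add' η θ := by simp [altPoly, add_smul, Finset.sum_add_distrib]
  map_smul' c η := by simp [altPoly, Finset.smul_sum, smul_smul]

lemma altPoly_add {k : ℕ} (η θ : (Euc n) [⋀^Fin k]→L[ℝ] ℝ) :
    altPoly r (η + θ) = altPoly r η + altPoly r θ := map_add (altPolyₗ n r k) η θ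

lemma altPoly_smul {k : ℕ} (c : ℝ) (η : (Euc n) [⋀^Fin k]→L[ℝ] ℝ) :
    altPoly r (c • η) = c • altPoly r η := map_smul (altPolyₗ n r k) c η

lemma altPoly_neg {k : ℕ} (η : (Euc n) [⋀^Fin k]→L[ℝ] ℝ) :
    altPoly r (-η) = -altPoly r η := map_neg (altPolyₗ n r k) η

lemma altPoly_sub {k : ℕ} (η θ : (Euc n) [⋀^Fin k]→L[ℝ] ℝ) :
    altPoly r (η - θ) = altPoly r η - altPoly r θ := map_sub (altPolyₗ n r k) η θ

@[simp] lemma altPoly_zero {k : ℕ} : altPoly r (0 : (Euc n) [⋀^Fin k]→L[ℝ] ℝ) = 0 :=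
  map_zero (altPolyₗ n r k)

lemma altPoly_sum {k : ℕ} {N : Type*} (s : Finset N) (η : N → (Euc n) [⋀^Fin k]→L[ℝ] ℝ) :
    altPoly r (∑ i ∈ s, η i) = ∑ i ∈ s, altPoly r (η i) := map_sum (altPolyₗ n r k) η s

lemma altPoly_mem_degree {k : ℕ} (η : (Euc n) [⋀^Fin k]→L[ℝ] ℝ) : altPoly r η ∈ degree n r k := by
  refine sum_mem fun I _ ↦ Submodule.smul_mem _ _ (Submodule.subset_span ⟨List.ofFn fun a ↦ .v (I a),
    ?_, ?_⟩)
  · simp [List.map_ofFn, Function.comp_def, Gen.deg]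
  · simp [List.map_ofFn, Function.comp_def]

lemma alternatingMap_eq_zero_of_lt {k : ℕ} (hk : n < k) (η : (Euc n) [⋀^Fin k]→L[ℝ] ℝ) : η = 0 := by
  ext v
  refine η.toAlternatingMap.map_linearDependent v fun h ↦ ?_
  have := h.fintype_card_le_finrank
  simp at this
  omega

lemma leftPartial_v_altPoly_zero (i : Fin n) (η : (Euc n) [⋀^Fin 0]→L[ℝ] ℝ) :
    leftPartial (.v i) (altPoly r η) = 0 := by simp [altPoly_zero_eq]

lemma leftPartial_altPoly_of_ne (z : Gen n) (hz : ∀ i, z ≠ .v i) {k : ℕ}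
    (η : (Euc n) [⋀^Fin k]→L[ℝ] ℝ) : leftPartial z (altPoly r η) = 0 := by
  induction k with
  | zero => simp [altPoly_zero_eq]
  | succ k ih =>
    rw [altPoly_succ]
    simp [leftPartial_var_mul z _ (altPoly_mem_degree _), ih, (hz _).symm]

lemma rightPartial_altPoly_of_ne (z : Gen n) (hz : ∀ i, z ≠ .v i) {k : ℕ}
    (η : (Euc n) [⋀^Fin k]→L[ℝ] ℝ) : rightPartial z (altPoly r η) = 0 := by
  rw [rightPartial_eq z (altPoly_mem_degree η), leftPartial_altPoly_of_ne z hz, smul_zero]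

lemma curryLeft_swap {k : ℕ} (η : (Euc n) [⋀^Fin (k + 2)]→L[ℝ] ℝ) (x y : Euc n) :
    (η.curryLeft x).curryLeft y = -(η.curryLeft y).curryLeft x := by
  have h := η.curryLeft_same (x + y)
  have hx := η.curryLeft_same x
  have hy := η.curryLeft_same y
  rw [map_add, map_add, ContinuousAlternatingMap.curryLeft_add, add_apply, add_apply, hx, hy,
    zero_add, add_zero] at h
  exact eq_neg_of_add_eq_zero_right h

/-- Apply `∂/∂vⁱ` to the recursion for a form of degree `k + 2`: removing the leading factor gives
the contraction once, and the other term, by induction and antisymmetry, gives it `k + 1` times. The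
prefactor `1 / (k + 2)` makes the total one. -/
lemma leftPartial_v_altPoly {k : ℕ} (i : Fin n) (η : (Euc n) [⋀^Fin (k + 1)]→L[ℝ] ℝ) :
    leftPartial (.v i) (altPoly r η) = altPoly r (η.curryLeft (basisVec i)) := by
  induction k with
  | zero =>
    rw [altPoly_succ]
    simp only [map_smul, map_sum, leftPartial_var_mul _ _ (altPoly_mem_degree _),
      leftPartial_v_altPoly_zero, mul_zero, smul_zero, add_zero, Gen.v.injEq, ite_smul, one_smul,
      zero_smul, Finset.sum_ite_eq', Finset.mem_univ, if_true]
    simp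
  | succ k ih =>
    rw [altPoly_succ]
    simp only [map_smul, map_sum, leftPartial_var_mul _ _ (altPoly_mem_degree _), ih,
      Gen.v.injEq, ite_smul, one_smul, zero_smul, Finset.sum_add_distrib, Finset.sum_ite_eq',
      Finset.mem_univ, if_true, Gen.deg, mul_one, zpow_one, neg_smul',
      one_smul]
    have hs : ∀ x, altPoly r ((η.curryLeft (basisVec x)).curryLeft (basisVec i)) =
        -altPoly r ((η.curryLeft (basisVec i)).curryLeft (basisVec x)) := fun x ↦ by
      rw [curryLeft_swap, altPoly_neg]
    have hm : ∀ x, -(var r (.v x) * altPoly r ((η.curryLeft (basisVec x)).curryLeft (basisVec i))) =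
        var r (.v x) * altPoly r ((η.curryLeft (basisVec i)).curryLeft (basisVec x)) := fun x ↦ by
      rw [hs]
      exact (congrArg (fun x : FibreAlg n r ↦ -x) (mul_neg _ _)).trans (neg_neg _)
    simp only [hm]
    have h := altPoly_succ (r := r) (η.curryLeft (basisVec i))
    rw [eq_inv_smul_iff₀ (by positivity)] at h
    rw [← h, inv_smul_eq_iff₀ (by positivity)]
    push_cast
    module

/-- Differentiating in the `vⁱ` contracts with basis vectors and lowers the degree to `0`, where
`aug` reads off the scalar. -/
lemma eq_zero_of_altPoly_eq_zero {k : ℕ} (η : (Euc n) [⋀^Fin k]→L[ℝ] ℝ) (h : altPoly r η = 0) :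
    η = 0 := by
  induction k with
  | zero =>
    rw [altPoly_zero_eq] at h
    have := congrArg (aug n r) h
    ext v
    rw [Subsingleton.elim v ![]]
    simpa using this
  | succ k ih =>
    have hc : ∀ i, η.curryLeft (basisVec i) = 0 := fun i ↦ ih _ <| by
      rw [← leftPartial_v_altPoly, h, map_zero]
    ext v
    rw [← Matrix.cons_head_tail v, ← ContinuousAlternatingMap.curryLeft_apply_apply,
      clm_apply_eq_sum]
    simp [hc]

/-- In the alternating sum the vector `x` is fed to `L` in the term of index `0`; in every other
term it stays the first argument of the form, and the shifted index contributes the minus sign. -/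
lemma curryLeft_alternatizeUncurryFin {k : ℕ} (L : Euc n →L[ℝ] (Euc n) [⋀^Fin (k + 1)]→L[ℝ] ℝ)
    (x : Euc n) : (ContinuousAlternatingMap.alternatizeUncurryFin L).curryLeft x = L x -
      ContinuousAlternatingMap.alternatizeUncurryFin
        ((ContinuousAlternatingMap.curryLeftLI.toContinuousLinearMap.comp L).flip x) := by
  ext v
  rw [ContinuousAlternatingMap.curryLeft_apply_apply,
    ContinuousAlternatingMap.alternatizeUncurryFin_apply, Fin.sum_univ_succ,
    ContinuousAlternatingMap.sub_apply, ContinuousAlternatingMap.alternatizeUncurryFin_apply,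
    sub_eq_add_neg, ← Finset.sum_neg_distrib]
  congr 1
  · simp [Matrix.vecCons]
  · refine Finset.sum_congr rfl fun j _ ↦ ?_
    have h : Fin.removeNth j.succ (Matrix.vecCons x v) = Matrix.vecCons x (Fin.removeNth j v) := by
      ext1 a
      refine Fin.cases ?_ (fun a ↦ ?_) a <;> simp [Fin.removeNth, Matrix.vecCons]
    rw [h]
    simp [pow_succ]

lemma curryLeft_alternatizeUncurryFin_zero (L : Euc n →L[ℝ] (Euc n) [⋀^Fin 0]→L[ℝ] ℝ)
    (x : Euc n) : (ContinuousAlternatingMap.alternatizeUncurryFin L).curryLeft x = L x := by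
  ext v
  rw [ContinuousAlternatingMap.curryLeft_apply_apply,
    ContinuousAlternatingMap.alternatizeUncurryFin_apply, Fin.sum_univ_succ]
  simp [Matrix.vecCons]

lemma FibreAlg.v_mul_v_mul (i j : Fin n) (x : FibreAlg n r) :
    var r (.v i) * (var r (.v j) * x) = -(var r (.v j) * (var r (.v i) * x)) := by
  rw [← mul_assoc, var_mul_var, ← mul_assoc]
  simp only [Gen.deg, mul_one, zpow_one, neg_smul', one_smul]
  exact neg_mul (α := FibreAlg n r) _ _

/-- With `L` the derivative of a form, this says that `vⁱ ∂/∂xⁱ` is the exterior derivative.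
Contracting the alternation gives `L x` minus an alternation of lower degree; by induction and
anticommutation of the `vⁱ` the latter contributes a further `k + 1` copies of the left side,
balancing the factor `k + 2` from the recursion. -/
lemma sum_v_mul_altPoly {k : ℕ} (L : Euc n →L[ℝ] (Euc n) [⋀^Fin k]→L[ℝ] ℝ) :
    ∑ i, var r (.v i) * altPoly r (L (basisVec i)) =
      altPoly r (ContinuousAlternatingMap.alternatizeUncurryFin L) := by
  induction k with
  | zero =>
    rw [altPoly_succ]
    simp only [curryLeft_alternatizeUncurryFin_zero]
    simp
  | succ k ih =>
    have h (j : Fin n) := altPoly_succ (r := r) (L (basisVec j))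
    simp only [eq_inv_smul_iff₀ (show (k + 1 : ℝ) ≠ 0 by positivity)] at h
    rw [altPoly_succ, eq_inv_smul_iff₀ (by positivity)]
    simp only [curryLeft_alternatizeUncurryFin, altPoly_sub, ← ih, mul_sub, Finset.mul_sum,
      Finset.sum_sub_distrib]
    have h1 : ∑ i, ∑ j, var r (.v i) * (var r (.v j) * altPoly r
        (((ContinuousAlternatingMap.curryLeftLI.toContinuousLinearMap.comp L).flip (basisVec i))
          (basisVec j))) = -∑ j, var r (.v j) * ((k + 1 : ℝ) • altPoly r (L (basisVec j))) := by
      rw [Finset.sum_comm, ← Finset.sum_neg_distrib]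
      refine Finset.sum_congr rfl fun j _ ↦ ?_
      rw [h, Finset.mul_sum, ← Finset.sum_neg_distrib]
      exact Finset.sum_congr rfl fun i _ ↦ v_mul_v_mul _ _ _
    rw [h1]
    simp only [mul_smul_comm, ← Finset.smul_sum]
    push_cast
    module

/-- The `vⁱ` transform like the differentials `dxⁱ`, so substituting them is pulling back the form.
This makes a differential form a global function. -/
lemma fibreChange_altPoly {φ ψ : Euc n → Euc n} {y : Euc n} {A : Euc n →L[ℝ] Euc n}
    (hA : ∀ i j, jacobian ψ i j (φ y) = A (basisVec j) i) {k : ℕ}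
    (η : (Euc n) [⋀^Fin k]→L[ℝ] ℝ) :
    fibreChange r φ ψ y (altPoly r η) = altPoly r (η.compContinuousLinearMap A) := by
  induction k with
  | zero =>
    rw [altPoly_zero_eq, altPoly_zero_eq, map_smul, map_one]
    congr 1
    rw [ContinuousAlternatingMap.compContinuousLinearMap_apply]
    exact congrArg η (Subsingleton.elim _ _)
  | succ k ih =>
    rw [altPoly_succ, altPoly_succ, map_smul, map_sum]
    congr 1
    have hv : ∀ i, fibreChange r φ ψ y (var r (.v i)) =
        ∑ l, A (basisVec l) i • var r (.v l) := fun i ↦ by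
      simp [fibreChange, subst, substGen, hA]
    simp only [map_mul, hv, ih, Finset.sum_mul,
      ContinuousAlternatingMap.curryLeft_compContinuousLinearMap, smul_mul_assoc]
    rw [Finset.sum_comm]
    refine Finset.sum_congr rfl fun j _ ↦ ?_
    have hL := clm_apply_eq_sum ((ContinuousAlternatingMap.compContinuousLinearMapCLM A).comp
      η.curryLeft) (A (basisVec j))
    simp only [ContinuousLinearMap.comp_apply,
      ContinuousAlternatingMap.compContinuousLinearMapCLM_apply] at hL
    rw [hL]
    simp [altPoly_sum, Finset.mul_sum, altPoly_smul]

section Local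

variable {U : Set (Euc n)} {k : ℕ} {η : Euc n → (Euc n) [⋀^Fin k]→L[ℝ] ℝ}

lemma contDiffOn_apply_form (hη : ContDiffOn ℝ ∞ η U) (v : Fin k → Euc n) :
    ContDiffOn ℝ ∞ (fun y ↦ η y v) U :=
  (ContinuousAlternatingMap.apply ℝ (Euc n) ℝ v).contDiff.comp_contDiffOn hη

lemma homOn_altPoly (hU : IsOpen U) (hη : ContDiffOn ℝ ∞ η U) :
    HomOn U k fun y ↦ altPoly r (η y) :=
  ⟨IsSmoothOn.sum _ fun _ _ ↦ isSmoothOn_smul hU (contDiffOn_apply_form hη _) _,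
    fun _ _ ↦ altPoly_mem_degree _⟩

lemma partialX_altPoly {y : Euc n} (hη : DifferentiableAt ℝ η y) (i : Fin n) :
    partialX (fun y ↦ altPoly r (η y)) i y = altPoly r (fderiv ℝ η y (basisVec i)) := by
  refine (hasPartialX_sum _ fun I _ ↦ ?_).partialX_eq
  have h := ((ContinuousAlternatingMap.apply ℝ (Euc n) ℝ
    (fun a ↦ basisVec (I a))).hasFDerivAt.comp y hη.hasFDerivAt)
  have h' := hasPartialX_smul (i := i) (r := r) h.differentiableAt
    (List.ofFn (fun a ↦ var r (.v (I a)))).prod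
  rw [h.fderiv] at h'
  exact h'

lemma poisson_S_altPoly {y : Euc n} (hη : DifferentiableAt ℝ η y) :
    poisson (fun _ ↦ polyS n r) (fun y ↦ altPoly r (η y)) y = altPoly r (extDeriv η y) := by
  simp only [poisson, rightPartial_P_polyS, partialX_altPoly hη, partialX_const, zero_mul, sub_zero,
    rightPartial_p_polyS, add_zero, leftPartial_altPoly_of_ne (.p _) (by simp), mul_zero, smul_zero]
  exact sum_v_mul_altPoly _

lemma poisson_vecP_altPoly {η : Euc n → (Euc n) [⋀^Fin (k + 1)]→L[ℝ] ℝ} {X : Fin n → Euc n → ℝ}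
    {y w : Euc n} (hw : ∀ i, X i y = w i) :
    poisson (vecP r X) (fun y ↦ altPoly r (η y)) y = altPoly r ((η y).curryLeft w) := by
  rw [clm_apply_eq_sum (η y).curryLeft w, altPoly_sum]
  refine Finset.sum_congr rfl fun i _ ↦ ?_
  simp [leftPartial_altPoly_of_ne (.p _), leftPartial_altPoly_of_ne (.P _), leftPartial_v_altPoly,
    hw, altPoly_smul, Algebra.algebraMap_eq_smul_one]

lemma poisson_vecP_altPoly_zero {η : Euc n → (Euc n) [⋀^Fin 0]→L[ℝ] ℝ} (X : Fin n → Euc n → ℝ)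
    (y : Euc n) : poisson (vecP r X) (fun y ↦ altPoly r (η y)) y = 0 := by
  simp [poisson, leftPartial_altPoly_of_ne (.p _), leftPartial_altPoly_of_ne (.P _),
    leftPartial_v_altPoly_zero]

lemma poisson_altPoly_altPoly {l : ℕ} (η : Euc n → (Euc n) [⋀^Fin k]→L[ℝ] ℝ)
    (θ : Euc n → (Euc n) [⋀^Fin l]→L[ℝ] ℝ) (y : Euc n) :
    poisson (fun y ↦ altPoly r (η y)) (fun y ↦ altPoly r (θ y)) y = 0 := by
  simp [poisson, leftPartial_altPoly_of_ne (.p _), leftPartial_altPoly_of_ne (.P _),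
    rightPartial_altPoly_of_ne (.p _), rightPartial_altPoly_of_ne (.P _)]

end Local

end HigherCourant

/-! ### Forms and vector fields in charts -/

namespace HigherCourant

variable {n r : ℕ}

lemma mlieBracket_eq_lieBracket (V W : (x : Euc n) → TangentSpace 𝓘(ℝ, Euc n) x) :
    VectorField.mlieBracket 𝓘(ℝ, Euc n) V W = VectorField.lieBracket ℝ V W := by
  rw [← VectorField.mlieBracketWithin_univ, VectorField.mlieBracketWithin_eq_lieBracketWithin]
  exact VectorField.lieBracketWithin_univ

section Manifold

variable {M : Type*} [TopologicalSpace M] [ChartedSpace (Euc n) M]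

namespace Chart

/-- The derivative of a chart at a point of the manifold. -/
noncomputable def D (e : Chart n M) (x : M) : Euc n →L[ℝ] Euc n :=
  mfderiv 𝓘(ℝ, Euc n) 𝓘(ℝ, Euc n) e.1 x

/-- The derivative of the inverse of a chart. -/
noncomputable def Dsymm (e : Chart n M) (y : Euc n) : Euc n →L[ℝ] Euc n :=
  mfderiv 𝓘(ℝ, Euc n) 𝓘(ℝ, Euc n) e.1.symm y

/-- The expression of a vector field in a chart. -/
noncomputable def vectorField (e : Chart n M) (X : VField n M) (y : Euc n) : Euc n :=
  e.D (e.1.symm y) (X (e.1.symm y))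

lemma vcoord_eq (e : Chart n M) (X : VField n M) (i : Fin n) (y : Euc n) :
    vcoord e X i y = e.vectorField X y i := rfl

lemma contMDiffOn (e : Chart n M) : ContMDiffOn 𝓘(ℝ, Euc n) 𝓘(ℝ, Euc n) ∞ e.1 e.1.source :=
  contMDiffOn_of_mem_maximalAtlas e.2

lemma contMDiffOn_symm (e : Chart n M) :
    ContMDiffOn 𝓘(ℝ, Euc n) 𝓘(ℝ, Euc n) ∞ e.1.symm e.1.target :=
  contMDiffOn_symm_of_mem_maximalAtlas e.2

lemma mdifferentiable (e : Chart n M) : e.1.MDifferentiable 𝓘(ℝ, Euc n) 𝓘(ℝ, Euc n) :=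
  ⟨e.contMDiffOn.mdifferentiableOn (by simp), e.contMDiffOn_symm.mdifferentiableOn (by simp)⟩

lemma Dsymm_D (e : Chart n M) {x : M} (hx : x ∈ e.1.source) (v : Euc n) :
    e.Dsymm (e.1 x) (e.D x v) = v :=
  DFunLike.congr_fun (e.mdifferentiable.symm_comp_deriv hx) v

lemma D_Dsymm (e : Chart n M) {y : Euc n} (hy : y ∈ e.1.target) (v : Euc n) :
    e.D (e.1.symm y) (e.Dsymm y v) = v :=
  DFunLike.congr_fun (e.mdifferentiable.comp_symm_deriv hy) v

lemma Dsymm_D' (e : Chart n M) {y : Euc n} (hy : y ∈ e.1.target) (v : Euc n) :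
    e.Dsymm y (e.D (e.1.symm y) v) = v := by
  have := e.Dsymm_D (e.1.map_target hy) v
  rwa [e.1.right_inv hy] at this

lemma contDiffOn_change (e e' : Chart n M) : ContDiffOn ℝ ∞ (fun y ↦ e'.1 (e.1.symm y))
    (e.1.target ∩ e.1.symm ⁻¹' e'.1.source) :=
  contMDiffOn_iff_contDiffOn.1 (e'.contMDiffOn.comp' e.contMDiffOn_symm)

lemma coordChange (e e' : Chart n M) :
    CoordChange (fun y ↦ e'.1 (e.1.symm y)) (fun y ↦ e.1 (e'.1.symm y))
      (e.1.target ∩ e.1.symm ⁻¹' e'.1.source) (e'.1.target ∩ e'.1.symm ⁻¹' e.1.source) where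
  isOpen := e.1.isOpen_inter_preimage_symm e'.1.open_source
  isOpen' := e'.1.isOpen_inter_preimage_symm e.1.open_source
  maps y hy := ⟨e'.1.map_source hy.2, by
    change e'.1.symm (e'.1 (e.1.symm y)) ∈ e.1.source
    rw [e'.1.left_inv hy.2]; exact e.1.map_target hy.1⟩
  maps' y hy := ⟨e.1.map_source hy.2, by
    change e.1.symm (e.1 (e'.1.symm y)) ∈ e'.1.source
    rw [e.1.left_inv hy.2]; exact e'.1.map_target hy.1⟩
  left_inv y hy := by
    rw [e'.1.left_inv hy.2, e.1.right_inv hy.1]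
  right_inv y hy := by
    rw [e.1.left_inv hy.2, e'.1.right_inv hy.1]
  smooth := contDiffOn_change e e'
  smooth' := contDiffOn_change e' e

lemma fderiv_change (e e' : Chart n M) {y : Euc n} (hy : y ∈ e.1.target)
    (hy' : e.1.symm y ∈ e'.1.source) :
    fderiv ℝ (fun z ↦ e'.1 (e.1.symm z)) y = (e'.D (e.1.symm y)).comp (e.Dsymm y) := by
  rw [← mfderiv_eq_fderiv]
  exact mfderiv_comp y (e'.mdifferentiable.mdifferentiableAt hy')
    (e.mdifferentiable.mdifferentiableAt_symm hy)

lemma formInChart_change (e e' : Chart n M) {k : ℕ} (η : Form n M k) {y : Euc n}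
    (hy : y ∈ e'.1.target) (hy' : e'.1.symm y ∈ e.1.source) :
    formInChart e'.1 η y = (formInChart e.1 η (e.1 (e'.1.symm y))).compContinuousLinearMap
      (fderiv ℝ (fun z ↦ e.1 (e'.1.symm z)) y) := by
  -- All tangent spaces are the model space; for a family with values in one fixed space the base
  -- point can be replaced freely.
  have h : ∀ η : M → (Euc n) [⋀^Fin k]→L[ℝ] ℝ,
      (η (e'.1.symm y)).compContinuousLinearMap (e'.Dsymm y) =
      ((η (e.1.symm (e.1 (e'.1.symm y)))).compContinuousLinearMap
        (e.Dsymm (e.1 (e'.1.symm y)))).compContinuousLinearMap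
        (fderiv ℝ (fun z ↦ e.1 (e'.1.symm z)) y) := fun η ↦ by
    rw [fderiv_change _ _ hy hy', e.1.left_inv hy']
    ext v
    simp [Function.comp_def, e.Dsymm_D hy']
  exact h η

lemma vectorField_change (e e' : Chart n M) (X : VField n M) {y : Euc n}
    (hy : y ∈ e'.1.target) (hy' : e'.1.symm y ∈ e.1.source) :
    e'.vectorField X y = fderiv ℝ (fun z ↦ e'.1 (e.1.symm z)) (e.1 (e'.1.symm y))
      (e.vectorField X (e.1 (e'.1.symm y))) := by
  have h : ∀ X : M → Euc n, e'.D (e'.1.symm y) (X (e'.1.symm y)) =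
      fderiv ℝ (fun z ↦ e'.1 (e.1.symm z)) (e.1 (e'.1.symm y))
      (e.D (e.1.symm (e.1 (e'.1.symm y))) (X (e.1.symm (e.1 (e'.1.symm y))))) := fun X ↦ by
    rw [fderiv_change _ _ (e.1.map_source hy')
      (by rw [e.1.left_inv hy']; exact e'.1.map_target hy), e.1.left_inv hy']
    simp [e.Dsymm_D hy']
  exact h X

lemma isInvertible_mfderiv_symm (e : Chart n M) {y : Euc n} (hy : y ∈ e.1.target) :
    (mfderiv 𝓘(ℝ, Euc n) 𝓘(ℝ, Euc n) e.1.symm y).IsInvertible :=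
  ⟨ContinuousLinearEquiv.equivOfInverse (e.Dsymm y) (e.D (e.1.symm y)) (e.D_Dsymm hy)
    (e.Dsymm_D' hy), rfl⟩

/-- This identifies the chart expression of a field with a pullback, so that smoothness and
naturality of the Lie bracket under pullback apply to it. -/
lemma mpullback_symm (e : Chart n M) (X : VField n M) {y : Euc n} (hy : y ∈ e.1.target) :
    VectorField.mpullback 𝓘(ℝ, Euc n) 𝓘(ℝ, Euc n) e.1.symm X y = e.vectorField X y := by
  have h : (e.Dsymm y).inverse = e.D (e.1.symm y) :=
    ContinuousLinearMap.inverse_eq (by ext1 v; exact e.Dsymm_D' hy v)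
      (by ext1 v; exact e.D_Dsymm hy v)
  exact DFunLike.congr_fun h _

end Chart

lemma formInChart_contr (e : Chart n M) (X : VField n M) (α : TotalForm n M) (k : ℕ) {y : Euc n}
    (hy : y ∈ e.1.target) : formInChart e.1 (contr X α k) y =
      (formInChart e.1 (α (k + 1)) y).curryLeft (e.vectorField X y) := by
  have h : ∀ (η : (Euc n) [⋀^Fin (k + 1)]→L[ℝ] ℝ) (v : Euc n),
      (η.curryLeft v).compContinuousLinearMap (e.Dsymm y) =
      (η.compContinuousLinearMap (e.Dsymm y)).curryLeft (e.D (e.1.symm y) v) := fun η v ↦ by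
    rw [ContinuousAlternatingMap.curryLeft_compContinuousLinearMap, e.Dsymm_D' hy]
  exact h _ _

end Manifold

end HigherCourant

/-! ### Smoothness and naturality of the Cartan operations -/

namespace HigherCourant

variable {n r : ℕ}

section Manifold

variable {M : Type*} [TopologicalSpace M] [ChartedSpace (Euc n) M] [IsManifold 𝓘(ℝ, Euc n) ∞ M]

lemma Chart.contDiffOn_vectorField (e : Chart n M) {X : VField n M} (hX : X ∈ smoothVField n M) :
    ContDiffOn ℝ ∞ (e.vectorField X) e.1.target := by
  intro y hy
  have h := ContMDiffAt.mpullback_vectorField_preimage (hX (e.1.symm y))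
    (e.contMDiffOn_symm.contMDiffAt (e.1.open_target.mem_nhds hy))
    (e.isInvertible_mfderiv_symm hy) (m := ∞) (by simp)
  refine ((contMDiffAt_vectorSpace_iff_contDiffAt.1 h).congr_of_eventuallyEq ?_).contDiffWithinAt
  filter_upwards [e.1.open_target.mem_nhds hy] with z hz
  exact (e.mpullback_symm X hz).symm

lemma three_le_infty : (3 : WithTop ℕ∞) ≤ ∞ :=
  WithTop.coe_le_coe.2 (le_top (a := (3 : ℕ∞)))

lemma mlieBracket_mem {X Y : VField n M} (hX : X ∈ smoothVField n M) (hY : Y ∈ smoothVField n M) :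
    VectorField.mlieBracket 𝓘(ℝ, Euc n) X Y ∈ smoothVField n M := by
  have : IsManifold 𝓘(ℝ, Euc n) (((⊤ : ℕ∞) : WithTop ℕ∞) + 1) M := ‹_›
  have : IsManifold 𝓘(ℝ, Euc n) (minSmoothness ℝ 2) M :=
    .of_le (n := ∞) (by simp [minSmoothness_of_isRCLikeNormedField, two_le_infty])
  have : IsManifold 𝓘(ℝ, Euc n) (minSmoothness ℝ 3) M :=
    .of_le (n := ∞) (by simpa [minSmoothness_of_isRCLikeNormedField] using three_le_infty)
  exact ContDiff.mlieBracket_vectorField (n := ⊤) (m := ⊤) hX hY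
    (by simp [minSmoothness_of_isRCLikeNormedField])

lemma Chart.vectorField_mlieBracket (e : Chart n M) {X Y : VField n M}
    (hX : X ∈ smoothVField n M) (hY : Y ∈ smoothVField n M) {y : Euc n} (hy : y ∈ e.1.target) :
    e.vectorField (VectorField.mlieBracket 𝓘(ℝ, Euc n) X Y) y =
      VectorField.lieBracket ℝ (e.vectorField X) (e.vectorField Y) y := by
  have : IsManifold 𝓘(ℝ, Euc n) (minSmoothness ℝ 3) M :=
    .of_le (n := ∞) (by simpa [minSmoothness_of_isRCLikeNormedField] using three_le_infty)
  have : IsManifold 𝓘(ℝ, Euc n) (minSmoothness ℝ 2) M :=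
    .of_le (n := ∞) (by simp [minSmoothness_of_isRCLikeNormedField, two_le_infty])
  rw [← e.mpullback_symm _ hy, VectorField.mpullback_mlieBracket (n := ∞)
    ((hX _).mdifferentiableAt (by simp)) ((hY _).mdifferentiableAt (by simp))
    (e.contMDiffOn_symm.contMDiffAt (e.1.open_target.mem_nhds hy))
    (by simp [minSmoothness_of_isRCLikeNormedField, two_le_infty])]
  have h : ∀ X : VField n M, VectorField.mpullback 𝓘(ℝ, Euc n) 𝓘(ℝ, Euc n) e.1.symm X =ᶠ[𝓝 y]
      e.vectorField X := fun X ↦ by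
    filter_upwards [e.1.open_target.mem_nhds hy] with z hz
    exact e.mpullback_symm X hz
  rw [Filter.EventuallyEq.mlieBracket_vectorField_eq (h X) (h Y)]
  exact congrFun (mlieBracket_eq_lieBracket _ _) y

lemma vcoord_mlieBracket (e : Chart n M) {X Y : VField n M}
    (hX : X ∈ smoothVField n M) (hY : Y ∈ smoothVField n M) {y : Euc n} (hy : y ∈ e.1.target)
    (i : Fin n) : vcoord e (VectorField.mlieBracket 𝓘(ℝ, Euc n) X Y) i y =
      coordLie (vcoord e X) (vcoord e Y) i y := by
  rw [Chart.vcoord_eq, e.vectorField_mlieBracket hX hY hy, VectorField.lieBracket, coordLie,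
    clm_apply_eq_sum, clm_apply_eq_sum (fderiv ℝ (e.vectorField X) y)]
  have h : ∀ {X}, X ∈ smoothVField n M → ∀ j v, fderiv ℝ (vcoord e X j) y v =
      fderiv ℝ (e.vectorField X) y v j := fun {X} hX j v ↦ by
    have hd : DifferentiableAt ℝ (e.vectorField X) y :=
      ((e.contDiffOn_vectorField hX).contDiffAt (e.1.open_target.mem_nhds hy)).differentiableAt
        (by simp)
    have := ((EuclideanSpace.proj (𝕜 := ℝ) j).hasFDerivAt.comp y hd.hasFDerivAt).fderiv
    exact DFunLike.congr_fun this v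
  simp [h hX, h hY, Chart.vcoord_eq]

lemma contDiffOn_vcoord (e : Chart n M) {X : VField n M} (hX : X ∈ smoothVField n M) (i : Fin n) :
    ContDiffOn ℝ ∞ (vcoord e X i) e.1.target :=
  (EuclideanSpace.proj (𝕜 := ℝ) i).contDiff.comp_contDiffOn (e.contDiffOn_vectorField hX)

/-- The preferred chart at a point, as a chart of the maximal atlas. -/
def Chart.at (x : M) : Chart n M := ⟨chartAt (Euc n) x, IsManifold.chart_mem_maximalAtlas x⟩

lemma eq_zero_of_vectorField_eq_zero {X : VField n M}
    (h : ∀ e : Chart n M, ∀ y ∈ e.1.target, e.vectorField X y = 0) : X = 0 := by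
  ext1 x
  have hx := mem_chart_source (Euc n) x
  have h' := h (Chart.at x) _ ((chartAt (Euc n) x).map_source hx)
  have key : ∀ X : M → Euc n, (Chart.at (n := n) x).D ((chartAt (Euc n) x).symm (chartAt (Euc n) x x))
      (X ((chartAt (Euc n) x).symm (chartAt (Euc n) x x))) = 0 → X x = 0 := fun X hX ↦ by
    rw [(chartAt (Euc n) x).left_inv hx] at hX
    rw [← (Chart.at x).Dsymm_D hx (X x), hX, map_zero]
  exact key X h'

lemma eq_zero_of_formInChart_eq_zero {k : ℕ} {η : Form n M k}
    (h : ∀ e : Chart n M, ∀ y ∈ e.1.target, formInChart e.1 η y = 0) : η = 0 := by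
  ext1 x
  have hx := mem_chart_source (Euc n) x
  have h' := h (Chart.at x) _ ((chartAt (Euc n) x).map_source hx)
  have key : ∀ η : M → (Euc n) [⋀^Fin k]→L[ℝ] ℝ,
      (η ((chartAt (Euc n) x).symm (chartAt (Euc n) x x))).compContinuousLinearMap
        ((Chart.at (n := n) x).Dsymm (chartAt (Euc n) x x)) = 0 → η x = 0 := fun η hη ↦ by
    rw [(chartAt (Euc n) x).left_inv hx] at hη
    ext v
    have := DFunLike.congr_fun hη fun i ↦ (Chart.at x).D x (v i)
    have hD : ∀ v, (Chart.at (n := n) x).Dsymm (chartAt (Euc n) x x) ((Chart.at x).D x v) = v :=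
      (Chart.at x).Dsymm_D hx
    simpa [Function.comp_def, hD] using this
  exact key η h'

/-- The definition of `extD` uses a different preferred chart at each point. Since the exterior
derivative commutes with pullback along the change of coordinates, every chart gives the same
answer. -/
lemma formInChart_extD (e : Chart n M) {k : ℕ} {η : Form n M k} (hη : η ∈ smoothForm n M k)
    {y : Euc n} (hy : y ∈ e.1.target) :
    formInChart e.1 (extD η) y = extDeriv (formInChart e.1 η) y := by
  set x := e.1.symm y with hx
  set c : Chart n M := Chart.at x
  have hc : x ∈ c.1.source := mem_chart_source _ _
  have hcd : DifferentiableAt ℝ (formInChart c.1 η) (c.1 x) :=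
    ((hη c).contDiffAt (c.1.open_target.mem_nhds (c.1.map_source hc))).differentiableAt (by simp)
  have hf : ContDiffAt ℝ ∞ (fun z ↦ c.1 (e.1.symm z)) y :=
    (Chart.contDiffOn_change e c).contDiffAt
      ((e.1.isOpen_inter_preimage_symm c.1.open_source).mem_nhds ⟨hy, hc⟩)
  have h : formInChart e.1 η =ᶠ[𝓝 y] fun z ↦ (formInChart c.1 η (c.1 (e.1.symm z))).compContinuousLinearMap
      (fderiv ℝ (fun z ↦ c.1 (e.1.symm z)) z) := by
    filter_upwards [(e.1.isOpen_inter_preimage_symm c.1.open_source).mem_nhds ⟨hy, hc⟩] with z hz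
    exact Chart.formInChart_change c e η hz.1 hz.2
  rw [h.extDeriv_eq, extDeriv_pullback (f := fun z ↦ c.1 (e.1.symm z)) hcd hf
    (by simp [minSmoothness_of_isRCLikeNormedField, two_le_infty]), Chart.fderiv_change e c hy hc]
  rfl

lemma contDiffOn_extDeriv {U : Set (Euc n)} (hU : IsOpen U) {k : ℕ}
    {η : Euc n → (Euc n) [⋀^Fin k]→L[ℝ] ℝ} (hη : ContDiffOn ℝ ∞ η U) :
    ContDiffOn ℝ ∞ (extDeriv η) U :=
  (ContinuousAlternatingMap.alternatizeUncurryFinCLM ℝ (Euc n) ℝ).contDiff.comp_contDiffOn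
    (hη.fderiv_of_isOpen hU (by simp))

lemma extD_mem {k : ℕ} {η : Form n M k} (hη : η ∈ smoothForm n M k) :
    extD η ∈ smoothForm n M (k + 1) := fun e ↦
  (contDiffOn_extDeriv e.1.open_target (hη e)).congr fun _ hy ↦ formInChart_extD e hη hy

lemma contr_mem {X : VField n M} (hX : X ∈ smoothVField n M) {α : TotalForm n M} {k : ℕ}
    (hα : α (k + 1) ∈ smoothForm n M (k + 1)) : contr X α k ∈ smoothForm n M k := fun e ↦ by
  refine ContDiffOn.congr ?_ fun _ hy ↦ formInChart_contr e X α k hy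
  have h : ContDiff ℝ ∞ fun η : (Euc n) [⋀^Fin (k + 1)]→L[ℝ] ℝ ↦ η.curryLeft :=
    IsBoundedLinearMap.contDiff
      ⟨⟨ContinuousAlternatingMap.curryLeft_add, ContinuousAlternatingMap.curryLeft_smul⟩, 1, one_pos,
        fun η ↦ by rw [ContinuousAlternatingMap.norm_curryLeft, one_mul]⟩
  exact ContDiffOn.clm_apply (h.comp_contDiffOn (hα e)) (e.contDiffOn_vectorField hX)

lemma deRham_mem {α : TotalForm n M} (hα : ∀ k, α k ∈ smoothForm n M k) (k : ℕ) :
    deRham α k ∈ smoothForm n M k := by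
  cases k with
  | zero => exact zero_mem _
  | succ k => exact extD_mem (hα k)

lemma lieD_mem {X : VField n M} (hX : X ∈ smoothVField n M) {α : TotalForm n M}
    (hα : ∀ k, α k ∈ smoothForm n M k) (k : ℕ) : lieD X α k ∈ smoothForm n M k :=
  add_mem (deRham_mem (fun k ↦ contr_mem hX (hα (k + 1))) k)
    (contr_mem hX (deRham_mem hα (k + 1)))

end Manifold

end HigherCourant

/-! ### The graded Lie algebra of functions on `T*[r]T[1]M` -/

namespace HigherCourant

variable {n r : ℕ}

section GradedLie

variable {V W : Type*} [AddCommGroup V] [Module ℝ V] [AddCommGroup W] [Module ℝ W]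

/-- The components `𝒢 i` and the bracket `br` form a graded Lie algebra. -/
structure IsGradedLie (𝒢 : ℤ → Submodule ℝ V) (br : V → V → V) : Prop where
  indep : iSupIndep 𝒢
  br_mem : ∀ i j, ∀ a ∈ 𝒢 i, ∀ b ∈ 𝒢 j, br a b ∈ 𝒢 (i + j)
  br_add_left : ∀ a ∈ ⨆ i, 𝒢 i, ∀ b ∈ ⨆ i, 𝒢 i, ∀ c ∈ ⨆ i, 𝒢 i,
    br (a + b) c = br a c + br b c
  br_add_right : ∀ a ∈ ⨆ i, 𝒢 i, ∀ b ∈ ⨆ i, 𝒢 i, ∀ c ∈ ⨆ i, 𝒢 i,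
    br a (b + c) = br a b + br a c
  br_smul_left : ∀ (c : ℝ), ∀ a ∈ ⨆ i, 𝒢 i, ∀ b ∈ ⨆ i, 𝒢 i, br (c • a) b = c • br a b
  br_smul_right : ∀ (c : ℝ), ∀ a ∈ ⨆ i, 𝒢 i, ∀ b ∈ ⨆ i, 𝒢 i, br a (c • b) = c • br a b
  skew : ∀ i j, ∀ a ∈ 𝒢 i, ∀ b ∈ 𝒢 j, br a b = -(((-1 : ℝ) ^ (i * j)) • br b a)
  jacobi : ∀ i j k, ∀ a ∈ 𝒢 i, ∀ b ∈ 𝒢 j, ∀ c ∈ 𝒢 k,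
    br a (br b c) = br (br a b) c + ((-1 : ℝ) ^ (i * j)) • br b (br a c)

namespace IsGradedLie

variable {𝒢 : ℤ → Submodule ℝ V} {br : V → V → V} (h : IsGradedLie 𝒢 br)
include h

lemma br_mem_iSup {i : ℤ} {a : V} (ha : a ∈ 𝒢 i) {c : V} (hc : c ∈ ⨆ i, 𝒢 i) :
    br a c ∈ ⨆ i, 𝒢 i := by
  have ha' := (le_iSup 𝒢 i) ha
  induction hc using Submodule.iSup_induction' with
  | mem j c hc => exact (le_iSup 𝒢 _) (h.br_mem i j a ha c hc)
  | zero =>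
    have := h.br_smul_right 0 a ha' 0 (zero_mem _)
    rw [zero_smul, zero_smul] at this
    rw [this]; exact zero_mem _
  | add c c' hc hc' ih ih' => rw [h.br_add_right a ha' c hc c' hc']; exact add_mem ih ih'

lemma br_zero_right {a : V} (ha : a ∈ ⨆ i, 𝒢 i) : br a 0 = 0 := by
  simpa using h.br_smul_right 0 a ha 0 (zero_mem _)

lemma br_zero_left {a : V} (ha : a ∈ ⨆ i, 𝒢 i) : br 0 a = 0 := by
  simpa using h.br_smul_left 0 0 (zero_mem _) a ha

lemma br_sum_right {a : V} (ha : a ∈ ⨆ i, 𝒢 i) {N : Type*} (s : Finset N) (f : N → V)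
    (hf : ∀ k ∈ s, f k ∈ ⨆ i, 𝒢 i) : br a (∑ k ∈ s, f k) = ∑ k ∈ s, br a (f k) := by
  classical
  induction s using Finset.induction_on with
  | empty => simpa using h.br_zero_right ha
  | insert k s hk ih =>
    rw [Finset.sum_insert hk, Finset.sum_insert hk, h.br_add_right a ha _ (hf k (by simp)) _
      (sum_mem fun j hj ↦ hf j (by simp [hj])), ih fun j hj ↦ hf j (by simp [hj])]

lemma br_sum_left {a : V} (ha : a ∈ ⨆ i, 𝒢 i) {N : Type*} (s : Finset N) (f : N → V)
    (hf : ∀ k ∈ s, f k ∈ ⨆ i, 𝒢 i) : br (∑ k ∈ s, f k) a = ∑ k ∈ s, br (f k) a := by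
  classical
  induction s using Finset.induction_on with
  | empty => simpa using h.br_zero_left ha
  | insert k s hk ih =>
    rw [Finset.sum_insert hk, Finset.sum_insert hk, h.br_add_left _ (hf k (by simp)) _
      (sum_mem fun j hj ↦ hf j (by simp [hj])) a ha, ih fun j hj ↦ hf j (by simp [hj])]

/-- The sign depends only on the first two degrees, so the last argument may be inhomogeneous. -/
lemma jacobi_right {i j : ℤ} {a b c : V} (ha : a ∈ 𝒢 i) (hb : b ∈ 𝒢 j) (hc : c ∈ ⨆ i, 𝒢 i) :
    br a (br b c) = br (br a b) c + ((-1 : ℝ) ^ (i * j)) • br b (br a c) := by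
  have ha' := (le_iSup 𝒢 i) ha
  have hb' := (le_iSup 𝒢 j) hb
  have hab := (le_iSup 𝒢 _) (h.br_mem i j a ha b hb)
  induction hc using Submodule.iSup_induction' with
  | mem k c hc => exact h.jacobi i j k a ha b hb c hc
  | zero => simp [h.br_zero_right ha', h.br_zero_right hb', h.br_zero_right hab]
  | add c c' hc hc' ih ih' =>
    rw [h.br_add_right b hb' c hc c' hc', h.br_add_right a ha' _ (h.br_mem_iSup hb hc) _
      (h.br_mem_iSup hb hc'), ih, ih', h.br_add_right _ hab c hc c' hc',
      h.br_add_right a ha' c hc c' hc', h.br_add_right b hb' _ (h.br_mem_iSup ha hc) _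
      (h.br_mem_iSup ha hc'), smul_add]
    abel

/-- An element of degree `1` with `{Θ, Θ} = 0` defines an inner differential. -/
theorem isDGLA {Θ : V} (hΘ : Θ ∈ 𝒢 1) (hΘΘ : br Θ Θ = 0) : IsDGLA 𝒢 (br Θ) br where
  indep := h.indep
  d_mem i a ha := by rw [add_comm]; exact h.br_mem 1 i Θ hΘ a ha
  d_add a ha b hb := h.br_add_right Θ ((le_iSup 𝒢 1) hΘ) a ha b hb
  d_smul c a ha := h.br_smul_right c Θ ((le_iSup 𝒢 1) hΘ) a ha
  br_mem := h.br_mem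
  br_add_left := h.br_add_left
  br_add_right := h.br_add_right
  br_smul_left := h.br_smul_left
  br_smul_right := h.br_smul_right
  d_d a ha := by
    -- For an odd `Θ` Jacobi reads `2 d(d a) = {{Θ, Θ}, a}`.
    have := h.jacobi_right hΘ hΘ ha
    rw [hΘΘ, h.br_zero_left ha, zero_add, mul_one, zpow_one, neg_smul, one_smul,
      eq_neg_iff_add_eq_zero, ← two_smul ℝ] at this
    exact (smul_eq_zero.1 this).resolve_left two_ne_zero
  leibniz i j a ha b hb := by
    have := h.jacobi 1 i j Θ hΘ a ha b hb
    rwa [one_mul] at this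
  skew := h.skew
  jacobi := h.jacobi

end IsGradedLie

end GradedLie

section Large

variable {M : Type*} [TopologicalSpace M] [ChartedSpace (Euc n) M]
  {F G H : Large n r M} {i j k : ℤ}

lemma largeBracket_apply (F G : Large n r M) {e : Chart n M} {y : Euc n} (hy : y ∈ e.1.target) :
    largeBracket F G e y = poisson (F e) (G e) y := by
  rw [largeBracket, if_pos hy]

lemma largeBracket_apply_of_notMem (F G : Large n r M) {e : Chart n M} {y : Euc n}
    (hy : y ∉ e.1.target) : largeBracket F G e y = 0 := by
  rw [largeBracket, if_neg hy]

lemma largeBracket_eventuallyEq (F G : Large n r M) {e : Chart n M} {y : Euc n}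
    (hy : y ∈ e.1.target) : largeBracket F G e =ᶠ[𝓝 y] poisson (F e) (G e) := by
  filter_upwards [e.1.open_target.mem_nhds hy] with z hz using largeBracket_apply F G hz

lemma homOn_of_mem_gLarge (hF : F ∈ gLarge n M r k) (e : Chart n M) :
    HomOn e.1.target (k + r) (F e) := ⟨hF.1 e, hF.2.1 e⟩

/-- The gluing condition is restated at points of the target chart, the form in which `push` and
`compat` are phrased. -/
lemma mem_gLarge_of_push (h1 : ∀ e : Chart n M, HomOn e.1.target (k + r) (F e))
    (h2 : ∀ e : Chart n M, ∀ y ∉ e.1.target, F e y = 0)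
    (h3 : ∀ e e' : Chart n M, ∀ y ∈ e'.1.target, e'.1.symm y ∈ e.1.source →
      CoordChange.push (fun y ↦ e'.1 (e.1.symm y)) (fun y ↦ e.1 (e'.1.symm y)) (F e) y = F e' y) :
    F ∈ gLarge n M r k := by
  refine ⟨fun e ↦ (h1 e).1, fun e ↦ (h1 e).2, h2, fun e e' y hy hy' ↦ ?_⟩
  have hc := Chart.coordChange e e'
  have hm := hc.maps y ⟨hy, hy'⟩
  have h := h3 e e' _ hm.1 hm.2
  rw [CoordChange.push, hc.left_inv y ⟨hy, hy'⟩] at h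
  exact h

lemma push_of_mem_gLarge (hF : F ∈ gLarge n M r k) (e e' : Chart n M) {y : Euc n}
    (hy : y ∈ e'.1.target) (hy' : e'.1.symm y ∈ e.1.source) :
    CoordChange.push (fun y ↦ e'.1 (e.1.symm y)) (fun y ↦ e.1 (e'.1.symm y)) (F e) y = F e' y := by
  have hc := Chart.coordChange e e'
  have hm := hc.maps' y ⟨hy, hy'⟩
  have h := hF.2.2.2 e e' _ hm.1 hm.2
  have hr := hc.right_inv y ⟨hy, hy'⟩
  refine Eq.trans h ?_
  exact congrArg (F e') hr

lemma largeBracket_mem (hF : F ∈ gLarge n M r i) (hG : G ∈ gLarge n M r j) :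
    largeBracket F G ∈ gLarge n M r (i + j) := by
  refine mem_gLarge_of_push (fun e ↦ ?_) (fun e y hy ↦ largeBracket_apply_of_notMem F G hy)
    fun e e' y hy hy' ↦ ?_
  · have := ((homOn_of_mem_gLarge hF e).poisson e.1.open_target (homOn_of_mem_gLarge hG e)).congr
      e.1.open_target fun y hy ↦ largeBracket_apply F G hy
    rwa [show i + r + (j + r) - r = i + j + r by ring] at this
  · have hc := Chart.coordChange e e'
    have hm := hc.maps' y ⟨hy, hy'⟩
    have h := hc.compat (r := r) ⟨hy, hy'⟩ (F := F e) (G := G e)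
      ((hF.1 e).mono Set.inter_subset_left) ((hG.1 e).mono Set.inter_subset_left)
    -- The bracket differentiates, so the local expressions must agree near `y` and not merely at
    -- `y`.
    have hpush : ∀ {F : Large n r M} {k : ℤ}, F ∈ gLarge n M r k →
        CoordChange.push (fun y ↦ e'.1 (e.1.symm y)) (fun y ↦ e.1 (e'.1.symm y)) (F e) =ᶠ[𝓝 y]
          F e' := fun hF ↦ by
      filter_upwards [hc.isOpen'.mem_nhds ⟨hy, hy'⟩] with z hz
      exact push_of_mem_gLarge hF e e' hz.1 hz.2
    rw [largeBracket_apply F G hy, ← poisson_congr (hpush hF) (hpush hG), h, CoordChange.push,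
      largeBracket_apply F G hm.1]

lemma largeBracket_skew (hF : F ∈ gLarge n M r i) (hG : G ∈ gLarge n M r j) :
    largeBracket F G = -(((-1 : ℝ) ^ (i * j)) • largeBracket G F) := by
  ext e y
  by_cases hy : y ∈ e.1.target
  · have := poisson_skew e.1.open_target (homOn_of_mem_gLarge hF e) (homOn_of_mem_gLarge hG e) hy
    rw [largeBracket_apply F G hy, this, Pi.neg_apply, Pi.neg_apply, Pi.smul_apply, Pi.smul_apply,
      largeBracket_apply G F hy, add_sub_cancel_right, add_sub_cancel_right]
  · simp [largeBracket_apply_of_notMem _ _ hy]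

lemma largeBracket_jacobi (hF : F ∈ gLarge n M r i) (hG : G ∈ gLarge n M r j)
    (hH : H ∈ gLarge n M r k) : largeBracket F (largeBracket G H) =
      largeBracket (largeBracket F G) H +
        ((-1 : ℝ) ^ (i * j)) • largeBracket G (largeBracket F H) := by
  ext e y
  by_cases hy : y ∈ e.1.target
  · have := poisson_jacobi e.1.open_target (homOn_of_mem_gLarge hF e) (homOn_of_mem_gLarge hG e)
      (homOn_of_mem_gLarge hH e) hy
    rw [add_sub_cancel_right, add_sub_cancel_right] at this
    rw [Pi.add_apply, Pi.add_apply, Pi.smul_apply, Pi.smul_apply, largeBracket_apply _ _ hy,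
      largeBracket_apply _ _ hy, largeBracket_apply _ _ hy,
      poisson_congr (.refl _ _) (largeBracket_eventuallyEq G H hy),
      poisson_congr (.refl _ _) (largeBracket_eventuallyEq F H hy),
      poisson_congr (largeBracket_eventuallyEq F G hy) (.refl _ _)]
    exact this
  · simp [largeBracket_apply_of_notMem _ _ hy]

lemma isSmoothOn_of_mem_iSup (hF : F ∈ ⨆ k, gLarge n M r k) (e : Chart n M) :
    IsSmoothOn (F e) e.1.target := by
  induction hF using Submodule.iSup_induction' with
  | mem k F hF => exact hF.1 e
  | zero => exact isSmoothOn_const _ 0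
  | add F G _ _ hF hG => exact hF.add hG

lemma eq_zero_of_mem_iSup (hF : F ∈ ⨆ k, gLarge n M r k) {e : Chart n M} {y : Euc n}
    (hy : y ∉ e.1.target) : F e y = 0 := by
  induction hF using Submodule.iSup_induction' with
  | mem k F hF => exact hF.2.2.1 e y hy
  | zero => rfl
  | add F G _ _ hF hG => simp [hF, hG]

/-- Smoothness of the summands matters: `partialX` has the default value `0` where no derivative
exists and is additive only where both derivatives do. -/
lemma largeBracket_add_left (hF : F ∈ ⨆ k, gLarge n M r k) (hG : G ∈ ⨆ k, gLarge n M r k) :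
    largeBracket (F + G) H = largeBracket F H + largeBracket G H := by
  ext e y
  by_cases hy : y ∈ e.1.target
  · have h : ∀ i, partialX (F e + G e) i y = partialX (F e) i y + partialX (G e) i y := fun i ↦
      (((isSmoothOn_of_mem_iSup hF e).hasPartialX hy i).add
        ((isSmoothOn_of_mem_iSup hG e).hasPartialX hy i)).partialX_eq
    simp only [Pi.add_apply, largeBracket_apply _ _ hy, poisson, h, map_add, add_mul, smul_add,
      ← Finset.sum_add_distrib]
    exact Finset.sum_congr rfl fun i _ ↦ by abel
  · simp [largeBracket_apply_of_notMem _ _ hy]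

lemma largeBracket_add_right (hF : F ∈ ⨆ k, gLarge n M r k) (hG : G ∈ ⨆ k, gLarge n M r k) :
    largeBracket H (F + G) = largeBracket H F + largeBracket H G := by
  ext e y
  by_cases hy : y ∈ e.1.target
  · have h : ∀ i, partialX (F e + G e) i y = partialX (F e) i y + partialX (G e) i y := fun i ↦
      (((isSmoothOn_of_mem_iSup hF e).hasPartialX hy i).add
        ((isSmoothOn_of_mem_iSup hG e).hasPartialX hy i)).partialX_eq
    simp only [Pi.add_apply, largeBracket_apply _ _ hy, poisson, h, map_add, mul_add, smul_add,
      ← Finset.sum_add_distrib]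
    exact Finset.sum_congr rfl fun i _ ↦ by abel
  · simp [largeBracket_apply_of_notMem _ _ hy]

lemma partialX_const_smul {F : Euc n → FibreAlg n r} {y : Euc n} {i : Fin n} {D : FibreAlg n r}
    (h : HasPartialX F i y D) (c : ℝ) : partialX (c • F) i y = c • D :=
  HasPartialX.partialX_eq (h.map (c • LinearMap.id))

lemma largeBracket_smul_left (c : ℝ) (hF : F ∈ ⨆ k, gLarge n M r k) :
    largeBracket (c • F) H = c • largeBracket F H := by
  ext e y
  by_cases hy : y ∈ e.1.target
  · have h : ∀ i, partialX (c • F e) i y = c • partialX (F e) i y := fun i ↦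
      partialX_const_smul ((isSmoothOn_of_mem_iSup hF e).hasPartialX hy i) c
    simp only [Pi.smul_apply, largeBracket_apply _ _ hy, poisson, h, map_smul, smul_mul_assoc,
      Finset.smul_sum, smul_add, smul_sub, smul_comm ((-1 : ℝ) ^ r) c]
  · simp [largeBracket_apply_of_notMem _ _ hy]

lemma largeBracket_smul_right (c : ℝ) (hF : F ∈ ⨆ k, gLarge n M r k) :
    largeBracket H (c • F) = c • largeBracket H F := by
  ext e y
  by_cases hy : y ∈ e.1.target
  · have h : ∀ i, partialX (c • F e) i y = c • partialX (F e) i y := fun i ↦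
      partialX_const_smul ((isSmoothOn_of_mem_iSup hF e).hasPartialX hy i) c
    simp only [Pi.smul_apply, largeBracket_apply _ _ hy, poisson, h, map_smul, mul_smul_comm,
      Finset.smul_sum, smul_add, smul_sub, smul_comm ((-1 : ℝ) ^ r) c]
  · simp [largeBracket_apply_of_notMem _ _ hy]

lemma iSupIndep_gLarge : iSupIndep (gLarge n M r) := by
  refine iSupIndep_of_proj (fun k ↦
    { toFun := fun F e y ↦ degreeProj n r (k + r) (F e y)
      map_add' := fun F G ↦ by ext; simp
      map_smul' := fun c F ↦ by ext; simp }) (fun i F hF ↦ ?_) fun i j hij F hF ↦ ?_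
  · ext e y
    by_cases hy : y ∈ e.1.target
    · simp [degreeProj_of_mem (hF.2.1 e y hy)]
    · simp [hF.2.2.1 e y hy]
  · ext e y
    by_cases hy : y ∈ e.1.target
    · simp [degreeProj_of_mem (hF.2.1 e y hy), hij.symm]
    · simp [hF.2.2.1 e y hy]

variable (n r M) in
theorem isGradedLie_gLarge : IsGradedLie (gLarge n M r) largeBracket where
  indep := iSupIndep_gLarge
  br_mem _ _ _ ha _ hb := largeBracket_mem ha hb
  br_add_left _ ha _ hb _ _ := largeBracket_add_left ha hb
  br_add_right _ _ _ hb _ hc := largeBracket_add_right hb hc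
  br_smul_left c _ ha _ _ := largeBracket_smul_left c ha
  br_smul_right c _ _ _ hb := largeBracket_smul_right c hb
  skew _ _ _ ha _ hb := largeBracket_skew ha hb
  jacobi _ _ _ _ ha _ hb _ hc := largeBracket_jacobi ha hb hc

end Large

end HigherCourant

/-! ### The images of vector fields and forms, and their brackets -/

namespace HigherCourant

variable {n r : ℕ}

section Large

variable {M : Type*} [TopologicalSpace M] [ChartedSpace (Euc n) M]

lemma canonicalS_apply {e : Chart n M} {y : Euc n} (hy : y ∈ e.1.target) :
    canonicalS n r M e y = polyS n r := by rw [canonicalS, if_pos hy]; rfl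

lemma formFun_apply {k : ℕ} (α : Form n M k) {e : Chart n M} {y : Euc n} (hy : y ∈ e.1.target) :
    formFun r α e y = altPoly r (formInChart e.1 α y) := by rw [formFun, if_pos hy]; rfl

open Classical in
/-- The fibrewise linear function `Xⁱ pᵢ` of a vector field. -/
noncomputable def vecFun (r : ℕ) (X : VField n M) : Large n r M := fun e y ↦
  if y ∈ e.1.target then vecP r (vcoord e X) y else 0

lemma vecFun_apply (X : VField n M) {e : Chart n M} {y : Euc n} (hy : y ∈ e.1.target) :
    vecFun r X e y = vecP r (vcoord e X) y := by rw [vecFun, if_pos hy]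

variable (M) in
lemma canonicalS_mem : canonicalS n r M ∈ gLarge n M r 1 := by
  refine mem_gLarge_of_push (fun e ↦ ?_) (fun e y hy ↦ by rw [canonicalS, if_neg hy])
    fun e e' y hy hy' ↦ ?_
  · rw [add_comm]
    exact (homOn_polyS _).congr e.1.open_target fun y hy ↦ canonicalS_apply hy
  · have hc := Chart.coordChange e e'
    rw [CoordChange.push, canonicalS_apply (hc.maps' y ⟨hy, hy'⟩).1, hc.fibreChange_polyS ⟨hy, hy'⟩,
      canonicalS_apply hy]

lemma formFun_mem {k : ℕ} {α : Form n M k} (hα : α ∈ smoothForm n M k) :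
    formFun r α ∈ gLarge n M r (k - r) := by
  refine mem_gLarge_of_push (fun e ↦ ?_) (fun e y hy ↦ by rw [formFun, if_neg hy])
    fun e e' y hy hy' ↦ ?_
  · rw [sub_add_cancel]
    exact (homOn_altPoly e.1.open_target (hα e)).congr e.1.open_target fun y hy ↦ formFun_apply α hy
  · have hc := Chart.coordChange e e'
    rw [CoordChange.push, formFun_apply α (hc.maps' y ⟨hy, hy'⟩).1, formFun_apply α hy,
      fibreChange_altPoly (A := fderiv ℝ (fun z ↦ e.1 (e'.1.symm z)) y),
      Chart.formInChart_change e e' α hy hy']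
    intro i j
    rw [hc.right_inv y ⟨hy, hy'⟩, jacobian]

/-- An inhomogeneous form is a family indexed by all natural numbers; components above the dimension
vanish, so finite sums suffice. -/
lemma formFun_eq_zero_of_lt {k : ℕ} (hk : n < k) (α : Form n M k) : formFun r α = 0 := by
  ext e y
  by_cases hy : y ∈ e.1.target
  · rw [formFun_apply α hy, alternatingMap_eq_zero_of_lt hk (formInChart e.1 α y), altPoly_zero]; rfl
  · rw [formFun, if_neg hy]; rfl

lemma canonicalS_eventuallyEq {e : Chart n M} {y : Euc n} (hy : y ∈ e.1.target) :
    canonicalS n r M e =ᶠ[𝓝 y] fun _ ↦ polyS n r := by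
  filter_upwards [e.1.open_target.mem_nhds hy] with z hz using canonicalS_apply hz

lemma formFun_eventuallyEq {k : ℕ} (α : Form n M k) {e : Chart n M} {y : Euc n}
    (hy : y ∈ e.1.target) : formFun r α e =ᶠ[𝓝 y] fun y ↦ altPoly r (formInChart e.1 α y) := by
  filter_upwards [e.1.open_target.mem_nhds hy] with z hz using formFun_apply α hz

lemma vecFun_eventuallyEq (X : VField n M) {e : Chart n M} {y : Euc n}
    (hy : y ∈ e.1.target) : vecFun r X e =ᶠ[𝓝 y] vecP r (vcoord e X) := by
  filter_upwards [e.1.open_target.mem_nhds hy] with z hz using vecFun_apply X hz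

lemma large_ext {F G : Large n r M} (h : ∀ e : Chart n M, ∀ y ∈ e.1.target, F e y = G e y)
    (hF : F ∈ ⨆ k, gLarge n M r k) (hG : G ∈ ⨆ k, gLarge n M r k) : F = G := by
  ext e y
  by_cases hy : y ∈ e.1.target
  · exact h e y hy
  · rw [eq_zero_of_mem_iSup hF hy, eq_zero_of_mem_iSup hG hy]

lemma mem_iSup_gLarge {F : Large n r M} {k : ℤ} (hF : F ∈ gLarge n M r k) :
    F ∈ ⨆ k, gLarge n M r k := le_iSup (gLarge n M r) k hF

lemma largeBracket_canonicalS_canonicalS :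
    largeBracket (canonicalS n r M) (canonicalS n r M) = 0 := by
  refine large_ext (fun e y hy ↦ ?_) (mem_iSup_gLarge (largeBracket_mem (canonicalS_mem M)
    (canonicalS_mem M))) (zero_mem _)
  rw [largeBracket_apply _ _ hy,
    poisson_congr (canonicalS_eventuallyEq hy) (canonicalS_eventuallyEq hy), poisson_S_S]
  rfl

lemma largeBracket_formFun_formFun {k l : ℕ} {α : Form n M k} {β : Form n M l}
    (hα : α ∈ smoothForm n M k) (hβ : β ∈ smoothForm n M l) :
    largeBracket (formFun r α) (formFun r β) = 0 := by
  refine large_ext (fun e y hy ↦ ?_) (mem_iSup_gLarge (largeBracket_mem (formFun_mem hα)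
    (formFun_mem hβ))) (zero_mem _)
  rw [largeBracket_apply _ _ hy,
    poisson_congr (formFun_eventuallyEq α hy) (formFun_eventuallyEq β hy), poisson_altPoly_altPoly]
  rfl

lemma largeBracket_canonicalS_largeBracket {F : Large n r M} (hF : F ∈ ⨆ k, gLarge n M r k) :
    largeBracket (canonicalS n r M) (largeBracket (canonicalS n r M) F) = 0 :=
  ((isGradedLie_gLarge n r M).isDGLA (canonicalS_mem M) largeBracket_canonicalS_canonicalS).d_d F hF

variable [IsManifold 𝓘(ℝ, Euc n) ∞ M]

lemma vecFun_mem {X : VField n M} (hX : X ∈ smoothVField n M) :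
    vecFun r X ∈ gLarge n M r (-1) := by
  refine mem_gLarge_of_push (fun e ↦ ?_) (fun e y hy ↦ by rw [vecFun, if_neg hy])
    fun e e' y hy hy' ↦ ?_
  · rw [neg_add_eq_sub]
    exact (homOn_vecP e.1.open_target (contDiffOn_vcoord e hX)).congr e.1.open_target
      fun y hy ↦ vecFun_apply X hy
  · have hc := Chart.coordChange e e'
    rw [CoordChange.push, vecFun_apply X (hc.maps' y ⟨hy, hy'⟩).1, vecFun_apply X hy]
    simp only [vecP, map_sum, map_smul, CoordChange.fibreChange_p]
    simp only [Finset.smul_sum, smul_smul]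
    rw [Finset.sum_comm]
    refine Finset.sum_congr rfl fun i _ ↦ ?_
    rw [Chart.vcoord_eq e', Chart.vectorField_change e e' X hy hy', clm_apply_eq_sum,
      ← Finset.sum_smul]
    congr 1
    simp [CoordChange.coordVec, jacobian, Chart.vcoord_eq]

lemma differentiableAt_vcoord (e : Chart n M) {X : VField n M} (hX : X ∈ smoothVField n M)
    {y : Euc n} (hy : y ∈ e.1.target) (i : Fin n) : DifferentiableAt ℝ (vcoord e X i) y :=
  ((contDiffOn_vcoord e hX i).contDiffAt (e.1.open_target.mem_nhds hy)).differentiableAt (by simp)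

lemma largeBracket_canonicalS_formFun {k : ℕ} {α : Form n M k} (hα : α ∈ smoothForm n M k) :
    largeBracket (canonicalS n r M) (formFun r α) = formFun r (extD α) := by
  refine large_ext (fun e y hy ↦ ?_) (mem_iSup_gLarge (largeBracket_mem (canonicalS_mem M)
    (formFun_mem hα))) (mem_iSup_gLarge (formFun_mem (extD_mem hα)))
  rw [largeBracket_apply _ _ hy,
    poisson_congr (canonicalS_eventuallyEq hy) (formFun_eventuallyEq α hy), poisson_S_altPoly
    (((hα e).contDiffAt (e.1.open_target.mem_nhds hy)).differentiableAt (by simp)),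
    formFun_apply _ hy, formInChart_extD e hα hy]

lemma largeBracket_vecFun_vecFun {X Y : VField n M} (hX : X ∈ smoothVField n M)
    (hY : Y ∈ smoothVField n M) : largeBracket (vecFun r X) (vecFun r Y) = 0 := by
  refine large_ext (fun e y hy ↦ ?_) (mem_iSup_gLarge (largeBracket_mem (vecFun_mem hX)
    (vecFun_mem hY))) (zero_mem _)
  rw [largeBracket_apply _ _ hy,
    poisson_congr (vecFun_eventuallyEq X hy) (vecFun_eventuallyEq Y hy), poisson_vecP_vecP]
  rfl

lemma largeBracket_vecFun_formFun {X : VField n M} (hX : X ∈ smoothVField n M)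
    {α : TotalForm n M} {k : ℕ} (hα : α (k + 1) ∈ smoothForm n M (k + 1)) :
    largeBracket (vecFun r X) (formFun r (α (k + 1))) = formFun r (contr X α k) := by
  refine large_ext (fun e y hy ↦ ?_) (mem_iSup_gLarge (largeBracket_mem (vecFun_mem hX)
    (formFun_mem hα))) (mem_iSup_gLarge (formFun_mem (contr_mem hX hα)))
  rw [largeBracket_apply _ _ hy,
    poisson_congr (vecFun_eventuallyEq X hy) (formFun_eventuallyEq _ hy),
    poisson_vecP_altPoly (w := e.vectorField X y) fun i ↦ rfl,
    formFun_apply _ hy, formInChart_contr e X α k hy]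

lemma largeBracket_vecFun_formFun_zero {X : VField n M} (hX : X ∈ smoothVField n M)
    {α : Form n M 0} (hα : α ∈ smoothForm n M 0) :
    largeBracket (vecFun r X) (formFun r α) = 0 := by
  refine large_ext (fun e y hy ↦ ?_) (mem_iSup_gLarge (largeBracket_mem (vecFun_mem hX)
    (formFun_mem hα))) (zero_mem _)
  rw [largeBracket_apply _ _ hy,
    poisson_congr (vecFun_eventuallyEq X hy) (formFun_eventuallyEq _ hy),
    poisson_vecP_altPoly_zero]
  rfl

/-- The function `Yⁱ Pᵢ + (∂Yⁱ/∂xʲ) vʲ pᵢ` of a vector field. -/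
noncomputable def lieFun (r : ℕ) (Y : VField n M) : Large n r M :=
  largeBracket (canonicalS n r M) (vecFun r Y)

lemma lieFun_apply {Y : VField n M} (hY : Y ∈ smoothVField n M) {e : Chart n M} {y : Euc n}
    (hy : y ∈ e.1.target) : lieFun r Y e y = vecL r (vcoord e Y) y := by
  rw [lieFun, largeBracket_apply _ _ hy,
    poisson_congr (canonicalS_eventuallyEq hy) (vecFun_eventuallyEq Y hy),
    poisson_S_vecP (differentiableAt_vcoord e hY hy)]

lemma lieFun_mem {Y : VField n M} (hY : Y ∈ smoothVField n M) : lieFun r Y ∈ gLarge n M r 0 := by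
  have := largeBracket_mem (canonicalS_mem M) (vecFun_mem (r := r) hY)
  rwa [add_neg_cancel] at this

lemma largeBracket_lieFun_vecFun {X Y : VField n M} (hX : X ∈ smoothVField n M)
    (hY : Y ∈ smoothVField n M) : largeBracket (lieFun r Y) (vecFun r X) =
      vecFun r (VectorField.mlieBracket 𝓘(ℝ, Euc n) Y X) := by
  refine large_ext (fun e y hy ↦ ?_) (mem_iSup_gLarge (largeBracket_mem (lieFun_mem hY)
    (vecFun_mem hX))) (mem_iSup_gLarge (vecFun_mem (mlieBracket_mem hY hX)))
  have hL : lieFun r Y e =ᶠ[𝓝 y] vecL r (vcoord e Y) := by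
    filter_upwards [e.1.open_target.mem_nhds hy] with z hz using lieFun_apply hY hz
  rw [largeBracket_apply _ _ hy, poisson_congr hL (vecFun_eventuallyEq _ hy),
    poisson_vecL_vecP (differentiableAt_vcoord e hX hy), vecFun_apply _ hy]
  simp only [vecP, vcoord_mlieBracket e hY hX hy]

lemma largeBracket_vecFun_lieFun {X Y : VField n M} (hX : X ∈ smoothVField n M)
    (hY : Y ∈ smoothVField n M) : largeBracket (vecFun r X) (lieFun r Y) =
      -vecFun r (VectorField.mlieBracket 𝓘(ℝ, Euc n) Y X) := by
  rw [largeBracket_skew (vecFun_mem hX) (lieFun_mem hY), largeBracket_lieFun_vecFun hX hY, mul_zero,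
    zpow_zero, one_smul]

/-- Since `{L_X, 𝒮} = 0`, the derivation `{L_X, -}` passes through the bracket with `𝒮` and acts on
`i_Y`, giving `{𝒮, i_[X,Y]}`. -/
lemma largeBracket_lieFun_lieFun {X Y : VField n M} (hX : X ∈ smoothVField n M)
    (hY : Y ∈ smoothVField n M) : largeBracket (lieFun r X) (lieFun r Y) =
      lieFun r (VectorField.mlieBracket 𝓘(ℝ, Euc n) X Y) := by
  have h := largeBracket_jacobi (lieFun_mem (r := r) hX) (canonicalS_mem M) (vecFun_mem hY)
  have h0 : largeBracket (lieFun r X) (canonicalS n r M) = 0 := by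
    rw [largeBracket_skew (lieFun_mem hX) (canonicalS_mem M), lieFun,
      largeBracket_canonicalS_largeBracket (mem_iSup_gLarge (vecFun_mem hX)), smul_zero, neg_zero]
  rw [h0, (isGradedLie_gLarge n r M).br_zero_left (mem_iSup_gLarge (vecFun_mem hY)), zero_add,
    zero_mul, zpow_zero, one_smul, largeBracket_lieFun_vecFun hY hX] at h
  exact h

/-- Jacobi for `𝒮` and `i_Y`, of degrees `1` and `-1`. On forms, where `{𝒮, -}` is `d` and `{i_Y,
-}` is contraction, this is Cartan's formula. -/
lemma largeBracket_lieFun {Y : VField n M} (hY : Y ∈ smoothVField n M) {F : Large n r M}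
    (hF : F ∈ ⨆ k, gLarge n M r k) : largeBracket (lieFun r Y) F =
      largeBracket (canonicalS n r M) (largeBracket (vecFun r Y) F) +
        largeBracket (vecFun r Y) (largeBracket (canonicalS n r M) F) := by
  have h := (isGradedLie_gLarge n r M).jacobi_right (canonicalS_mem M) (vecFun_mem hY) hF
  rw [show (1 : ℤ) * -1 = -1 by ring, zpow_neg_one, inv_neg, inv_one, neg_smul, one_smul] at h
  rw [h, add_assoc, neg_add_cancel, add_zero]
  rfl

end Large

end HigherCourant

/-! ### Pulling back the axioms, and reading off coefficients -/

namespace HigherCourant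

variable {n r : ℕ}

section Transport

variable {V W : Type*} [AddCommGroup V] [Module ℝ V] [AddCommGroup W] [Module ℝ W]

/-- The preimage of a submodule under a map that is linear on the submodule `T`. -/
def comapOn (T : Submodule ℝ V) (Φ : V → W) (add : ∀ a ∈ T, ∀ b ∈ T, Φ (a + b) = Φ a + Φ b)
    (smul : ∀ (c : ℝ), ∀ a ∈ T, Φ (c • a) = c • Φ a) (K : Submodule ℝ W) : Submodule ℝ V where
  carrier := {a | a ∈ T ∧ Φ a ∈ K}
  add_mem' := fun {a b} ha hb ↦ ⟨add_mem ha.1 hb.1, by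
    rw [add a ha.1 b hb.1]; exact add_mem ha.2 hb.2⟩
  zero_mem' := ⟨zero_mem _, by
    have := smul 0 0 (zero_mem _)
    rw [zero_smul, zero_smul] at this
    rw [this]; exact zero_mem _⟩
  smul_mem' := fun c a ha ↦ ⟨Submodule.smul_mem _ c ha.1, by
    rw [smul c a ha.1]; exact Submodule.smul_mem _ c ha.2⟩

/-- The axioms of a differential graded Lie algebra can be checked after an injective morphism. -/
theorem IsDGLA.of_injective {𝒢 : ℤ → Submodule ℝ V} {d : V → V} {br : V → V → V}
    {ℋ : ℤ → Submodule ℝ W} {d' : W → W} {br' : W → W → W} (h : IsDGLA ℋ d' br')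
    (T : Submodule ℝ V) (Φ : V → W) (add : ∀ a ∈ T, ∀ b ∈ T, Φ (a + b) = Φ a + Φ b)
    (smul : ∀ (c : ℝ), ∀ a ∈ T, Φ (c • a) = c • Φ a) (inj : ∀ a ∈ T, Φ a = 0 → a = 0)
    (mem_iff : ∀ i a, a ∈ 𝒢 i ↔ a ∈ T ∧ Φ a ∈ ℋ i) (d_mem : ∀ a ∈ T, d a ∈ T)
    (br_mem : ∀ a ∈ T, ∀ b ∈ T, br a b ∈ T) (map_d : ∀ a ∈ T, Φ (d a) = d' (Φ a))
    (map_br : ∀ a ∈ T, ∀ b ∈ T, Φ (br a b) = br' (Φ a) (Φ b)) : IsDGLA 𝒢 d br := by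
  have hT : ∀ {i a}, a ∈ 𝒢 i → a ∈ T := fun ha ↦ ((mem_iff _ _).1 ha).1
  have hΦ : ∀ {i a}, a ∈ 𝒢 i → Φ a ∈ ℋ i := fun ha ↦ ((mem_iff _ _).1 ha).2
  have hs : ⨆ i, 𝒢 i ≤ comapOn T Φ add smul (⨆ i, ℋ i) :=
    iSup_le fun i a ha ↦ ⟨hT ha, le_iSup ℋ i (hΦ ha)⟩
  have ext : ∀ {a b}, a ∈ T → b ∈ T → Φ a = Φ b → a = b := fun {a b} ha hb hab ↦ by
    have hb' := Submodule.smul_mem T (-1 : ℝ) hb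
    have := inj (a + (-1 : ℝ) • b) (add_mem ha hb') (by
      rw [add a ha _ hb', smul (-1) b hb, hab, neg_smul, one_smul, add_neg_cancel])
    rwa [neg_smul, one_smul, add_neg_eq_zero] at this
  refine ⟨?_, ?_, ?_, ?_, ?_, ?_, ?_, ?_, ?_, ?_, ?_, ?_, ?_⟩
  · intro i
    rw [Submodule.disjoint_def]
    intro x hx hx'
    -- Independence transfers because `Φ` carries the sum of the other components into the
    -- corresponding sum of the `ℋ j`, and it has trivial kernel on `T`.
    have hle : ⨆ j, ⨆ (_ : j ≠ i), 𝒢 j ≤ comapOn T Φ add smul (⨆ j, ⨆ (_ : j ≠ i), ℋ j) :=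
      iSup₂_le fun j hj a ha ↦ ⟨hT ha, Submodule.mem_iSup_of_mem j
        (Submodule.mem_iSup_of_mem hj (hΦ ha))⟩
    exact inj x (hT hx) (Submodule.disjoint_def.1 (h.indep i) _ (hΦ hx) (hle hx').2)
  · intro i a ha
    rw [mem_iff, map_d a (hT ha)]
    exact ⟨d_mem a (hT ha), h.d_mem i _ (hΦ ha)⟩
  · intro a ha b hb
    obtain ⟨ha, ha'⟩ := hs ha
    obtain ⟨hb, hb'⟩ := hs hb
    refine ext (d_mem _ (add_mem ha hb)) (add_mem (d_mem a ha) (d_mem b hb)) ?_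
    rw [map_d _ (add_mem ha hb), add a ha b hb, h.d_add _ ha' _ hb', add _ (d_mem a ha) _ (d_mem b hb),
      map_d a ha, map_d b hb]
  · intro c a ha
    obtain ⟨ha, ha'⟩ := hs ha
    have hc := T.smul_mem c ha
    refine ext (d_mem _ hc) (T.smul_mem c (d_mem a ha)) ?_
    rw [map_d _ hc, smul c a ha, h.d_smul c _ ha', smul c _ (d_mem a ha), map_d a ha]
  · intro i j a ha b hb
    rw [mem_iff, map_br a (hT ha) b (hT hb)]
    exact ⟨br_mem a (hT ha) b (hT hb), h.br_mem i j _ (hΦ ha) _ (hΦ hb)⟩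
  · intro a ha b hb c hc
    obtain ⟨ha, ha'⟩ := hs ha
    obtain ⟨hb, hb'⟩ := hs hb
    obtain ⟨hc, hc'⟩ := hs hc
    refine ext (br_mem _ (add_mem ha hb) c hc) (add_mem (br_mem a ha c hc) (br_mem b hb c hc)) ?_
    rw [map_br _ (add_mem ha hb) c hc, add a ha b hb, h.br_add_left _ ha' _ hb' _ hc',
      add _ (br_mem a ha c hc) _ (br_mem b hb c hc), map_br a ha c hc, map_br b hb c hc]
  · intro a ha b hb c hc
    obtain ⟨ha, ha'⟩ := hs ha
    obtain ⟨hb, hb'⟩ := hs hb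
    obtain ⟨hc, hc'⟩ := hs hc
    refine ext (br_mem a ha _ (add_mem hb hc)) (add_mem (br_mem a ha b hb) (br_mem a ha c hc)) ?_
    rw [map_br a ha _ (add_mem hb hc), add b hb c hc, h.br_add_right _ ha' _ hb' _ hc',
      add _ (br_mem a ha b hb) _ (br_mem a ha c hc), map_br a ha b hb, map_br a ha c hc]
  · intro c a ha b hb
    obtain ⟨ha, ha'⟩ := hs ha
    obtain ⟨hb, hb'⟩ := hs hb
    have hc := T.smul_mem c ha
    refine ext (br_mem _ hc b hb) (T.smul_mem c (br_mem a ha b hb)) ?_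
    rw [map_br _ hc b hb, smul c a ha, h.br_smul_left c _ ha' _ hb', smul c _ (br_mem a ha b hb),
      map_br a ha b hb]
  · intro c a ha b hb
    obtain ⟨ha, ha'⟩ := hs ha
    obtain ⟨hb, hb'⟩ := hs hb
    have hc := T.smul_mem c hb
    refine ext (br_mem a ha _ hc) (T.smul_mem c (br_mem a ha b hb)) ?_
    rw [map_br a ha _ hc, smul c b hb, h.br_smul_right c _ ha' _ hb', smul c _ (br_mem a ha b hb),
      map_br a ha b hb]
  · intro a ha
    obtain ⟨ha, ha'⟩ := hs ha
    refine inj _ (d_mem _ (d_mem a ha)) ?_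
    rw [map_d _ (d_mem a ha), map_d a ha, h.d_d _ ha']
  · intro i j a ha b hb
    have h1 := d_mem _ (hT ha)
    have h2 := d_mem _ (hT hb)
    have h3 := br_mem _ (hT ha) _ h2
    have h4 := br_mem a (hT ha) b (hT hb)
    have h5 := br_mem _ h1 b (hT hb)
    refine ext (d_mem _ h4) (add_mem h5 (T.smul_mem _ h3)) ?_
    rw [map_d _ h4, map_br a (hT ha) b (hT hb), h.leibniz i j _ (hΦ ha) _ (hΦ hb),
      add _ h5 _ (T.smul_mem _ h3), smul _ _ h3, map_br _ h1 b (hT hb), map_br a (hT ha) _ h2,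
      map_d a (hT ha), map_d b (hT hb)]
  · intro i j a ha b hb
    have h1 := br_mem a (hT ha) b (hT hb)
    have h2 := br_mem b (hT hb) a (hT ha)
    rw [← neg_smul]
    refine ext h1 (T.smul_mem _ h2) ?_
    rw [map_br a (hT ha) b (hT hb), h.skew i j _ (hΦ ha) _ (hΦ hb), smul _ _ h2,
      map_br b (hT hb) a (hT ha), neg_smul]
  · intro i j k a ha b hb c hc
    have h1 := br_mem b (hT hb) c (hT hc)
    have h2 := br_mem a (hT ha) b (hT hb)
    have h3 := br_mem a (hT ha) c (hT hc)
    have h4 := br_mem _ h2 c (hT hc)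
    have h5 := br_mem b (hT hb) _ h3
    refine ext (br_mem a (hT ha) _ h1) (add_mem h4 (T.smul_mem _ h5)) ?_
    rw [map_br a (hT ha) _ h1, map_br b (hT hb) c (hT hc),
      h.jacobi i j k _ (hΦ ha) _ (hΦ hb) _ (hΦ hc), add _ h4 _ (T.smul_mem _ h5), smul _ _ h5,
      map_br _ h2 c (hT hc), map_br a (hT ha) b (hT hb), map_br b (hT hb) _ h3,
      map_br a (hT ha) c (hT hc)]

end Transport

namespace FibreAlg

lemma aug_eq_zero {m : ℤ} (hm : m ≠ 0) {x : FibreAlg n r} (hx : x ∈ degree n r m) :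
    aug n r x = 0 := by
  induction hx using degree_induction with
  | hm l hl =>
    cases l with
    | nil => exact absurd hl.symm (by simpa [monDeg] using hm)
    | cons a l => simp [mon]
  | hadd x y _ _ hx hy => rw [map_add, hx, hy, add_zero]
  | hsmul c x _ hx => rw [map_smul, hx, smul_zero]
  | h0 => exact map_zero _

/-- The substitution `p = 0`, `P = 0`. -/
noncomputable def formPart (n r : ℕ) : FibreAlg n r →ₐ[ℝ] FibreAlg n r :=
  lift (fun a ↦ match a with
    | .v i => var r (.v i)
    | .p _ => 0
    | .P _ => 0) fun a b ↦ by
    rcases a with i | i | i <;> rcases b with j | j | j <;> simp only [mul_zero, zero_mul, smul_zero]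
    exact var_mul_var _ _

@[simp] lemma formPart_v (i : Fin n) : formPart n r (var r (.v i)) = var r (.v i) := lift_var ..
@[simp] lemma formPart_p (i : Fin n) : formPart n r (var r (.p i)) = 0 := lift_var ..
@[simp] lemma formPart_P (i : Fin n) : formPart n r (var r (.P i)) = 0 := lift_var ..

lemma formPart_mem_degree {m : ℤ} {x : FibreAlg n r} (hx : x ∈ degree n r m) :
    formPart n r x ∈ degree n r m :=
  algHom_mem_degree _ (fun a ↦ by
    rcases a with i | i | i
    · rw [formPart_v]; exact var_mem_degree _
    · rw [formPart_p]; exact zero_mem _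
    · rw [formPart_P]; exact zero_mem _) hx

lemma formPart_altPoly {k : ℕ} (η : (Euc n) [⋀^Fin k]→L[ℝ] ℝ) :
    formPart n r (altPoly r η) = altPoly r η := by
  simp [altPoly, map_list_prod, List.map_ofFn, Function.comp_def]

lemma formPart_vecP (X : Fin n → Euc n → ℝ) (y : Euc n) : formPart n r (vecP r X y) = 0 := by
  simp [vecP]

lemma formPart_vecL (X : Fin n → Euc n → ℝ) (y : Euc n) : formPart n r (vecL r X y) = 0 := by
  simp [vecL]

/-- The derivative in `pᵢ` leaves only multiples of the `vʲ`, which vanish on the zero section. So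
`aug` after `∂/∂pᵢ` sees the field of degree `-1` alone, and after `∂/∂Pᵢ` the field of degree `0`
alone, for every `r`, even when degrees of generators coincide. -/
lemma aug_leftPartial_p_vecL (X : Fin n → Euc n → ℝ) (y : Euc n) (i : Fin n) :
    aug n r (leftPartial (.p i) (vecL r X y)) = 0 := by
  simp [vecL, leftPartial_var_mul_var]

lemma aug_leftPartial_P_vecL (X : Fin n → Euc n → ℝ) (y : Euc n) (i : Fin n) :
    aug n r (leftPartial (.P i) (vecL r X y)) = X i y := by
  simp [vecL, leftPartial_var_mul_var]

end FibreAlg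

end HigherCourant

/-! ### The morphism from the small to the large algebra -/

namespace HigherCourant

variable {n r : ℕ} {M : Type*} [TopologicalSpace M] [ChartedSpace (Euc n) M]

lemma vecFun_add (X Y : VField n M) : vecFun r (X + Y) = vecFun r X + vecFun r Y := by
  ext e y
  by_cases hy : y ∈ e.1.target
  · have h : ∀ i, vcoord e (X + Y) i y = vcoord e X i y + vcoord e Y i y := fun i ↦
      congrArg (fun v : Euc n ↦ v i) (map_add (e.D (e.1.symm y)) _ _)
    simp [vecFun, hy, vecP, h, add_smul, Finset.sum_add_distrib]
  · simp [vecFun, hy]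

lemma vecFun_smul (c : ℝ) (X : VField n M) : vecFun r (c • X) = c • vecFun r X := by
  ext e y
  by_cases hy : y ∈ e.1.target
  · have h : ∀ i, vcoord e (c • X) i y = c * vcoord e X i y := fun i ↦
      congrArg (fun v : Euc n ↦ v i) (map_smul (e.D (e.1.symm y)) c _)
    simp [vecFun, hy, vecP, h, Finset.smul_sum, smul_smul]
  · simp [vecFun, hy]

lemma formFun_add {k : ℕ} (α β : Form n M k) : formFun r (α + β) = formFun r α + formFun r β := by
  ext e y
  by_cases hy : y ∈ e.1.target
  · rw [Pi.add_apply, Pi.add_apply, formFun_apply _ hy, formFun_apply _ hy, formFun_apply _ hy,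
      ← altPoly_add]
    rfl
  · simp [formFun, hy]

lemma formFun_smul {k : ℕ} (c : ℝ) (α : Form n M k) : formFun r (c • α) = c • formFun r α := by
  ext e y
  by_cases hy : y ∈ e.1.target
  · rw [Pi.smul_apply, Pi.smul_apply, formFun_apply _ hy, formFun_apply _ hy, ← altPoly_smul]
    rfl
  · simp [formFun, hy]

@[simp] lemma vecFun_zero : vecFun r (0 : VField n M) = 0 := by
  simpa using vecFun_smul (r := r) 0 (0 : VField n M)

lemma vecFun_neg (X : VField n M) : vecFun r (-X) = -vecFun r X := by
  refine eq_neg_of_add_eq_zero_left ?_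
  rw [← vecFun_add, neg_add_cancel, vecFun_zero]

@[simp] lemma formFun_zero {k : ℕ} : formFun r (0 : Form n M k) = 0 := by
  simpa using formFun_smul (r := r) 0 (0 : Form n M k)

/-- An inhomogeneous form as a function on `T*[r]T[1]M`. -/
noncomputable def formTotal (r : ℕ) (α : TotalForm n M) : Large n r M :=
  ∑ k ∈ Finset.range (n + 1), formFun r (α k)

/-- The freedom in the upper bound absorbs the shifts of degree by one under contraction and `d`. -/
lemma formTotal_eq_sum (α : TotalForm n M) {N : ℕ} (hN : n + 1 ≤ N) :
    formTotal r α = ∑ k ∈ Finset.range N, formFun r (α k) :=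
  Finset.sum_subset (Finset.range_subset_range.2 hN) fun k _ hk ↦
    formFun_eq_zero_of_lt (by simpa using hk) _

lemma formTotal_add (α β : TotalForm n M) :
    formTotal r (α + β) = formTotal r α + formTotal r β := by
  simp [formTotal, formFun_add, Finset.sum_add_distrib]

lemma formTotal_smul (c : ℝ) (α : TotalForm n M) : formTotal r (c • α) = c • formTotal r α := by
  simp [formTotal, formFun_smul, Finset.smul_sum]

lemma formTotal_sub (α β : TotalForm n M) :
    formTotal r (α - β) = formTotal r α - formTotal r β := by
  refine eq_sub_of_add_eq ?_
  rw [← formTotal_add, sub_add_cancel]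

lemma formTotal_single {k : ℕ} (α : Form n M k) : formTotal r (Pi.single k α) = formFun r α := by
  rw [formTotal_eq_sum (N := n + 1 + k + 1) _ (by omega), Finset.sum_eq_single k]
  · rw [Pi.single_eq_same]
  · intro j _ hj
    rw [Pi.single_eq_of_ne hj, formFun_zero]
  · intro h
    exact absurd (Finset.mem_range.2 (by omega)) h

lemma formTotal_mem {α : TotalForm n M} (hα : ∀ k, α k ∈ smoothForm n M k) :
    formTotal r α ∈ ⨆ k, gLarge n M r k :=
  sum_mem fun k _ ↦ mem_iSup_gLarge (formFun_mem (hα k))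

lemma largeBracket_formTotal_formTotal {α β : TotalForm n M} (hα : ∀ k, α k ∈ smoothForm n M k)
    (hβ : ∀ k, β k ∈ smoothForm n M k) : largeBracket (formTotal r α) (formTotal r β) = 0 := by
  have hL := isGradedLie_gLarge n r M
  rw [formTotal, hL.br_sum_left (formTotal_mem hβ) _ _ fun k _ ↦
    mem_iSup_gLarge (formFun_mem (hα k))]
  refine Finset.sum_eq_zero fun k _ ↦ ?_
  rw [formTotal, hL.br_sum_right (mem_iSup_gLarge (formFun_mem (hα k))) _ _ fun k _ ↦
    mem_iSup_gLarge (formFun_mem (hβ k))]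
  exact Finset.sum_eq_zero fun l _ ↦ largeBracket_formFun_formFun (hα k) (hβ l)

lemma parity_smooth {α : TotalForm n M} (hα : ∀ k, α k ∈ smoothForm n M k) (k : ℕ) :
    parity r α k ∈ smoothForm n M k := Submodule.smul_mem _ _ (hα k)

variable [IsManifold 𝓘(ℝ, Euc n) ∞ M]

lemma largeBracket_vecFun_formTotal {X : VField n M} (hX : X ∈ smoothVField n M)
    {α : TotalForm n M} (hα : ∀ k, α k ∈ smoothForm n M k) :
    largeBracket (vecFun r X) (formTotal r α) = formTotal r (contr X α) := by
  -- With `n + 2` terms, dropping the function component, which is killed, leaves the `n + 1`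
  -- contractions that make up the right side.
  rw [formTotal_eq_sum (N := n + 2) α (by omega), (isGradedLie_gLarge n r M).br_sum_right
    (mem_iSup_gLarge (vecFun_mem hX)) _ _ fun k _ ↦ mem_iSup_gLarge (formFun_mem (hα k)),
    Finset.sum_range_succ', largeBracket_vecFun_formFun_zero hX (hα 0), add_zero]
  exact Finset.sum_congr rfl fun k _ ↦ largeBracket_vecFun_formFun hX (hα (k + 1))

lemma largeBracket_canonicalS_formTotal {α : TotalForm n M} (hα : ∀ k, α k ∈ smoothForm n M k) :
    largeBracket (canonicalS n r M) (formTotal r α) = formTotal r (deRham α) := by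
  rw [formTotal_eq_sum (N := n + 2) (deRham α) (by omega), Finset.sum_range_succ', formTotal,
    (isGradedLie_gLarge n r M).br_sum_right (mem_iSup_gLarge (canonicalS_mem M)) _ _ fun k _ ↦
      mem_iSup_gLarge (formFun_mem (hα k)), deRham, formFun_zero, add_zero]
  exact Finset.sum_congr rfl fun k _ ↦ largeBracket_canonicalS_formFun (hα k)

lemma contr_smooth {X : VField n M} (hX : X ∈ smoothVField n M)
    {α : TotalForm n M} (hα : ∀ k, α k ∈ smoothForm n M k) (k : ℕ) :
    contr X α k ∈ smoothForm n M k := contr_mem hX (hα (k + 1))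

lemma largeBracket_lieFun_formTotal {Y : VField n M} (hY : Y ∈ smoothVField n M)
    {α : TotalForm n M} (hα : ∀ k, α k ∈ smoothForm n M k) :
    largeBracket (lieFun r Y) (formTotal r α) = formTotal r (lieD Y α) := by
  rw [largeBracket_lieFun hY (formTotal_mem hα), largeBracket_vecFun_formTotal hY hα,
    largeBracket_canonicalS_formTotal (contr_smooth hY hα), largeBracket_canonicalS_formTotal hα,
    largeBracket_vecFun_formTotal hY (deRham_mem hα), lieD, formTotal_add]

lemma largeBracket_formTotal_vecFun {X : VField n M} (hX : X ∈ smoothVField n M)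
    {α : TotalForm n M} (hα : ∀ k, α k ∈ smoothForm n M k) :
    largeBracket (formTotal r α) (vecFun r X) = -formTotal r (contr X (parity r α)) := by
  have hL := isGradedLie_gLarge n r M
  have hXm := mem_iSup_gLarge (vecFun_mem (r := r) hX)
  rw [← largeBracket_vecFun_formTotal hX (parity_smooth hα), formTotal,
    hL.br_sum_left hXm _ _ fun k _ ↦ mem_iSup_gLarge (formFun_mem (hα k)), formTotal,
    hL.br_sum_right hXm _ _ fun k _ ↦ mem_iSup_gLarge (formFun_mem (parity_smooth hα k)),
    ← Finset.sum_neg_distrib]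
  refine Finset.sum_congr rfl fun k _ ↦ ?_
  rw [largeBracket_skew (formFun_mem (hα k)) (vecFun_mem hX), parity, formFun_smul,
    largeBracket_smul_right _ (mem_iSup_gLarge (formFun_mem (hα k))),
    -- The sign of skew symmetry against an element of degree `-1` has the parity of `k - r`, which
    -- is the twist in `parity`.
    neg_one_zpow_congr (show Even (((k : ℤ) - r) * -1 - (k - r)) from ⟨-(k - r), by ring⟩)]

lemma largeBracket_formTotal_lieFun {Y : VField n M} (hY : Y ∈ smoothVField n M)
    {α : TotalForm n M} (hα : ∀ k, α k ∈ smoothForm n M k) :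
    largeBracket (formTotal r α) (lieFun r Y) = -formTotal r (lieD Y α) := by
  have hL := isGradedLie_gLarge n r M
  have hYm := mem_iSup_gLarge (lieFun_mem (r := r) hY)
  rw [← largeBracket_lieFun_formTotal hY hα, formTotal,
    hL.br_sum_left hYm _ _ fun k _ ↦ mem_iSup_gLarge (formFun_mem (hα k)),
    hL.br_sum_right hYm _ _ fun k _ ↦ mem_iSup_gLarge (formFun_mem (hα k)),
    ← Finset.sum_neg_distrib]
  refine Finset.sum_congr rfl fun k _ ↦ ?_
  rw [largeBracket_skew (formFun_mem (hα k)) (lieFun_mem hY), mul_zero, zpow_zero, one_smul]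

lemma lieFun_add {X Y : VField n M} (hX : X ∈ smoothVField n M) (hY : Y ∈ smoothVField n M) :
    lieFun r (X + Y) = lieFun r X + lieFun r Y := by
  rw [lieFun, vecFun_add, largeBracket_add_right (mem_iSup_gLarge (vecFun_mem hX))
    (mem_iSup_gLarge (vecFun_mem hY))]
  rfl

lemma lieFun_smul (c : ℝ) {X : VField n M} (hX : X ∈ smoothVField n M) :
    lieFun r (c • X) = c • lieFun r X := by
  rw [lieFun, vecFun_smul, largeBracket_smul_right c (mem_iSup_gLarge (vecFun_mem hX))]
  rfl

@[simp] lemma lieFun_zero : lieFun r (0 : VField n M) = 0 := by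
  simpa using lieFun_smul (r := r) 0 (zero_mem (smoothVField n M))

variable (n M) in
/-- The triples of a smooth vector field, a smooth vector field and a smooth form. -/
def smoothSmall : Submodule ℝ (Small n M) where
  carrier := {a | a.1 ∈ smoothVField n M ∧ a.2.1 ∈ smoothVField n M ∧
    ∀ k, a.2.2 k ∈ smoothForm n M k}
  add_mem' ha hb := ⟨add_mem ha.1 hb.1, add_mem ha.2.1 hb.2.1,
    fun k ↦ add_mem (ha.2.2 k) (hb.2.2 k)⟩
  zero_mem' := ⟨zero_mem _, zero_mem _, fun _ ↦ zero_mem _⟩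
  smul_mem' c _ ha := ⟨Submodule.smul_mem _ c ha.1, Submodule.smul_mem _ c ha.2.1,
    fun k ↦ Submodule.smul_mem _ c (ha.2.2 k)⟩

/-- The function on `T*[r]T[1]M` attached to `ι_X + L_Y + α`. -/
noncomputable def toLarge (r : ℕ) (a : Small n M) : Large n r M :=
  vecFun r a.1 + lieFun r a.2.1 + formTotal r a.2.2

variable {a b : Small n M}

lemma toLarge_add (ha : a ∈ smoothSmall n M) (hb : b ∈ smoothSmall n M) :
    toLarge r (a + b) = toLarge r a + toLarge r b := by
  simp only [toLarge, Prod.fst_add, Prod.snd_add, vecFun_add, lieFun_add ha.2.1 hb.2.1,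
    formTotal_add]
  abel

lemma toLarge_smul (c : ℝ) (ha : a ∈ smoothSmall n M) :
    toLarge r (c • a) = c • toLarge r a := by
  simp only [toLarge, Prod.smul_fst, Prod.smul_snd, vecFun_smul, lieFun_smul c ha.2.1,
    formTotal_smul, smul_add]

lemma toLarge_apply (ha : a ∈ smoothSmall n M) {e : Chart n M} {y : Euc n} (hy : y ∈ e.1.target) :
    toLarge r a e y = vecP r (vcoord e a.1) y + vecL r (vcoord e a.2.1) y +
      ∑ k ∈ Finset.range (n + 1), altPoly r (formInChart e.1 (a.2.2 k) y) := by
  simp [toLarge, formTotal, vecFun_apply _ hy, lieFun_apply ha.2.1 hy, formFun_apply _ hy]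

lemma toLarge_mem_gLarge {k : ℤ} (ha : a ∈ gSmall n M r k) : toLarge r a ∈ gLarge n M r k := by
  obtain ⟨⟨h1, h2⟩, ⟨h3, h4⟩, h5⟩ := ha
  refine add_mem (add_mem ?_ ?_) (sum_mem fun j _ ↦ ?_)
  · by_cases hk : k = -1
    · rw [hk]; exact vecFun_mem h1
    · rw [h2 hk, vecFun_zero]; exact zero_mem _
  · by_cases hk : k = 0
    · rw [hk]; exact lieFun_mem h3
    · rw [h4 hk, lieFun_zero]; exact zero_mem _
  · by_cases hk : k = (j : ℤ) - r
    · rw [hk]; exact formFun_mem (h5 j).1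
    · rw [(h5 j).2 hk, formFun_zero]; exact zero_mem _

/-- Coefficients have definite degrees: extracting `pᵢ` from a function of degree `k + r` leaves
degree `k + 1`, extracting `Pᵢ` leaves degree `k`, and at `p = P = 0` a `j`-form needs `j = k + r`.
In any other degree the component must vanish. -/
lemma mem_gSmall_of_toLarge_mem {k : ℤ} (ha : a ∈ smoothSmall n M)
    (h : toLarge r a ∈ gLarge n M r k) : a ∈ gSmall n M r k := by
  refine ⟨⟨ha.1, fun hk ↦ ?_⟩, ⟨ha.2.1, fun hk ↦ ?_⟩, fun j ↦ ⟨ha.2.2 j, fun hk ↦ ?_⟩⟩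
  · refine eq_zero_of_vectorField_eq_zero fun e y hy ↦ ?_
    ext i
    have h0 := aug_eq_zero (by simp only [Gen.deg]; omega)
      (leftPartial_mem_degree (.p i) (h.2.1 e y hy))
    rw [toLarge_apply ha hy, map_add, map_add, map_add, map_add, aug_leftPartial_p_vecL,
      leftPartial_p_vecP] at h0
    simpa [leftPartial_altPoly_of_ne (.p i), Chart.vcoord_eq] using h0
  · refine eq_zero_of_vectorField_eq_zero fun e y hy ↦ ?_
    ext i
    have h0 := aug_eq_zero (by simp only [Gen.deg]; omega)
      (leftPartial_mem_degree (.P i) (h.2.1 e y hy))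
    rw [toLarge_apply ha hy, map_add, map_add, map_add, map_add, aug_leftPartial_P_vecL,
      leftPartial_P_vecP] at h0
    simpa [leftPartial_altPoly_of_ne (.P i), Chart.vcoord_eq] using h0
  · refine eq_zero_of_formInChart_eq_zero fun e y hy ↦ ?_
    by_cases hj : n < j
    · exact alternatingMap_eq_zero_of_lt hj _
    refine eq_zero_of_altPoly_eq_zero (r := r) _ ?_
    -- `formPart` removes both vector field terms; the projection to degree `j` then isolates the
    -- `j`-form in the sum.
    have h0 := degreeProj_of_mem (m := j) (formPart_mem_degree (h.2.1 e y hy))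
    rw [toLarge_apply ha hy, if_neg (by omega), map_add, map_add (formPart n r), formPart_vecP,
      formPart_vecL, add_zero, zero_add, map_sum, map_sum, Finset.sum_eq_single j] at h0
    · rwa [formPart_altPoly, degreeProj_of_mem (altPoly_mem_degree _), if_pos rfl] at h0
    · intro l _ hl
      rw [formPart_altPoly, degreeProj_of_mem (altPoly_mem_degree _), if_neg (by exact_mod_cast hl)]
    · intro h'
      exact absurd (Finset.mem_range.2 (by omega)) h'

lemma mem_gSmall_iff {k : ℤ} :
    a ∈ gSmall n M r k ↔ a ∈ smoothSmall n M ∧ toLarge r a ∈ gLarge n M r k :=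
  ⟨fun h ↦ ⟨⟨h.1.1, h.2.1.1, fun j ↦ (h.2.2 j).1⟩, toLarge_mem_gLarge h⟩,
    fun h ↦ mem_gSmall_of_toLarge_mem h.1 h.2⟩

/-- The zero function lies in every degree, so `a` lies in every `gSmall n M r k`; for each
component one picks a `k` different from its degree. -/
lemma eq_zero_of_toLarge_eq_zero (ha : a ∈ smoothSmall n M) (h : toLarge r a = 0) : a = 0 := by
  have hk : ∀ k, a ∈ gSmall n M r k := fun k ↦
    mem_gSmall_of_toLarge_mem ha (by rw [h]; exact zero_mem _)
  refine Prod.ext ((hk 0).1.2 (by norm_num)) (Prod.ext ((hk 1).2.1.2 one_ne_zero) ?_)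
  ext1 j
  exact ((hk (j - r + 1)).2.2 j).2 (by omega)

lemma smallD₀_mem (ha : a ∈ smoothSmall n M) : smallD₀ a ∈ smoothSmall n M :=
  ⟨zero_mem _, ha.1, deRham_mem ha.2.2⟩

lemma smallBracket_mem (ha : a ∈ smoothSmall n M) (hb : b ∈ smoothSmall n M) :
    smallBracket r a b ∈ smoothSmall n M :=
  ⟨add_mem (mlieBracket_mem ha.2.1 hb.1) (mlieBracket_mem ha.1 hb.2.1),
    mlieBracket_mem ha.2.1 hb.2.1, fun k ↦ sub_mem (sub_mem (add_mem (contr_smooth ha.1 hb.2.2 k)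
      (lieD_mem ha.2.1 hb.2.2 k)) (contr_smooth hb.1 (parity_smooth ha.2.2) k))
      (lieD_mem hb.2.1 ha.2.2 k)⟩

lemma toLarge_smallD₀ (ha : a ∈ smoothSmall n M) :
    toLarge r (smallD₀ a) = largeBracket (canonicalS n r M) (toLarge r a) := by
  have hX := mem_iSup_gLarge (vecFun_mem (r := r) ha.1)
  have hY := mem_iSup_gLarge (lieFun_mem (r := r) ha.2.1)
  have h : largeBracket (canonicalS n r M) (lieFun r a.2.1) = 0 :=
    largeBracket_canonicalS_largeBracket (mem_iSup_gLarge (vecFun_mem ha.2.1))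
  rw [toLarge, toLarge, largeBracket_add_right (add_mem hX hY) (formTotal_mem ha.2.2),
    largeBracket_add_right hX hY, largeBracket_canonicalS_formTotal ha.2.2, h]
  simp [smallD₀, lieFun]

lemma toLarge_smallBracket (ha : a ∈ smoothSmall n M) (hb : b ∈ smoothSmall n M) :
    toLarge r (smallBracket r a b) = largeBracket (toLarge r a) (toLarge r b) := by
  have hX := mem_iSup_gLarge (vecFun_mem (r := r) ha.1)
  have hY := mem_iSup_gLarge (lieFun_mem (r := r) ha.2.1)
  have hα := formTotal_mem (r := r) ha.2.2
  have hX' := mem_iSup_gLarge (vecFun_mem (r := r) hb.1)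
  have hY' := mem_iSup_gLarge (lieFun_mem (r := r) hb.2.1)
  have hα' := formTotal_mem (r := r) hb.2.2
  -- Skew symmetry in the large algebra produces `-[b, a]`, while `smallBracket` is written with
  -- `[a, b]`.
  have h1 : vecFun r (VectorField.mlieBracket 𝓘(ℝ, Euc n) a.1 b.2.1) =
      -vecFun r (VectorField.mlieBracket 𝓘(ℝ, Euc n) b.2.1 a.1) := by
    rw [← vecFun_neg, ← VectorField.mlieBracket_swap]
  rw [toLarge, toLarge, toLarge, largeBracket_add_left (add_mem hX hY) hα,
    largeBracket_add_left hX hY, largeBracket_add_right (add_mem hX' hY') hα',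
    largeBracket_add_right (add_mem hX' hY') hα', largeBracket_add_right (add_mem hX' hY') hα',
    largeBracket_add_right hX' hY', largeBracket_add_right hX' hY', largeBracket_add_right hX' hY',
    largeBracket_vecFun_vecFun ha.1 hb.1, largeBracket_vecFun_lieFun ha.1 hb.2.1,
    largeBracket_vecFun_formTotal ha.1 hb.2.2, largeBracket_lieFun_vecFun hb.1 ha.2.1,
    largeBracket_lieFun_lieFun ha.2.1 hb.2.1, largeBracket_lieFun_formTotal ha.2.1 hb.2.2,
    largeBracket_formTotal_vecFun hb.1 ha.2.2, largeBracket_formTotal_lieFun hb.2.1 ha.2.2,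
    largeBracket_formTotal_formTotal ha.2.2 hb.2.2]
  simp only [smallBracket, vecFun_add, formTotal_sub, formTotal_add, h1]
  abel

lemma single_mem {k : ℕ} {σ : Form n M k} (hσ : σ ∈ smoothForm n M k) :
    ((0, 0, Pi.single k σ) : Small n M) ∈ smoothSmall n M := by
  refine ⟨zero_mem _, zero_mem _, fun j ↦ ?_⟩
  by_cases hj : j = k
  · subst hj
    simpa using hσ
  · simp [Pi.single_eq_of_ne hj]

lemma smallD_mem {σ : Form n M (r + 1)} (hσ : σ ∈ smoothForm n M (r + 1))
    (ha : a ∈ smoothSmall n M) : smallD σ a ∈ smoothSmall n M :=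
  add_mem (smallD₀_mem ha) (smallBracket_mem (single_mem hσ) ha)

lemma toLarge_smallD {σ : Form n M (r + 1)} (hσ : σ ∈ smoothForm n M (r + 1))
    (ha : a ∈ smoothSmall n M) : toLarge r (smallD σ a) = largeD σ (toLarge r a) := by
  have h : toLarge r ((0, 0, Pi.single (r + 1) σ) : Small n M) = formFun r σ := by
    simp [toLarge, formTotal_single]
  rw [smallD, toLarge_add (smallD₀_mem ha) (smallBracket_mem (single_mem hσ) ha),
    toLarge_smallD₀ ha, toLarge_smallBracket (single_mem hσ) ha, h, largeD,
    largeBracket_add_left (mem_iSup_gLarge (canonicalS_mem M)) (mem_iSup_gLarge (formFun_mem hσ))]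

/-- The master equation: `{𝒮, 𝒮}` and `{σ, σ}` vanish identically, and the cross terms are multiples
of `dσ`. This is where closedness of `σ` enters. -/
theorem isDGLA_gLarge {σ : Form n M (r + 1)} (hσ : σ ∈ smoothForm n M (r + 1))
    (hdσ : extD σ = 0) : IsDGLA (gLarge n M r) (largeD σ) largeBracket := by
  have hS := canonicalS_mem (n := n) (r := r) M
  have hσm : formFun r σ ∈ gLarge n M r 1 := by
    have := formFun_mem (r := r) hσ
    rwa [show ((r + 1 : ℕ) : ℤ) - r = 1 by push_cast; ring] at this
  have hS' := mem_iSup_gLarge hS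
  have hσ' := mem_iSup_gLarge hσm
  have h1 : largeBracket (canonicalS n r M) (formFun r σ) = 0 := by
    rw [largeBracket_canonicalS_formFun hσ, hdσ, formFun_zero]
  refine (isGradedLie_gLarge n r M).isDGLA (add_mem hS hσm) ?_
  rw [largeBracket_add_left hS' hσ', largeBracket_add_right hS' hσ',
    largeBracket_add_right hS' hσ', largeBracket_canonicalS_canonicalS, h1,
    largeBracket_skew hσm hS, h1, largeBracket_formFun_formFun hσ hσ]
  simp

theorem isDGLA_gSmall {σ : Form n M (r + 1)} (hσ : σ ∈ smoothForm n M (r + 1))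
    (hdσ : extD σ = 0) : IsDGLA (gSmall n M r) (smallD σ) (smallBracket r) :=
  (isDGLA_gLarge hσ hdσ).of_injective (smoothSmall n M) (toLarge r)
    (fun _ ha _ hb ↦ toLarge_add ha hb) (fun c _ ha ↦ toLarge_smul c ha)
    (fun _ ha ↦ eq_zero_of_toLarge_eq_zero ha) (fun _ _ ↦ mem_gSmall_iff)
    (fun _ ha ↦ smallD_mem hσ ha) (fun _ ha _ hb ↦ smallBracket_mem ha hb)
    (fun _ ha ↦ toLarge_smallD hσ ha) fun _ ha _ hb ↦ toLarge_smallBracket ha hb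

lemma iSup_gSmall_le : ⨆ k, gSmall n M r k ≤ smoothSmall n M :=
  iSup_le fun _ _ ha ↦ (mem_gSmall_iff.1 ha).1

lemma toLarge_mem_iSup (ha : a ∈ smoothSmall n M) : toLarge r a ∈ ⨆ k, gLarge n M r k :=
  add_mem (add_mem (mem_iSup_gLarge (vecFun_mem ha.1)) (mem_iSup_gLarge (lieFun_mem ha.2.1)))
    (formTotal_mem ha.2.2)

variable (n r M) in
/-- The map `ι_X + L_Y + α ↦ Xⁱ pᵢ + (Yⁱ Pᵢ + (∂Yⁱ/∂xʲ) vʲ pᵢ) + α_I vᴵ`. -/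
noncomputable def smallToLarge : ↥(⨆ k, gSmall n M r k) →ₗ[ℝ] ↥(⨆ k, gLarge n M r k) where
  toFun a := ⟨toLarge r a.1, toLarge_mem_iSup (iSup_gSmall_le a.2)⟩
  map_add' a b := Subtype.ext (toLarge_add (iSup_gSmall_le a.2) (iSup_gSmall_le b.2))
  map_smul' c a := Subtype.ext (toLarge_smul c (iSup_gSmall_le a.2))

lemma coe_smallToLarge (a : ↥(⨆ k, gSmall n M r k)) :
    (smallToLarge n r M a : Large n r M) = toLarge r a.1 := rfl

end HigherCourant

theorem mainTheorem7 (n r : ℕ) (M : Type*) [TopologicalSpace M] [ChartedSpace (Euc n) M]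
    [IsManifold 𝓘(ℝ, Euc n) ∞ M]
    (σ : Form n M (r + 1)) (hσ : σ ∈ smoothForm n M (r + 1)) (hdσ : extD σ = 0) :
    IsDGLA (gSmall n M r) (smallD σ) (smallBracket r) ∧
    IsDGLA (gLarge n M r) (largeD σ) largeBracket ∧
    ∃! φ : ↥(⨆ k, gSmall n M r k) →ₗ[ℝ] ↥(⨆ k, gLarge n M r k),
      IsDGLAHom (gSmall n M r) (smallD σ) (smallBracket r)
        (gLarge n M r) (largeD σ) largeBracket φ ∧
      Function.Injective φ ∧
      ∀ (X Y : VField n M) (α : TotalForm n M) (h : (X, Y, α) ∈ ⨆ k, gSmall n M r k)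
        (e : Chart n M), ∀ y ∈ e.1.target,
        (φ ⟨(X, Y, α), h⟩ : Large n r M) e y =
          ∑ i, vcoord e X i y • var r (.p i) +
          ∑ i, (vcoord e Y i y • var r (.P i) +
            ∑ j, fderiv ℝ (vcoord e Y i) y (basisVec j) • (var r (.v j) * var r (.p i))) +
          ∑ k ∈ Finset.range (n + 1), formPoly r e (α k) y := by
  have hs : ∀ {a}, a ∈ ⨆ k, gSmall n M r k → a ∈ smoothSmall n M := fun ha ↦ iSup_gSmall_le ha
  refine ⟨isDGLA_gSmall hσ hdσ, isDGLA_gLarge hσ hdσ, smallToLarge n r M,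
    ⟨⟨fun i a ha ↦ toLarge_mem_gLarge ha, fun a b h ↦ ?_, fun a b c h ↦ ?_⟩, ?_,
      fun X Y α h e y hy ↦ toLarge_apply (hs h) hy⟩, fun ψ ⟨_, _, hψ⟩ ↦ ?_⟩
  · rw [coe_smallToLarge, coe_smallToLarge, h, toLarge_smallD hσ (hs a.2)]
  · rw [coe_smallToLarge, coe_smallToLarge, coe_smallToLarge, h,
      toLarge_smallBracket (hs a.2) (hs b.2)]
  · rw [injective_iff_map_eq_zero]
    exact fun a ha ↦ Subtype.ext (eq_zero_of_toLarge_eq_zero (hs a.2) (congrArg Subtype.val ha))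
  -- Uniqueness uses only the coordinate formula: it fixes the values over every chart, and global
  -- functions vanish off the chart targets by convention.
  · ext1 a
    refine Subtype.ext (large_ext (fun e y hy ↦ ?_) (ψ a).2 (smallToLarge n r M a).2)
    exact (hψ a.1.1 a.1.2.1 a.1.2.2 a.2 e y hy).trans (toLarge_apply (hs a.2) hy).symm
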